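/- For integers $k,n\ge 0$ let $\triangle_k(n)$ be the coefficient of $q^n$ in $\big(\sum_{j\ge 0}q^{j(j+1)/2}\big)^k$, that is, the number of ordered representations of $n$ as a sum of $k$ triangular numbers. For integers $x\ge 0$, $y\ge 1$ with $y\nmid x$, read $\triangle_k(x/y)$ as $0$. Below, $d\ge1$, $m\ge0$ and $x\ge0$ are integers, the sums run over integers $k_1,\dots,k_m,l_1,\dots,l_m$, products over pairs are over $1\le i<j\le m$, congruence conditions on the indices are modulo the number in parentheses, and empty products are $1$. (1) Let $S^1_{d,m}(x)$ be the set of $(k,l)$ with $k_1l_1+\dots+k_ml_m=m^2+x$, all $k_i$ and $l_i$ odd positive, $k_i\equiv\pm(2i-1)\ (2d)$ for all $i$, and $k_i<k_j$ whenever $i<j$ and $k_i\equiv\pm k_j\ (2d)$. (1a) If $d$ is odd and $d\mid m$, then $$\sum_{(k,l)\in S^1_{d,m}(x)}(-1)^{|\{i;\,k_i\equiv d+2,d+4,\dots,2d-1\,(2d)\}|}\prod_{k_i\equiv d\,(2d)}k_i\prod_{k_i\equiv k_j\,(2d)}(k_j-k_i)^2\prod_{k_i\equiv -k_j\,(2d)}(k_j+k_i)^2$$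 $$=(-1)^{\frac{d-1}2\frac md}\big(2^{2m-d-1}d^{2m-d}\big)^{m/d}\prod_{l=1}^{(2m-d)/d}l!^d\ \triangle_{4m^2/d}(x/2d).$$ (1b) If $d$ is even and $d\mid 2m$, then $$\sum_{(k,l)\in S^1_{d,m}(x)}(-1)^{|\{i;\,k_i\equiv d+1,d+3,\dots,2d-1\,(2d)\}|}\prod_{k_i\equiv k_j\,(2d)}(k_j-k_i)^2\prod_{k_i\equiv -k_j\,(2d)}(k_j+k_i)^2$$ $$=(-1)^{\frac d2\binom{2m/d}2}(2d)^{(2m-d)m/d}\prod_{l=1}^{(2m-d)/d}l!^d\ \triangle_{4m^2/d}(x/2d).$$ (2) Let $S^2_{d,m}(x)$ be the set of $(k,l)$ with $k_1l_1+\dots+k_ml_m=\frac12m(m+1)+x$, all $k_i$ positive, all $l_i$ odd positive, $k_i\equiv\pm i\ (d)$ for all $i$, and $k_i<k_j$ whenever $i<j$ and $k_i\equiv\pm k_j\ (d)$. (2a) If $d$ is odd and $d\mid m$ or $d\mid m+1$, then $$\sum_{(k,l)\in S^2_{d,m}(x)}(-1)^{|\{i;\,k_i\equiv\frac{d+1}2,\frac{d+3}2,\dots,d-1\,(d)\}|}\prod_{k_i\equiv0\,(d)}k_i^3\prod_{k_i\equiv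 k_j\,(d)}(k_j-k_i)^2\prod_{k_i\equiv-k_j\,(d)}(k_i+k_j)^2=A\,d^{(2m+2-d)m/d}\,\triangle_{4m(m+1)/d}(x/d),$$ $$A=\begin{cases}(-1)^{\binom{d-1}2\binom{2m/d}2}\,2^{-m/d}\,(2m/d)!\,\prod_{l=1}^{(2m-d)/d}l!^d,&d\mid m,\\(-1)^{\binom{d-1}2\binom{2(m+1)/d}2}\,2^{-(m+1-d)/d}\,\big((2m+2-d)/d\big)!^{-1}\prod_{l=1}^{(2m+2-d)/d}l!^d,&d\mid m+1.\end{cases}$$ (2b) If $d$ is even and $d\mid 2m$ or $d\mid 2m+2$, then $$\sum_{(k,l)\in S^2_{d,m}(x)}(-1)^{|\{i;\,k_i\equiv\frac{d+2}2,\frac{d+4}2,\dots,d-1\,(d)\}|}\prod_{k_i\equiv0\,(d)}k_i^3\prod_{k_i\equiv d/2\,(d)}k_i\prod_{k_i\equiv k_j\,(d)}(k_j-k_i)^2\prod_{k_i\equiv-k_j\,(d)}(k_i+k_j)^2=B\,d^{(2m+2-d)m/d}\,\triangle_{4m(m+1)/d}(x/d),$$ $$B=\begin{cases}(-1)^{\binom{d-1}2\binom{2m/d}2}\,2^{-2m/d}\,(2m/d)!\,\prod_{l=1}^{(2m-d)/d}l!^d,&d\mid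 2m,\\(-1)^{\binom{d-1}2\binom{2(m+1)/d}2}\,2^{-(2m+2-d)/d}\,\big((2m+2-d)/d\big)!^{-1}\prod_{l=1}^{(2m+2-d)/d}l!^d,&d\mid 2m+2.\end{cases}$$ Here the residues in the exponents of $-1$ run upwards through consecutive integers in (2a), (2b), and in steps of $2$ in (1a), (1b), and the list is empty if its first member exceeds the last. In (2a) and (2b), when both divisibility conditions hold, the identity holds with either expression for the constant. (3) In particular, the following special cases hold. For $m\ge1$ (Getz and Mahlburg) $$\sum_{\substack{k_1l_1+\dots+k_ml_m=m^2+x\\k_i,\,l_i\text{ odd positive}\\k_i\equiv\pm(2i-1)\,(4m)}}(-1)^{|\{i;\,k_i\equiv1-2i\,(4m)\}|}=\triangle_{2m}(x/4m),$$ and for $m\ge0$ $$\sum_{\substack{k_1l_1+\dots+k_ml_m=\frac12m(m+1)+x\\k_i\text{ positive},\ l_i\text{ odd positive}\\k_i\equiv\pm i\,(2m+2)}}(-1)^{|\{i;\,k_i\equiv-i\,(2m+2)\}|}=\triangle_{2m}(x/(2m+2)).$$ Moreover, for all integers $n\ge0$, with the $k_i$ positive and the $l_i$ odd positive in all sums,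 $$\triangle_4(n)=\sum_{\substack{k_1l_1+k_2l_2=6n+3\\k_1\equiv\pm1,\ k_2\equiv\pm2\,(6)}}(-1)^{\chi(k_1\equiv-1\,(6))+\chi(k_2\equiv-2\,(6))},\qquad \chi(\text{true})=1,\ \chi(\text{false})=0,$$ $$\triangle_6(n)=\frac12\sum_{\substack{k_1l_1+k_2l_2=4n+3\\k_1\text{ odd},\ k_2\equiv2\,(4)}}(-1)^{\frac12(k_1-1)}k_2,$$ $$\triangle_8(n)=\frac1{2^5}\Big(\sum_{\substack{k_1l_1+k_2l_2=4n+4\\k_1,k_2\text{ odd},\ k_1\equiv-k_2\,(4)}}(k_1+k_2)^2-\sum_{\substack{k_1l_1+k_2l_2=4n+4\\k_1,k_2\text{ odd},\ k_1\equiv k_2\,(4)}}(k_1-k_2)^2\Big),$$ $$\triangle_8(n)=\frac1{2\cdot3^2}\Big(\sum_{\substack{k_1l_1+k_2l_2=3n+3\\k_1\equiv-k_2\not\equiv0\,(3)}}(k_1+k_2)^2-\sum_{\substack{k_1l_1+k_2l_2=3n+3\\k_1\equiv k_2\not\equiv0\,(3)}}(k_1-k_2)^2\Big),$$ $$\triangle_{12}(n)=\frac1{2^3}\sum_{\substack{k_1l_1+k_2l_2=2n+3\\k_1\text{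 odd},\ k_2\text{ even}}}k_1k_2^3.$$ -/

import Mathlib

open Finset

/-- The generating function `∑_{j ≥ 0} q ^ (j (j + 1) / 2)` of the triangular numbers: the
coefficient of `q ^ n` is the number of `j ≥ 0` with `j (j + 1) / 2 = n`, where `j ≤ n` is
automatic. -/
def triangleSeries : PowerSeries ℕ :=
  PowerSeries.mk fun n => #{j ∈ range (n + 1) | j * (j + 1) / 2 = n}

/-- The coefficient of `q ^ n` in the `k`-th power of the generating function of the triangular
numbers. -/
noncomputable def triangleNum (k n : ℕ) : ℕ := PowerSeries.coeff n (triangleSeries ^ k)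

theorem le_of_triangle {j n : ℕ} (h : j * (j + 1) / 2 = n) : j ≤ n := by
  subst h
  rw [Nat.le_div_iff_mul_le two_pos]
  rcases j with _ | j
  · simp
  · exact Nat.mul_le_mul_left _ (by omega)

/-- `triangleNum k n` is the number of ordered representations of `n` as a sum of `k` triangular
numbers. -/
theorem triangleNum_eq_card (k n : ℕ) :
    triangleNum k n =
      #{a ∈ Fintype.piFinset fun _ : Fin k => range (n + 1) | ∑ i, a i * (a i + 1) / 2 = n} := by
  rw [triangleNum, ← Fin.prod_const, PowerSeries.coeff_prod,
    card_eq_sum_card_fiberwise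
      (f := fun a => Finsupp.equivFunOnFinite.symm fun i => a i * (a i + 1) / 2)
      (t := finsuppAntidiag univ n)]
  · refine sum_congr rfl fun l hl => ?_
    simp only [triangleSeries, PowerSeries.coeff_mk, mem_finsuppAntidiag] at hl ⊢
    rw [← Fintype.card_piFinset]
    congr 1
    ext a
    simp only [mem_filter, Fintype.mem_piFinset, mem_range, DFunLike.ext_iff,
      Finsupp.equivFunOnFinite_symm_apply_apply]
    constructor
    · intro h
      have hs : ∑ i, a i * (a i + 1) / 2 = n := by
        rw [← hl.1]
        exact sum_congr rfl fun i _ => (h i).2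
      refine ⟨⟨fun i => ?_, hs⟩, fun i => (h i).2⟩
      have h1 : a i * (a i + 1) / 2 ≤ ∑ i, a i * (a i + 1) / 2 :=
        single_le_sum (f := fun i => a i * (a i + 1) / 2) (fun _ _ => Nat.zero_le _) (mem_univ i)
      exact Nat.lt_succ_of_le ((le_of_triangle rfl).trans (hs ▸ h1))
    · rintro ⟨_, h⟩ i
      exact ⟨Nat.lt_succ_of_le (le_of_triangle (h i)), h i⟩
  · intro a ha
    have h := (mem_filter.1 (mem_coe.1 ha)).2
    simpa [mem_finsuppAntidiag] using h

/-- `triangleNum k` at the rational argument `x / y`, read as zero if `y` does not divide `x`. -/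
noncomputable def triangleNumDiv (k x y : ℕ) : ℕ := if y ∣ x then triangleNum k (x / y) else 0

/-- All pairs `(k, l)` of `m`-tuples of positive integers with `k₁ l₁ + ⋯ + k_m l_m = N`.
The bound `N` on the entries is automatic, see `mem_posSol`. -/
def posSol (m N : ℕ) : Finset ((Fin m → ℕ) × (Fin m → ℕ)) :=
  {p ∈ (Fintype.piFinset fun _ => Icc 1 N) ×ˢ (Fintype.piFinset fun _ => Icc 1 N) |
    ∑ i, p.1 i * p.2 i = N}

theorem mem_posSol {m N : ℕ} {p : (Fin m → ℕ) × (Fin m → ℕ)} :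
    p ∈ posSol m N ↔ (∀ i, 0 < p.1 i ∧ 0 < p.2 i) ∧ ∑ i, p.1 i * p.2 i = N := by
  simp only [posSol, mem_filter, mem_product, Fintype.mem_piFinset, mem_Icc]
  constructor
  · rintro ⟨⟨h1, h2⟩, h⟩
    exact ⟨fun i => ⟨(h1 i).1, (h2 i).1⟩, h⟩
  · rintro ⟨h1, h⟩
    have key : ∀ i, p.1 i * p.2 i ≤ N := fun i =>
      h ▸ single_le_sum (f := fun i => p.1 i * p.2 i) (fun _ _ => Nat.zero_le _) (mem_univ i)
    exact ⟨⟨fun i => ⟨(h1 i).1, (Nat.le_mul_of_pos_right _ (h1 i).2).trans (key i)⟩,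
      fun i => ⟨(h1 i).2, (Nat.le_mul_of_pos_left _ (h1 i).1).trans (key i)⟩⟩, h⟩

/-- `a ≡ ± b` modulo `n`. -/
abbrev CongrPM (n a b : ℤ) : Prop := a ≡ b [ZMOD n] ∨ a ≡ -b [ZMOD n]

/-- The condition "`k_i < k_j` if `i < j` and `k_i ≡ ± k_j` modulo `n`". -/
abbrev OrderedMod (n : ℕ) {m : ℕ} (k : Fin m → ℕ) : Prop :=
  ∀ i j, i < j → CongrPM n (k i) (k j) → k i < k j

/-- The pairs `(k, l)` of `m`-tuples of odd positive integers with `k₁ l₁ + ⋯ + k_m l_m = N`,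
`k_i ≡ ± (2 i - 1)` modulo `2 d` for `i = 1, …, m`, and `k_i < k_j` if `i < j` and `k_i ≡ ± k_j`
modulo `2 d`. The index `i : Fin m` starts from `0`, so that `2 i - 1` is written as
`2 * i + 1`. -/
def oddSol (d m N : ℕ) : Finset ((Fin m → ℕ) × (Fin m → ℕ)) :=
  {p ∈ posSol m N | (∀ i, Odd (p.1 i) ∧ Odd (p.2 i)) ∧
    (∀ i : Fin m, CongrPM (2 * d) (p.1 i) (2 * (i : ℤ) + 1)) ∧ OrderedMod (2 * d) p.1}

/-- The pairs `(k, l)` of `m`-tuples of positive integers, the `l_i` odd, with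
`k₁ l₁ + ⋯ + k_m l_m = N`, `k_i ≡ ± i` modulo `d` for `i = 1, …, m`, and `k_i < k_j` if `i < j`
and `k_i ≡ ± k_j` modulo `d`. The index `i : Fin m` starts from `0`, so that `i` is written as
`i + 1`. -/
def mixedSol (d m N : ℕ) : Finset ((Fin m → ℕ) × (Fin m → ℕ)) :=
  {p ∈ posSol m N | (∀ i, Odd (p.2 i)) ∧
    (∀ i : Fin m, CongrPM d (p.1 i) ((i : ℤ) + 1)) ∧ OrderedMod d p.1}

/-- The sign `(-1) ^ |{i ; k_i ≡ r (n) for some r ∈ R}|`. -/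
def residueSign (n : ℕ) (R : Finset ℕ) {m : ℕ} (k : Fin m → ℕ) : ℚ :=
  (-1) ^ #{i | ∃ r ∈ R, k i ≡ r [MOD n]}

/-- The product of `(k_j - k_i) ^ 2` over `i < j` with `k_i ≡ k_j` modulo `n`, times the product of
`(k_j + k_i) ^ 2` over `i < j` with `k_i ≡ - k_j` modulo `n`. -/
def pairProd (n : ℕ) {m : ℕ} (k : Fin m → ℕ) : ℚ :=
  (∏ p : Fin m × Fin m with p.1 < p.2 ∧ (k p.1 : ℤ) ≡ k p.2 [ZMOD n],
      ((k p.2 : ℚ) - k p.1) ^ 2) *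
    ∏ p : Fin m × Fin m with p.1 < p.2 ∧ (k p.1 : ℤ) ≡ -k p.2 [ZMOD n],
      ((k p.2 : ℚ) + k p.1) ^ 2

/-- The product `1! ^ d * 2! ^ d * ⋯ * n! ^ d`. -/
def factorialProd (n d : ℕ) : ℚ := ∏ l ∈ Icc 1 n, (l.factorial : ℚ) ^ d

/-!
# Sums of triangular numbers and Hankel determinants of Lambert series

Write `q = exp (-η)` with `η > 0`. Multiply each side of the identities in the two families by
`q ^ N`, where `N` is the exponent `∑ k_i l_i`, and sum over `N`. In the first family put `D = 2 d`,
in the second `D = d`.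

The condition `k_i ≡ ± r (D)` prescribes for each index `i` a class of integers up to sign modulo
`D`, and the products over pairs involve only pairs of indices in the same class. After attaching to
each `k` a weight and a node (`classWeight`, `classNode`), the summand is the product of the weights
and of the squared differences of the nodes within each class (`classTerm_eq`), so that the
generating function is a product over the classes (`hasSum_classSol`). By Andréief's identity
(`hasSum_hankelDet_of_key`) the factor of a class with `n` indices is the Hankel determinant of
size `n` of the moments of that class. Summing over the odd `l` turns these moments into those of
the bilateral Lambert series `∑ j, exp ((j + α) u) / (2 sinh (h (j + α)))` with `h = D η` and
`α = r / D` (`hasSum_pairWeight_generic`).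

The Lambert series `F` is a quotient of theta series in `u` (`lambertSeries_mul_theta_eq`), and the
Hankel determinants of its derivatives satisfy the Toda equation
`H (n + 2) * H n = H (n + 1) * H (n + 1)'' - H (n + 1)' ^ 2`, a case of the Desnanot–Jacobi identity
(`toda`). Theta series satisfy the same relation up to a power of `θ` (`bracket_thetaSeries`), and
the first two determinants agree; hence the determinants are theta series divided by `θ ^ (n ^ 2)`,
with explicit constants (`hankelDet_lambertSeries`). For `α = 0` the same argument applies to the
second derivative of `F` (`hankelDet_lambertSeries_zero`). At `u = 0`, Jacobi's derivative formula
(`thetaDeriv_eq`) leaves a power of `∑ j ≥ 0, q ^ (D (2 j + 1) ^ 2 / 8)`, which is the theta series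
of the triangular numbers, and for odd `n` a quotient of theta values; these quotients cancel in the
product over the classes (`prod_classDet_generic`). In the classes of `0` and `D / 2` only odd
moments occur. There the even moments of the Lambert series vanish, so its Hankel determinant of
even size is up to sign the square of the one required (`hankelDet_of_even_eq_zero`), whose sign is
determined by positivity.

Under the divisibility conditions all classes that occur, apart from those of `0` and `D / 2`,
contain equally many indices (`count_foldMod_succ`, `count_foldMod_odd`), and comparing coefficients
of powers of `q` gives both families (`sum_classSol_of_card`). The identities for 4, 6, 8 and 12
triangles are the cases with `m = 2`; in those for 8 triangles both `k_i` lie in one class, and the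
condition `k_1 < k_2` is traded for a factor `2`.
-/

/-! ### Exponential sums as power series -/

/-- All moments of the weights `w` at the points `e` converge absolutely. -/
def HasMoments {ι : Type*} (w e : ι → ℝ) : Prop :=
  ∀ p : ℕ, Summable fun i => |w i| * |e i| ^ p

/-- The exponential sum `∑ i, w i * exp (e i * u)`, as a formal power series in `u`. -/
noncomputable def expSum {ι : Type*} (w e : ι → ℝ) : PowerSeries ℝ :=
  PowerSeries.mk fun p => (∑' i, w i * e i ^ p) / (p.factorial : ℝ)

section expSum

variable {ι κ : Type*} {w w' e : ι → ℝ} {v f : κ → ℝ}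

theorem HasMoments.summable (h : HasMoments w e) (p : ℕ) : Summable fun i => w i * e i ^ p := by
  refine Summable.of_abs ?_
  simpa [abs_mul, abs_pow] using h p

theorem HasMoments.summable_weight (h : HasMoments w e) : Summable w := by
  simpa using h.summable 0

theorem HasMoments.of_abs_le (h : HasMoments w e) (hw : ∀ i, |w' i| ≤ |w i|) :
    HasMoments w' e := fun p =>
  (h p).of_nonneg_of_le (fun i => by positivity) fun i =>
    mul_le_mul_of_nonneg_right (hw i) (by positivity)

theorem HasMoments.const_mul (h : HasMoments w e) (c : ℝ) : HasMoments (fun i => c * w i) e :=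
  fun p => by simpa [abs_mul, mul_assoc] using (h p).mul_left |c|

theorem HasMoments.neg (h : HasMoments w e) : HasMoments (fun i => -w i) e :=
  h.of_abs_le fun i => by simp

theorem HasMoments.add (h : HasMoments w e) (h' : HasMoments w' e) :
    HasMoments (fun i => w i + w' i) e := fun p =>
  ((h p).add (h' p)).of_nonneg_of_le (fun i => by positivity) fun i => by
    rw [← add_mul]; gcongr; exact abs_add_le _ _

theorem HasMoments.sub (h : HasMoments w e) (h' : HasMoments w' e) :
    HasMoments (fun i => w i - w' i) e := by
  simpa [sub_eq_add_neg] using h.add h'.neg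

theorem HasMoments.mul_exponent_pow (h : HasMoments w e) (k : ℕ) :
    HasMoments (fun i => w i * e i ^ k) e := fun p => by
  simpa [abs_mul, pow_add, mul_assoc] using h (k + p)

theorem HasMoments.mul_exponent (h : HasMoments w e) : HasMoments (fun i => w i * e i) e := by
  simpa using h.mul_exponent_pow 1

theorem HasMoments.comp_injective (h : HasMoments w e) {σ : κ → ι} (hσ : σ.Injective) :
    HasMoments (w ∘ σ) (e ∘ σ) := fun p => (h p).comp_injective hσ

theorem HasMoments.scale (h : HasMoments w e) (c : ℝ) : HasMoments w (fun i => c * e i) :=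
  fun p => by
    have := (h p).mul_left (|c| ^ p)
    refine this.congr fun i => ?_
    rw [abs_mul, mul_pow]; ring

theorem HasMoments.zero_exponent (h : HasMoments w e) : HasMoments w fun _ => (0 : ℝ) := by
  simpa using h.scale 0

theorem HasMoments.prod (h : HasMoments w e) (h' : HasMoments v f) :
    HasMoments (fun x : ι × κ => w x.1 * v x.2) fun x => e x.1 + f x.2 := fun p => by
  have key : Summable fun x : ι × κ => ∑ m ∈ range (p + 1),
      ((|w x.1| * |e x.1| ^ m) * (|v x.2| * |f x.2| ^ (p - m))) * (p.choose m : ℝ) :=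
    summable_sum fun m _ => ((h m).mul_of_nonneg (h' (p - m)) (fun i => by positivity)
      fun i => by positivity).mul_right _
  refine key.of_nonneg_of_le (fun x => by positivity) fun x => ?_
  calc |w x.1 * v x.2| * |e x.1 + f x.2| ^ p
      ≤ |w x.1| * |v x.2| * (|e x.1| + |f x.2|) ^ p := by
        rw [abs_mul]; gcongr; exact abs_add_le _ _
    _ = _ := by
        rw [add_pow, mul_sum]
        exact sum_congr rfl fun m _ => by ring

theorem coeff_expSum (w e : ι → ℝ) (p : ℕ) :
    PowerSeries.coeff p (expSum w e) = (∑' i, w i * e i ^ p) / (p.factorial : ℝ) := by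
  simp [expSum]

theorem constantCoeff_expSum (w e : ι → ℝ) :
    PowerSeries.constantCoeff (expSum w e) = ∑' i, w i := by
  rw [← PowerSeries.coeff_zero_eq_constantCoeff_apply, coeff_expSum]; simp

theorem expSum_neg (w e : ι → ℝ) : expSum (fun i => -w i) e = -expSum w e := by
  ext p; simp [coeff_expSum, tsum_neg, neg_div]

theorem expSum_const_mul (c : ℝ) (w e : ι → ℝ) :
    expSum (fun i => c * w i) e = PowerSeries.C c * expSum w e := by
  ext p
  simp only [coeff_expSum, PowerSeries.coeff_C_mul, mul_assoc, tsum_mul_left, mul_div_assoc]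

theorem expSum_add (h : HasMoments w e) (h' : HasMoments w' e) :
    expSum (fun i => w i + w' i) e = expSum w e + expSum w' e := by
  ext p
  simp only [coeff_expSum, map_add, add_mul, ← add_div]
  rw [(h.summable p).tsum_add (h'.summable p)]

theorem expSum_sub (h : HasMoments w e) (h' : HasMoments w' e) :
    expSum (fun i => w i - w' i) e = expSum w e - expSum w' e := by
  ext p
  simp only [coeff_expSum, map_sub, sub_mul, ← sub_div]
  rw [(h.summable p).tsum_sub (h'.summable p)]

theorem expSum_equiv (σ : κ ≃ ι) (w e : ι → ℝ) : expSum (w ∘ σ) (e ∘ σ) = expSum w e := by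
  ext p
  simp only [coeff_expSum, Function.comp]
  rw [σ.tsum_eq fun i => w i * e i ^ p]

theorem expSum_zero_exponent (w : ι → ℝ) :
    expSum w (fun _ => 0) = PowerSeries.C (∑' i, w i) := by
  ext p
  rcases p with _ | p <;> simp [coeff_expSum, PowerSeries.coeff_C]

theorem derivative_expSum (w e : ι → ℝ) :
    PowerSeries.derivative ℝ (expSum w e) = expSum (fun i => w i * e i) e := by
  ext p
  rw [PowerSeries.coeff_derivative, coeff_expSum, coeff_expSum, Nat.factorial_succ]
  push_cast
  simp only [pow_succ' , mul_assoc]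
  field_simp

theorem expSum_mul (h : HasMoments w e) (h' : HasMoments v f) :
    expSum w e * expSum v f =
      expSum (fun x : ι × κ => w x.1 * v x.2) fun x => e x.1 + f x.2 := by
  ext p
  rw [PowerSeries.coeff_mul, coeff_expSum, Nat.sum_antidiagonal_eq_sum_range_succ_mk]
  have hs : ∀ m, Summable fun x : ι × κ => (w x.1 * e x.1 ^ m) * (v x.2 * f x.2 ^ (p - m)) :=
    fun m => summable_mul_of_summable_norm (h.summable m).norm (h'.summable (p - m)).norm
  have h1 : (∑' x : ι × κ, w x.1 * v x.2 * (e x.1 + f x.2) ^ p) =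
      ∑ m ∈ range (p + 1), (∑' x : ι × κ, (w x.1 * e x.1 ^ m) * (v x.2 * f x.2 ^ (p - m))) *
        (p.choose m : ℝ) := by
    simp_rw [← tsum_mul_right]
    rw [← Summable.tsum_finsetSum fun m _ => (hs m).mul_right _]
    refine tsum_congr fun x => ?_
    rw [add_pow, mul_sum]
    exact sum_congr rfl fun m _ => by ring
  rw [h1, sum_div]
  refine sum_congr rfl fun m hm => ?_
  have hm : m ≤ p := by simpa [Nat.lt_succ_iff] using hm
  rw [coeff_expSum, coeff_expSum,
    ← tsum_mul_tsum_of_summable_norm (h.summable m).norm (h'.summable (p - m)).norm,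
    Nat.cast_choose ℝ hm]
  field_simp

/-- Collecting the terms of a double sum along the first index. -/
theorem expSum_prod_of_exponent {w : ι × κ → ℝ} {e : ι → ℝ}
    (h : HasMoments w fun x => e x.1) :
    expSum w (fun x => e x.1) = expSum (fun i => ∑' j, w (i, j)) e := by
  ext p
  rw [coeff_expSum, coeff_expSum, (h.summable p).tsum_prod]
  simp only [tsum_mul_right]

end expSum

/-- The pairs of integers of equal parity are `(a + b, a - b)`, those of different parity are
`(a + b + 1, a - b)`. -/
def parityEquiv : (ℤ × ℤ) ⊕ (ℤ × ℤ) ≃ ℤ × ℤ where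
  toFun := Sum.elim (fun x => (x.1 + x.2, x.1 - x.2)) fun x => (x.1 + x.2 + 1, x.1 - x.2)
  invFun y := if Even (y.1 + y.2) then Sum.inl ((y.1 + y.2) / 2, (y.1 - y.2) / 2)
    else Sum.inr ((y.1 + y.2 - 1) / 2, (y.1 - y.2 - 1) / 2)
  left_inv := by
    rintro (⟨a, b⟩ | ⟨a, b⟩)
    · have : Even (a + b + (a - b)) := ⟨a, by ring⟩
      simp only [Sum.elim_inl, this, if_true, Sum.inl.injEq, Prod.mk.injEq]
      omega
    · have : ¬ Even (a + b + 1 + (a - b)) := by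
        rw [Int.not_even_iff_odd]; exact ⟨a, by ring⟩
      simp only [Sum.elim_inr, this, if_false, Sum.inr.injEq, Prod.mk.injEq]
      omega
  right_inv := by
    rintro ⟨j, k⟩
    by_cases h : Even (j + k)
    · simp only [h, if_true, Sum.elim_inl, Prod.mk.injEq]
      obtain ⟨r, hr⟩ := h
      omega
    · simp only [h, if_false, Sum.elim_inr, Prod.mk.injEq]
      rw [Int.not_even_iff_odd] at h
      obtain ⟨r, hr⟩ := h
      omega

theorem tsum_parity {f : ℤ × ℤ → ℝ} (hf : Summable f) :
    ∑' x, f x = ∑' x : ℤ × ℤ, f (x.1 + x.2, x.1 - x.2) +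
      ∑' x : ℤ × ℤ, f (x.1 + x.2 + 1, x.1 - x.2) := by
  have h := (parityEquiv.summable_iff (f := f)).2 hf
  rw [← parityEquiv.tsum_eq f]
  exact Summable.tsum_sum (f := fun x => f (parityEquiv x)) (h.comp_injective Sum.inl_injective)
    (h.comp_injective Sum.inr_injective)

/-- The parity splitting of a double sum, for exponential sums. -/
theorem expSum_parity {w e : ℤ × ℤ → ℝ} (h : HasMoments w e) :
    expSum w e = expSum (fun x : ℤ × ℤ => w (x.1 + x.2, x.1 - x.2))
        (fun x => e (x.1 + x.2, x.1 - x.2)) +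
      expSum (fun x : ℤ × ℤ => w (x.1 + x.2 + 1, x.1 - x.2))
        (fun x => e (x.1 + x.2 + 1, x.1 - x.2)) := by
  ext p
  rw [map_add, coeff_expSum, coeff_expSum, coeff_expSum, tsum_parity (h.summable p), add_div]

/-- Multiplication of two exponential sums over `ℤ` after splitting the pairs of indices by
parity, when both parts factor. -/
theorem expSum_mul_parity {w e w' e' A a B b A' a' B' b' : ℤ → ℝ}
    (h : HasMoments w e) (h' : HasMoments w' e') (hA : HasMoments A a) (hB : HasMoments B b)
    (hA' : HasMoments A' a') (hB' : HasMoments B' b')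
    (h1 : ∀ x y, w (x + y) * w' (x - y) = A x * B y)
    (h2 : ∀ x y, e (x + y) + e' (x - y) = a x + b y)
    (h3 : ∀ x y, w (x + y + 1) * w' (x - y) = A' x * B' y)
    (h4 : ∀ x y, e (x + y + 1) + e' (x - y) = a' x + b' y) :
    expSum w e * expSum w' e' = expSum A a * expSum B b + expSum A' a' * expSum B' b' := by
  rw [expSum_mul h h', expSum_mul hA hB, expSum_mul hA' hB', expSum_parity (h.prod h')]
  simp only [h1, h2, h3, h4]

/-! ### Theta series -/

theorem HasMoments.add_exponent {ι : Type*} {w e : ι → ℝ} (h : HasMoments w e) (c : ℝ) :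
    HasMoments w fun i => e i + c := by
  have h1 : HasMoments (fun _ : Unit => (1 : ℝ)) fun _ => c := fun p => (hasSum_fintype _).summable
  have h2 := (h.prod h1).comp_injective (σ := fun i => (i, ())) (Prod.mk_left_injective ())
  simpa [Function.comp_def] using h2

theorem hasMoments_gaussian {h : ℝ} (hh : 0 < h) (β x : ℝ) :
    HasMoments (fun j : ℤ => Real.exp (-h * (j + β) ^ 2)) fun j => x * (j + β) := by
  have h0 : HasMoments (fun j : ℤ => Real.exp (-h * (j + β) ^ 2)) fun j => (j : ℝ) := fun p => by
    have hb := summable_pow_mul_jacobiTheta₂_term_bound (h * |β| / Real.pi) (T := h / Real.pi)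
      (by positivity) p
    refine hb.of_nonneg_of_le (fun j => by positivity) fun j => ?_
    rw [mul_comm, Int.cast_abs, abs_of_pos (Real.exp_pos _)]
    refine mul_le_mul_of_nonneg_left (Real.exp_le_exp.2 ?_) (by positivity)
    have : Real.pi * (h / Real.pi * (j : ℝ) ^ 2 - 2 * (h * |β| / Real.pi) * |(j : ℝ)|) =
        h * (j : ℝ) ^ 2 - 2 * h * (|β| * |(j : ℝ)|) := by
      field_simp [Real.pi_ne_zero]
    rw [neg_mul, neg_mul, neg_le_neg_iff, this, ← abs_mul]
    nlinarith [neg_abs_le (β * j), mul_nonneg hh.le (sq_nonneg β),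
      mul_le_mul_of_nonneg_left (neg_abs_le (β * j)) hh.le]
  exact (h0.add_exponent β).scale x

theorem abs_neg_one_zpow_mul (j : ℤ) (x : ℝ) : |(-1 : ℝ) ^ j * x| = |x| := by
  rw [abs_mul, abs_zpow]; simp

theorem neg_one_zpow_neg (j : ℤ) : (-1 : ℝ) ^ (-j) = (-1) ^ j := by
  rw [zpow_neg, ← inv_zpow]; norm_num

theorem neg_one_zpow_succ (j : ℤ) : (-1 : ℝ) ^ (j + 1) = -(-1) ^ j := by
  rw [zpow_add_one₀ (by norm_num)]; ring

theorem neg_one_zpow_add_mul_sub (a b : ℤ) : (-1 : ℝ) ^ (a + b) * (-1) ^ (a - b) = 1 := by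
  rw [← zpow_add₀ (by norm_num), Even.neg_one_zpow ⟨a, by ring⟩]

theorem neg_one_zpow_add_one_mul_sub (a b : ℤ) :
    (-1 : ℝ) ^ (a + b + 1) * (-1) ^ (a - b) = -1 := by
  rw [neg_one_zpow_succ, neg_mul, neg_one_zpow_add_mul_sub]

/-- The coefficients `(-1) ^ j * exp (-h * (j + β) ^ 2)` of the theta series. -/
noncomputable def thetaWeight (h β : ℝ) (j : ℤ) : ℝ := (-1) ^ j * Real.exp (-h * (j + β) ^ 2)

/-- The theta series `∑ j, (-1) ^ j * exp (-h * (j + β) ^ 2) * exp (x * (j + β) * u)`, as a power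
series in `u`. -/
noncomputable def thetaSeries (h β x : ℝ) : PowerSeries ℝ :=
  expSum (thetaWeight h β) fun j : ℤ => x * (j + β)

/-- The moments `∑ j, (-1) ^ j * exp (-h * (j + β) ^ 2) * (j + β) ^ p`. -/
noncomputable def thetaMoment (h β : ℝ) (p : ℕ) : ℝ :=
  ∑' j : ℤ, thetaWeight h β j * (j + β) ^ p

/-- The value `∑ j, (-1) ^ j * exp (-h * (j + β) ^ 2)` of the theta series at the origin. -/
noncomputable abbrev thetaNull (h β : ℝ) : ℝ := thetaMoment h β 0

/-- The coefficients of the theta series without signs, at twice the parameter: these are the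
coefficients that arise in products of two theta series. -/
noncomputable def gaussWeight (h β : ℝ) (j : ℤ) : ℝ := Real.exp (-(2 * h) * (j + β) ^ 2)

/-- The series `∑ j, exp (-2 * h * (j + β) ^ 2) * exp (2 * x * (j + β) * u)`. -/
noncomputable def gaussSeries (h β x : ℝ) : PowerSeries ℝ :=
  expSum (gaussWeight h β) fun j : ℤ => 2 * x * (j + β)

/-- The moments `∑ j, exp (-2 * h * (j + β) ^ 2) * (2 * (j + β)) ^ p`. -/
noncomputable def gaussMoment (h β : ℝ) (p : ℕ) : ℝ :=
  ∑' j : ℤ, gaussWeight h β j * (2 * (j + β)) ^ p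

section theta

variable {h : ℝ}

theorem hasMoments_theta (hh : 0 < h) (β x : ℝ) :
    HasMoments (thetaWeight h β) fun j : ℤ => x * (j + β) :=
  (hasMoments_gaussian hh β x).of_abs_le fun j => by
    rw [thetaWeight, abs_neg_one_zpow_mul]

theorem hasMoments_gauss (hh : 0 < h) (β x : ℝ) :
    HasMoments (gaussWeight h β) fun j : ℤ => 2 * x * (j + β) :=
  hasMoments_gaussian (by positivity) β _

theorem summable_thetaWeight (hh : 0 < h) (β : ℝ) (p : ℕ) :
    Summable fun j : ℤ => thetaWeight h β j * (j + β) ^ p := by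
  simpa using (hasMoments_theta hh β 1).summable p

theorem coeff_thetaSeries (h β x : ℝ) (p : ℕ) :
    PowerSeries.coeff p (thetaSeries h β x) = x ^ p * thetaMoment h β p / p.factorial := by
  rw [thetaSeries, coeff_expSum, thetaMoment, ← tsum_mul_left]
  congr 1
  exact tsum_congr fun j => by rw [mul_pow]; ring

theorem constantCoeff_thetaSeries (h β x : ℝ) :
    PowerSeries.constantCoeff (thetaSeries h β x) = thetaNull h β := by
  rw [← PowerSeries.coeff_zero_eq_constantCoeff_apply, coeff_thetaSeries]; simp

theorem coeff_gaussSeries (h β x : ℝ) (p : ℕ) :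
    PowerSeries.coeff p (gaussSeries h β x) = x ^ p * gaussMoment h β p / p.factorial := by
  rw [gaussSeries, coeff_expSum, gaussMoment, ← tsum_mul_left]
  congr 1
  exact tsum_congr fun j => by rw [mul_assoc, mul_left_comm, mul_pow]; ring

theorem thetaSeries_add_one (h β x : ℝ) : thetaSeries h (β + 1) x = -thetaSeries h β x := by
  rw [thetaSeries, thetaSeries, ← expSum_neg,
    ← expSum_equiv (Equiv.addRight (1 : ℤ)) _ fun j : ℤ => x * (j + β)]
  congr 1
  · ext j
    simp only [Function.comp, thetaWeight, Equiv.coe_addRight, neg_one_zpow_succ]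
    push_cast
    ring_nf
  · ext j
    simp only [Function.comp, Equiv.coe_addRight]
    push_cast
    ring

theorem thetaNull_add_one (h β : ℝ) : thetaNull h (β + 1) = -thetaNull h β := by
  simp only [← constantCoeff_thetaSeries h _ 1, thetaSeries_add_one, map_neg]

theorem thetaNull_add_nat (h β : ℝ) (n : ℕ) : thetaNull h (β + n) = (-1) ^ n * thetaNull h β := by
  induction n with
  | zero => simp
  | succ n ih => rw [Nat.cast_succ, ← add_assoc, thetaNull_add_one, ih, pow_succ]; ring

/-- The theta value is even in `β`, by `j ↦ -j`. -/
theorem thetaNull_neg (h β : ℝ) : thetaNull h (-β) = thetaNull h β := by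
  simp only [thetaNull, thetaMoment]
  rw [← (Equiv.neg ℤ).tsum_eq]
  refine tsum_congr fun j => ?_
  simp only [thetaWeight, Equiv.neg_apply, neg_one_zpow_neg]
  push_cast
  ring_nf

/-- The odd theta series vanishes at the origin. -/
theorem thetaMoment_half_zero (h : ℝ) : thetaNull h (1 / 2) = 0 := by
  have h1 := thetaNull_add_one h (-(1 / 2))
  rw [thetaNull_neg] at h1
  norm_num at h1
  linarith

theorem gaussSeries_add_one (h β x : ℝ) : gaussSeries h (β + 1) x = gaussSeries h β x := by
  rw [gaussSeries, gaussSeries, ← expSum_equiv (Equiv.addRight (1 : ℤ)) (gaussWeight h β)]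
  congr 1
  · ext j
    simp only [Function.comp, gaussWeight, Equiv.coe_addRight]
    push_cast
    ring_nf
  · ext j
    simp only [Function.comp, Equiv.coe_addRight]
    push_cast
    ring

/-- The addition formula for the product of two theta series, obtained by summing separately over
the pairs of indices of equal and of different parity. -/
theorem thetaSeries_mul (hh : 0 < h) (β γ x y : ℝ) :
    thetaSeries h (β + γ) (x + y) * thetaSeries h (β - γ) (x - y) =
      gaussSeries h β x * gaussSeries h γ y -
        gaussSeries h (β + 1 / 2) x * gaussSeries h (γ + 1 / 2) y := by
  have := expSum_mul_parity (hasMoments_theta hh (β + γ) (x + y))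
    (hasMoments_theta hh (β - γ) (x - y))
    (hasMoments_gauss hh β x) (hasMoments_gauss hh γ y)
    (hasMoments_gauss hh (β + 1 / 2) x).neg (hasMoments_gauss hh (γ + 1 / 2) y)
    (fun a b => ?_) (fun a b => ?_) (fun a b => ?_) (fun a b => ?_)
  · rw [thetaSeries, thetaSeries, this, expSum_neg, neg_mul, ← sub_eq_add_neg]
    rfl
  · simp only [thetaWeight, gaussWeight]
    rw [mul_mul_mul_comm, neg_one_zpow_add_mul_sub, one_mul, ← Real.exp_add, ← Real.exp_add]
    push_cast
    ring_nf
  · push_cast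
    ring
  · simp only [thetaWeight, gaussWeight]
    rw [mul_mul_mul_comm, neg_one_zpow_add_one_mul_sub, neg_mul _ (Real.exp _), ← Real.exp_add,
      neg_one_mul, ← Real.exp_add]
    push_cast
    ring_nf
  · push_cast
    ring

theorem gaussSeries_zero_exponent (h β : ℝ) :
    gaussSeries h β 0 = PowerSeries.C (gaussMoment h β 0) := by
  simp [gaussSeries, gaussMoment, expSum_zero_exponent]

theorem thetaSeries_sq (hh : 0 < h) (β x : ℝ) :
    thetaSeries h β x ^ 2 =
      gaussSeries h β x * PowerSeries.C (gaussMoment h 0 0) -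
        gaussSeries h (β + 1 / 2) x * PowerSeries.C (gaussMoment h (1 / 2) 0) := by
  have := thetaSeries_mul hh β 0 x 0
  simpa [gaussSeries_zero_exponent, ← sq] using this

end theta

theorem powerSeries_two_ne_zero : (2 : PowerSeries ℝ) ≠ 0 := fun h => by
  have := congrArg PowerSeries.constantCoeff h
  rw [map_ofNat, map_zero] at this
  exact two_ne_zero this

/-- The bracket `f * f'' - f' ^ 2`, that is, `f ^ 2` times the second logarithmic derivative
of `f`. -/
noncomputable def bracket (f : PowerSeries ℝ) : PowerSeries ℝ :=
  f * PowerSeries.derivative ℝ (PowerSeries.derivative ℝ f) - PowerSeries.derivative ℝ f ^ 2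

theorem bracket_mul (f g : PowerSeries ℝ) :
    bracket (f * g) = bracket f * g ^ 2 + f ^ 2 * bracket g := by
  simp only [bracket, Derivation.leibniz, smul_eq_mul, map_add]
  ring

theorem bracket_pow_mul (f : PowerSeries ℝ) (n : ℕ) :
    bracket (f ^ n) * f ^ 2 = n * f ^ (2 * n) * bracket f := by
  induction n with
  | zero => simp [bracket]
  | succ n ih =>
    rw [pow_succ, bracket_mul, add_mul, mul_right_comm, ih]
    push_cast
    ring

theorem bracket_C_mul (a : ℝ) (f : PowerSeries ℝ) :
    bracket (PowerSeries.C a * f) = PowerSeries.C a ^ 2 * bracket f := by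
  rw [bracket_mul]
  have : bracket (PowerSeries.C a) = 0 := by simp [bracket]
  rw [this]; ring

/-- The bracket of an exponential sum is again an exponential sum, over the pairs of indices, with
the weights multiplied by the squared difference of the exponents. -/
theorem two_mul_bracket_expSum {ι : Type*} {w e : ι → ℝ} (h : HasMoments w e) :
    2 * bracket (expSum w e) =
      expSum (fun x : ι × ι => w x.1 * w x.2 * (e x.1 - e x.2) ^ 2) fun x => e x.1 + e x.2 := by
  have h1 := h.mul_exponent
  have h2 := h1.mul_exponent
  have e1 := expSum_mul h h2
  have e2 := expSum_mul h2 h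
  have e3 := expSum_mul h1 h1
  have : 2 * bracket (expSum w e) =
      expSum w e * expSum (fun i => w i * e i * e i) e +
        expSum (fun i => w i * e i * e i) e * expSum w e -
        (expSum (fun i => w i * e i) e * expSum (fun i => w i * e i) e +
          expSum (fun i => w i * e i) e * expSum (fun i => w i * e i) e) := by
    rw [bracket, derivative_expSum, derivative_expSum]; ring
  rw [this, e1, e2, e3, ← expSum_add (h.prod h2) (h2.prod h),
    ← expSum_add (h1.prod h1) (h1.prod h1),
    ← expSum_sub ((h.prod h2).add (h2.prod h)) ((h1.prod h1).add (h1.prod h1))]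
  congr 1
  ext x
  ring

section theta

variable {h : ℝ}

theorem HasMoments.bracket {ι : Type*} {w e : ι → ℝ} (h : HasMoments w e) :
    HasMoments (fun x : ι × ι => w x.1 * w x.2 * (e x.1 - e x.2) ^ 2) fun x => e x.1 + e x.2 := by
  have h1 := h.mul_exponent
  have h2 := h1.mul_exponent
  refine (funext fun x => ?_ :
    (fun x : ι × ι => w x.1 * w x.2 * (e x.1 - e x.2) ^ 2) = _) ▸
      ((h.prod h2).add (h2.prod h)).sub ((h1.prod h1).add (h1.prod h1))
  ring

/-- The bracket of a theta series is a combination of the same two series without signs as its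
square in `thetaSeries_sq`, because the squared difference of the exponents depends on the second
factor of the parity splitting only. -/
theorem two_mul_bracket_thetaSeries (hh : 0 < h) (β x : ℝ) :
    2 * bracket (thetaSeries h β x) = PowerSeries.C (x ^ 2) *
      (gaussSeries h β x * PowerSeries.C (gaussMoment h 0 2) -
        gaussSeries h (β + 1 / 2) x * PowerSeries.C (gaussMoment h (1 / 2) 2)) := by
  have hc : ∀ γ, HasMoments (fun j : ℤ => gaussWeight h γ j * (2 * (j + γ)) ^ 2)
      fun _ => (0 : ℝ) := fun γ => by
    have := ((hasMoments_gauss hh γ 1).mul_exponent_pow 2).zero_exponent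
    simpa using this
  have hT := hasMoments_theta hh β x
  rw [thetaSeries, two_mul_bracket_expSum hT, expSum_parity hT.bracket]
  have e1 := expSum_mul (hasMoments_gauss hh β x) (hc 0)
  have e2 := expSum_mul (hasMoments_gauss hh (β + 1 / 2) x) (hc (1 / 2))
  rw [expSum_zero_exponent] at e1 e2
  simp only [gaussSeries, gaussMoment]
  rw [e1, e2, mul_sub, ← expSum_const_mul, ← expSum_const_mul, sub_eq_add_neg, ← expSum_neg]
  congr 2
  · ext y
    simp only [thetaWeight, gaussWeight]
    have h1 := neg_one_zpow_add_mul_sub y.1 y.2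
    have h2 : Real.exp (-h * (((y.1 + y.2 : ℤ) : ℝ) + β) ^ 2) *
        Real.exp (-h * (((y.1 - y.2 : ℤ) : ℝ) + β) ^ 2) =
        Real.exp (-(2 * h) * (y.1 + β) ^ 2) * Real.exp (-(2 * h) * (y.2 + 0) ^ 2) := by
      rw [← Real.exp_add, ← Real.exp_add]
      push_cast
      ring_nf
    have h3 : x * (((y.1 + y.2 : ℤ) : ℝ) + β) - x * (((y.1 - y.2 : ℤ) : ℝ) + β) =
        x * (2 * (y.2 + 0)) := by
      push_cast
      ring
    rw [mul_mul_mul_comm ((-1 : ℝ) ^ _), h1, h2, h3]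
    ring
  · ext y
    push_cast
    ring
  · ext y
    simp only [thetaWeight, gaussWeight]
    have h1 := neg_one_zpow_add_one_mul_sub y.1 y.2
    have h2 : Real.exp (-h * (((y.1 + y.2 + 1 : ℤ) : ℝ) + β) ^ 2) *
        Real.exp (-h * (((y.1 - y.2 : ℤ) : ℝ) + β) ^ 2) =
        Real.exp (-(2 * h) * (y.1 + (β + 1 / 2)) ^ 2) *
          Real.exp (-(2 * h) * (y.2 + 1 / 2) ^ 2) := by
      rw [← Real.exp_add, ← Real.exp_add]
      push_cast
      ring_nf
    have h3 : x * (((y.1 + y.2 + 1 : ℤ) : ℝ) + β) - x * (((y.1 - y.2 : ℤ) : ℝ) + β) =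
        x * (2 * (y.2 + 1 / 2)) := by
      push_cast
      ring
    rw [mul_mul_mul_comm ((-1 : ℝ) ^ _), h1, h2, h3]
    ring
  · ext y
    push_cast
    ring

/-- The derivative at the origin of the odd theta series. -/
noncomputable abbrev thetaDeriv (h : ℝ) : ℝ := thetaMoment h (1 / 2) 1

/-- The coefficient of `u ^ 2` in `thetaSeries_sq` for the odd theta series: the determinant that
governs the elimination in `bracket_thetaSeries` is a square. -/
theorem thetaDeriv_sq (hh : 0 < h) :
    2 * thetaDeriv h ^ 2 = gaussMoment h 0 0 * gaussMoment h (1 / 2) 2 -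
      gaussMoment h (1 / 2) 0 * gaussMoment h 0 2 := by
  have h1 := congrArg (PowerSeries.coeff 2) (thetaSeries_sq hh (1 / 2) 1)
  have h2 : (1 / 2 + 1 / 2 : ℝ) = 0 + 1 := by norm_num
  rw [h2, gaussSeries_add_one, map_sub, PowerSeries.coeff_mul_C, PowerSeries.coeff_mul_C,
    coeff_gaussSeries, coeff_gaussSeries, sq, PowerSeries.coeff_mul,
    Nat.sum_antidiagonal_eq_sum_range_succ_mk] at h1
  simp only [sum_range_succ, sum_range_zero, coeff_thetaSeries] at h1
  have h3 := thetaMoment_half_zero h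
  simp only [thetaNull] at h3
  norm_num [h3] at h1
  simp only [thetaDeriv]
  norm_num
  linarith

/-- The theta relation behind the Toda equation: for theta series whose arguments differ by
`x ± 1`, the difference of the second logarithmic derivatives is a product of theta series. -/
theorem bracket_thetaSeries (hh : 0 < h) (β x : ℝ) :
    bracket (thetaSeries h β x) * thetaSeries h 0 1 ^ 2 -
        PowerSeries.C (x ^ 2) * bracket (thetaSeries h 0 1) * thetaSeries h β x ^ 2 =
      PowerSeries.C (x ^ 2 * thetaDeriv h ^ 2) *
        (thetaSeries h (β + 1 / 2) (x + 1) * thetaSeries h (β - 1 / 2) (x - 1)) := by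
  have h1 : (1 / 2 + 1 / 2 : ℝ) = 0 + 1 := by norm_num
  have hK := congrArg (PowerSeries.C (R := ℝ)) (thetaDeriv_sq hh)
  have e1 := two_mul_bracket_thetaSeries hh β x
  have e2 := two_mul_bracket_thetaSeries hh 0 1
  rw [thetaSeries_sq hh, thetaSeries_sq hh, thetaSeries_mul hh, h1, gaussSeries_add_one]
  simp only [map_mul, map_sub, map_pow, map_ofNat, one_pow, map_one, one_mul, zero_add] at *
  refine mul_left_cancel₀ powerSeries_two_ne_zero ?_
  linear_combination (gaussSeries h 0 1 * PowerSeries.C (gaussMoment h 0 0) -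
      gaussSeries h (1 / 2) 1 * PowerSeries.C (gaussMoment h (1 / 2) 0)) * e1 -
    PowerSeries.C x ^ 2 * (gaussSeries h β x * PowerSeries.C (gaussMoment h 0 0) -
      gaussSeries h (β + 1 / 2) x * PowerSeries.C (gaussMoment h (1 / 2) 0)) * e2 -
    PowerSeries.C x ^ 2 * (gaussSeries h β x * gaussSeries h (1 / 2) 1 -
      gaussSeries h (β + 1 / 2) x * gaussSeries h 0 1) * hK

end theta

/-! ### Lambert series and their expression by theta series -/

theorem hasMoments_exp_abs {h : ℝ} (hh : 0 < h) :
    HasMoments (fun j : ℤ => Real.exp (-h * |(j : ℝ)|)) fun j => (j : ℝ) := fun p => by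
  have hr : ‖Real.exp (-h)‖ < 1 := by
    rw [Real.norm_eq_abs, abs_of_pos (Real.exp_pos _)]
    exact Real.exp_lt_one_iff.2 (by linarith)
  have key : Summable fun n : ℕ => Real.exp (-h * n) * (n : ℝ) ^ p := by
    refine (summable_pow_mul_geometric_of_norm_lt_one p hr).congr fun n => ?_
    rw [← Real.exp_nat_mul]
    ring_nf
  refine Summable.of_nat_of_neg ?_ ?_ <;>
  · refine key.congr fun n => ?_
    simp [abs_of_pos (Real.exp_pos _)]

/-- The coefficients `1 / (2 * sinh (h * (j + α)))`. With Lean's convention for division by zero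
the coefficient at `j + α = 0` is `0`, so that for `α = 0` this is the sum over `j ≠ 0`. -/
noncomputable def cosechWeight (h α : ℝ) (j : ℤ) : ℝ := 1 / (2 * Real.sinh (h * (j + α)))

/-- The bilateral Lambert series `∑ j, exp ((j + α) * u) / (2 * sinh (h * (j + α)))`, as a power
series in `u`. -/
noncomputable def lambertSeries (h α : ℝ) : PowerSeries ℝ :=
  expSum (cosechWeight h α) fun j : ℤ => (j : ℝ) + α

/-- The nonzero elements of `ℤ + α` are bounded away from zero. -/
theorem exists_le_abs_int_add {α : ℝ} (h0 : 0 ≤ α) (h1 : α < 1) :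
    ∃ δ > 0, ∀ j : ℤ, (j : ℝ) + α = 0 ∨ δ ≤ |(j : ℝ) + α| := by
  rcases h0.eq_or_lt with rfl | h0
  · refine ⟨1, one_pos, fun j => ?_⟩
    rcases eq_or_ne j 0 with rfl | hj
    · simp
    · right
      rw [add_zero]
      exact_mod_cast Int.one_le_abs hj
  · refine ⟨min α (1 - α), lt_min h0 (by linarith), fun j => Or.inr ?_⟩
    rcases le_or_gt 0 j with hj | hj
    · have : (0 : ℝ) ≤ j := by exact_mod_cast hj
      rw [abs_of_nonneg (by linarith)]
      exact (min_le_left _ _).trans (by linarith)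
    · have : (j : ℝ) ≤ -1 := by exact_mod_cast Int.le_sub_one_of_lt hj
      rw [abs_of_neg (by linarith)]
      exact (min_le_right _ _).trans (by linarith)

theorem abs_one_div_two_mul_sinh_le {x δ : ℝ} (hδ : 0 < δ) (hx : δ ≤ |x|) :
    |1 / (2 * Real.sinh x)| ≤ (1 - Real.exp (-2 * δ))⁻¹ * Real.exp (-|x|) := by
  have h1 : |2 * Real.sinh x| = Real.exp |x| * (1 - Real.exp (-2 * |x|)) := by
    rw [abs_mul, Real.abs_sinh, Real.sinh_eq, mul_sub, ← Real.exp_add]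
    ring_nf
  have h2 : Real.exp (-2 * |x|) ≤ Real.exp (-2 * δ) := Real.exp_le_exp.2 (by linarith)
  have h3 : Real.exp (-2 * δ) < 1 := Real.exp_lt_one_iff.2 (by linarith)
  rw [abs_div, abs_one, h1, one_div, mul_inv, Real.exp_neg, mul_comm]
  gcongr

section lambert

variable {h α : ℝ}

theorem hasMoments_cosech (hh : 0 < h) (h0 : 0 ≤ α) (h1 : α < 1) :
    HasMoments (cosechWeight h α) fun j : ℤ => (j : ℝ) + α := by
  obtain ⟨δ, hδ, H⟩ := exists_le_abs_int_add h0 h1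
  have hd : 0 < h * δ := by positivity
  have hC : 0 < 1 - Real.exp (-2 * (h * δ)) := by
    have := Real.exp_lt_one_iff (x := -2 * (h * δ)) |>.2 (by linarith)
    linarith
  refine (((hasMoments_exp_abs hh).const_mul
    ((1 - Real.exp (-2 * (h * δ)))⁻¹ * Real.exp (h * |α|))).add_exponent α).of_abs_le fun j => ?_
  rw [abs_of_pos (a := _ * _) (by positivity)]
  rcases H j with H | H
  · rw [cosechWeight, H]
    simp only [mul_zero, Real.sinh_zero, div_zero, abs_zero]
    positivity
  · refine (abs_one_div_two_mul_sinh_le hd (x := h * (j + α)) ?_).trans ?_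
    · rw [abs_mul, abs_of_pos hh]
      gcongr
    · rw [mul_assoc, ← Real.exp_add, abs_mul, abs_of_pos hh]
      gcongr
      have := abs_add_le (j + α) (-α)
      rw [add_neg_cancel_right, abs_neg] at this
      nlinarith

theorem summable_cosech (hh : 0 < h) (h0 : 0 ≤ α) (h1 : α < 1) : Summable (cosechWeight h α) :=
  (hasMoments_cosech hh h0 h1).summable_weight

/-- The coefficients of the product of a Lambert series and the theta series. -/
noncomputable def lambertThetaConv (h α : ℝ) (n : ℤ) : ℝ :=
  ∑' j : ℤ, cosechWeight h α (n - j) * thetaWeight h 0 j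

/-- The change of variables `(n, j) ↦ (n - j, j)`. -/
def shearEquiv : ℤ × ℤ ≃ ℤ × ℤ where
  toFun x := (x.1 - x.2, x.2)
  invFun x := (x.1 + x.2, x.2)
  left_inv x := by simp
  right_inv x := by simp

theorem lambertSeries_mul_theta (hh : 0 < h) (h0 : 0 ≤ α) (h1 : α < 1) :
    lambertSeries h α * thetaSeries h 0 1 =
      expSum (lambertThetaConv h α) fun n : ℤ => (n : ℝ) + α := by
  have hm := (hasMoments_cosech hh h0 h1).prod (hasMoments_theta hh 0 1)
  rw [lambertSeries, thetaSeries, expSum_mul (hasMoments_cosech hh h0 h1) (hasMoments_theta hh 0 1),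
    ← expSum_equiv shearEquiv]
  have he : ((fun x : ℤ × ℤ => (x.1 : ℝ) + α + 1 * (x.2 + 0)) ∘ shearEquiv) =
      fun x : ℤ × ℤ => (x.1 : ℝ) + α := by
    ext x
    simp [shearEquiv]
    ring
  have hm2 := hm.comp_injective shearEquiv.injective
  rw [he] at hm2 ⊢
  exact expSum_prod_of_exponent (e := fun n : ℤ => (n : ℝ) + α) hm2

theorem summable_conv (hh : 0 < h) (h0 : 0 ≤ α) (h1 : α < 1) (n : ℤ) :
    Summable fun j : ℤ => cosechWeight h α (n - j) * thetaWeight h 0 j := by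
  have hm := ((hasMoments_cosech hh h0 h1).prod (hasMoments_theta hh 0 1)).summable_weight
  have := hm.comp_injective (i := fun j : ℤ => (n - j, j)) fun a b hab => (Prod.ext_iff.1 hab).2
  exact this

theorem thetaWeight_succ (h α : ℝ) (n : ℤ) :
    thetaWeight h α (n + 1) = -Real.exp (-h * (2 * (n + α) + 1)) * thetaWeight h α n := by
  rw [thetaWeight, thetaWeight, neg_one_zpow_succ, neg_mul _ (_ * _), neg_mul _ (Real.exp _),
    mul_left_comm, ← Real.exp_add]
  push_cast
  ring_nf

theorem thetaWeight_ne_zero (h α : ℝ) (n : ℤ) : thetaWeight h α n ≠ 0 :=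
  mul_ne_zero (zpow_ne_zero _ (by norm_num)) (Real.exp_ne_zero _)

/-- The first-order recurrence satisfied by the coefficients of the product of a Lambert series
and the theta series; it uses only that the odd theta series vanishes at the origin. -/
theorem lambertThetaConv_succ (hh : 0 < h) (h0 : 0 ≤ α) (h1 : α < 1) (n : ℤ) :
    lambertThetaConv h α (n + 1) = -Real.exp (-h * (2 * (n + α) + 1)) *
      (lambertThetaConv h α n -
        ∑' j : ℤ, if (n : ℝ) - j + α = 0 then thetaWeight h 0 j else 0) := by
  have hs1 := summable_conv hh h0 h1 n
  have hs2 : Summable fun j : ℤ => thetaWeight h (1 / 2) j := by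
    simpa using summable_thetaWeight hh (1 / 2) 0
  have hs3 : Summable fun j : ℤ => if (n : ℝ) - j + α = 0 then thetaWeight h 0 j else 0 := by
    have : Summable fun j : ℤ => thetaWeight h 0 j := by simpa using summable_thetaWeight hh 0 0
    exact this.abs.of_norm_bounded fun j => by split_ifs <;> simp
  have hz : ∑' j : ℤ, Real.exp (h / 4 + h * (n + α)) * thetaWeight h (1 / 2) j = 0 := by
    have := thetaMoment_half_zero h
    simp only [thetaNull, thetaMoment, pow_zero, mul_one] at this
    rw [tsum_mul_left, this, mul_zero]
  rw [lambertThetaConv, ← (Equiv.addRight (1 : ℤ)).tsum_eq]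
  -- a multiple of the vanishing odd theta value may be added
  have hsum : lambertThetaConv h α n -
      (∑' j : ℤ, if (n : ℝ) - j + α = 0 then thetaWeight h 0 j else 0) =
      ∑' j : ℤ, (cosechWeight h α (n - j) * thetaWeight h 0 j -
        (if (n : ℝ) - j + α = 0 then thetaWeight h 0 j else 0) +
        Real.exp (h / 4 + h * (n + α)) * thetaWeight h (1 / 2) j) := by
    rw [(hs1.sub hs3).tsum_add (hs2.mul_left _), hs1.tsum_sub hs3, hz, add_zero, lambertThetaConv]
  rw [hsum, ← tsum_mul_left]
  refine tsum_congr fun j => ?_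
  have e1 : n + 1 - (j + 1) = n - j := by ring
  have e2 : Real.exp (h / 4 + h * (n + α)) * thetaWeight h (1 / 2) j =
      Real.exp (h * (n - j + α)) * thetaWeight h 0 j := by
    rw [thetaWeight, thetaWeight, mul_left_comm, ← Real.exp_add, mul_left_comm, ← Real.exp_add]
    ring_nf
  have e3 : Real.exp (-h * (2 * (j + 0) + 1)) =
      Real.exp (-h * (2 * (n + α) + 1)) * Real.exp (h * (n - j + α)) ^ 2 := by
    rw [← Real.exp_nat_mul, ← Real.exp_add]
    push_cast
    ring_nf
  rw [e2, Equiv.coe_addRight, e1, thetaWeight_succ, e3, cosechWeight]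
  push_cast
  by_cases hk : (n : ℝ) - j + α = 0
  · rw [hk]
    simp
  · have hne : Real.sinh (h * (n - j + α)) ≠ 0 := by
      rw [Ne, Real.sinh_eq_zero]
      exact mul_ne_zero hh.ne' hk
    have hs : 2 * Real.sinh (h * (n - j + α)) =
        Real.exp (h * (n - j + α)) - (Real.exp (h * (n - j + α)))⁻¹ := by
      rw [Real.sinh_eq, Real.exp_neg]; ring
    rw [if_neg hk]
    have hx := Real.exp_pos (h * (n - j + α))
    set y := Real.exp (h * (n - j + α)) with hy
    have hd : 2 * Real.sinh (h * (n - j + α)) ≠ 0 := mul_ne_zero two_ne_zero hne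
    rw [hs] at hd ⊢
    have : y ^ 2 - 1 ≠ 0 := fun h0 => hd (by field_simp; rw [h0, mul_zero])
    field_simp
    ring

/-- The constant in the factorization of a Lambert series. -/
noncomputable def lambertConst (h α : ℝ) : ℝ := lambertThetaConv h α 0 / thetaWeight h α 0

theorem lambertThetaConv_eq (hh : 0 < h) (h0 : 0 < α) (h1 : α < 1) (n : ℤ) :
    lambertThetaConv h α n = lambertConst h α * thetaWeight h α n := by
  have hz : ∀ n : ℤ, (∑' j : ℤ, if (n : ℝ) - j + α = 0 then thetaWeight h 0 j else 0) = 0 := by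
    intro n
    refine (tsum_congr fun j => if_neg fun hj => ?_).trans tsum_zero
    have h2 : α = ((j - n : ℤ) : ℝ) := by push_cast; linarith
    rw [h2] at h0 h1
    have h3 : 0 < j - n := by exact_mod_cast h0
    have h4 : j - n < 1 := by exact_mod_cast h1
    omega
  have hstep : ∀ n : ℤ, lambertThetaConv h α (n + 1) / thetaWeight h α (n + 1) =
      lambertThetaConv h α n / thetaWeight h α n := fun n => by
    rw [lambertThetaConv_succ hh h0.le h1, hz, sub_zero, thetaWeight_succ,
      mul_div_mul_left _ _ (neg_ne_zero.2 (Real.exp_ne_zero _))]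
  rw [← div_eq_iff (thetaWeight_ne_zero _ _ _), lambertConst]
  induction n using Int.induction_on with
  | zero => rfl
  | succ i ih => rw [hstep, ih]
  | pred i ih => rw [← ih, ← hstep, sub_add_cancel]

/-- A bilateral Lambert series is, up to a constant, a quotient of two theta series: the
coefficients of its product with the theta series satisfy the same recurrence as those of a theta
series. -/
theorem lambertSeries_mul_theta_eq (hh : 0 < h) (h0 : 0 < α) (h1 : α < 1) :
    lambertSeries h α * thetaSeries h 0 1 =
      PowerSeries.C (lambertConst h α) * thetaSeries h α 1 := by
  rw [lambertSeries_mul_theta hh h0.le h1, thetaSeries, ← expSum_const_mul]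
  simp only [one_mul]
  congr 1
  ext n
  exact lambertThetaConv_eq hh h0 h1 n

/-- The Lambert series without its term at zero is minus the logarithmic derivative of the theta
series. -/
theorem lambertSeries_zero_mul_theta (hh : 0 < h) :
    lambertSeries h 0 * thetaSeries h 0 1 = -PowerSeries.derivative ℝ (thetaSeries h 0 1) := by
  have hz : ∀ n : ℤ, (∑' j : ℤ, if (n : ℝ) - j + 0 = 0 then thetaWeight h 0 j else 0) =
      thetaWeight h 0 n := by
    intro n
    rw [tsum_eq_single n]
    · simp
    · intro j hj
      rw [if_neg]
      rw [add_zero, sub_eq_zero]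
      exact_mod_cast hj.symm
  have hstep : ∀ n : ℤ, lambertThetaConv h 0 (n + 1) / thetaWeight h 0 (n + 1) =
      lambertThetaConv h 0 n / thetaWeight h 0 n - 1 := fun n => by
    rw [lambertThetaConv_succ hh le_rfl one_pos, hz, thetaWeight_succ,
      mul_div_mul_left _ _ (neg_ne_zero.2 (Real.exp_ne_zero _)), sub_div,
      div_self (thetaWeight_ne_zero _ _ _)]
  have hzero : lambertThetaConv h 0 0 = 0 := by
    have : lambertThetaConv h 0 0 = -lambertThetaConv h 0 0 := by
      conv_lhs => rw [lambertThetaConv, ← (Equiv.neg ℤ).tsum_eq]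
      rw [lambertThetaConv, ← tsum_neg]
      refine tsum_congr fun j => ?_
      simp only [cosechWeight, thetaWeight, Equiv.neg_apply, neg_one_zpow_neg]
      push_cast
      rw [show h * (0 - -(j : ℝ) + 0) = -(h * (0 - j + 0)) by ring, Real.sinh_neg,
        show (-(j : ℝ) + 0) ^ 2 = (j + 0) ^ 2 by ring, mul_neg, div_neg, neg_mul]
    linarith
  have hn : ∀ n : ℤ, lambertThetaConv h 0 n / thetaWeight h 0 n = -n := fun n => by
    induction n using Int.induction_on with
    | zero => simp [hzero]
    | succ i ih => rw [hstep, ih]; push_cast; ring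
    | pred i ih =>
      have := hstep (-(i : ℤ) - 1)
      rw [sub_add_cancel, ih] at this
      push_cast at this ⊢
      linarith
  rw [lambertSeries_mul_theta hh le_rfl one_pos, thetaSeries, derivative_expSum, ← expSum_neg]
  congr 1
  · ext n
    rw [(div_eq_iff (thetaWeight_ne_zero _ _ _)).1 (hn n)]
    ring
  · ext n
    ring

theorem hasSum_indicator_le_sub (a b : ℤ) :
    HasSum (fun n : ℤ => (if a ≤ n then (1 : ℝ) else 0) - if b ≤ n then 1 else 0) (b - a) := by
  wlog hab : a ≤ b generalizing a b
  · simpa using (this b a (le_of_not_ge hab)).neg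
  have h1 : ∀ n ∉ Ico a b, ((if a ≤ n then (1 : ℝ) else 0) - if b ≤ n then 1 else 0) = 0 := by
    intro n hn
    rw [mem_Ico, not_and_or, not_le, not_lt] at hn
    split_ifs <;> first | omega | norm_num
  convert hasSum_sum_of_ne_finset_zero h1 using 1
  rw [sum_congr rfl (g := fun _ => (1 : ℝ))]
  · have : ((b - a).toNat : ℤ) = b - a := Int.toNat_of_nonneg (by omega)
    simp only [sum_const, Int.card_Ico, nsmul_eq_mul, mul_one]
    exact_mod_cast this.symm
  · intro n hn
    rw [mem_Ico] at hn
    rw [if_pos hn.1, if_neg (by omega), sub_zero]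
  · infer_instance

theorem hasSum_abs_indicator_le_sub (a b : ℤ) :
    HasSum (fun n : ℤ => |(if a ≤ n then (1 : ℝ) else 0) - if b ≤ n then 1 else 0|)
      |(b : ℝ) - a| := by
  wlog hab : a ≤ b generalizing a b
  · have := this b a (le_of_not_ge hab)
    simpa only [abs_sub_comm] using this
  rw [abs_of_nonneg (by exact_mod_cast sub_nonneg.2 hab)]
  refine (hasSum_indicator_le_sub a b).congr_fun fun n => ?_
  rw [abs_of_nonneg]
  split_ifs <;> first | omega | norm_num

/-- The coefficient `1 / (1 - exp (-2 * h * (k + α)))`, which tends to `1` for `k → ∞` and to `0`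
for `k → -∞`. -/
noncomputable def stepWeight (h α : ℝ) (k : ℤ) : ℝ :=
  Real.exp (h * (k + α)) * cosechWeight h α k

/-- The step weights are close to the indicator function of `k ≥ 0`. -/
theorem summable_stepWeight_sub (hh : 0 < h) (h0 : 0 < α) (h1 : α < 1) :
    Summable fun k : ℤ => |stepWeight h α k - if 0 ≤ k then 1 else 0| := by
  refine (summable_cosech hh h0.le h1).abs.of_nonneg_of_le (fun k => abs_nonneg _) fun k => ?_
  rw [stepWeight]
  split_ifs with hk
  · have hk : (0 : ℝ) ≤ k := by exact_mod_cast hk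
    have hx : 0 < h * (k + α) := by positivity
    have : Real.exp (h * (k + α)) * cosechWeight h α k - 1 =
        Real.exp (-(h * (k + α))) * cosechWeight h α k := by
      have hs : 0 < Real.sinh (h * (k + α)) := Real.sinh_pos_iff.2 hx
      rw [cosechWeight]
      field_simp
      rw [Real.sinh_eq]
      ring
    rw [this, abs_mul, abs_of_pos (Real.exp_pos _)]
    exact mul_le_of_le_one_left (abs_nonneg _) (Real.exp_le_one_iff.2 (by linarith))
  · have hk : (k : ℝ) ≤ -1 := by
      push Not at hk
      exact_mod_cast Int.le_sub_one_of_lt hk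
    rw [sub_zero, abs_mul, abs_of_pos (Real.exp_pos _)]
    refine mul_le_of_le_one_left (abs_nonneg _) (Real.exp_le_one_iff.2 ?_)
    nlinarith

/-- The difference of two translates of the step weights has the sum `b - a`, as for the indicator
function, and the sum of its absolute values grows at most linearly in `b - a`. -/
theorem hasSum_stepWeight_sub (hh : 0 < h) (h0 : 0 < α) (h1 : α < 1) (a b : ℤ) :
    HasSum (fun n : ℤ => stepWeight h α (n - a) - stepWeight h α (n - b)) (b - a) ∧
      Summable (fun n : ℤ => |stepWeight h α (n - a) - stepWeight h α (n - b)|) ∧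
      ∑' n : ℤ, |stepWeight h α (n - a) - stepWeight h α (n - b)| ≤
        2 * (∑' k : ℤ, |stepWeight h α k - if 0 ≤ k then 1 else 0|) + |(b : ℝ) - a| := by
  have hW := summable_stepWeight_sub hh h0 h1
  set W := fun k : ℤ => stepWeight h α k - if 0 ≤ k then (1 : ℝ) else 0 with hWdef
  have hsh : ∀ c : ℤ, HasSum (fun n : ℤ => W (n - c)) (∑' k, W k) := fun c => by
    have := (Equiv.subRight c).hasSum_iff (f := W) (a := ∑' k, W k)
    exact this.2 (Summable.of_abs hW).hasSum
  have hsha : ∀ c : ℤ, HasSum (fun n : ℤ => |W (n - c)|) (∑' k, |W k|) := fun c => by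
    have := (Equiv.subRight c).hasSum_iff (f := fun k => |W k|) (a := ∑' k, |W k|)
    exact this.2 hW.hasSum
  have hsplit : ∀ n : ℤ, stepWeight h α (n - a) - stepWeight h α (n - b) =
      W (n - a) - W (n - b) + ((if a ≤ n then (1 : ℝ) else 0) - if b ≤ n then 1 else 0) := by
    intro n
    simp only [hWdef, sub_nonneg]
    ring
  have hle : ∀ n : ℤ, |stepWeight h α (n - a) - stepWeight h α (n - b)| ≤
      |W (n - a)| + |W (n - b)| + |(if a ≤ n then (1 : ℝ) else 0) - if b ≤ n then 1 else 0| := by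
    intro n
    rw [hsplit]
    exact (abs_add_le _ _).trans (by gcongr; exact abs_sub _ _)
  have hbig := ((hsha a).add (hsha b)).add (hasSum_abs_indicator_le_sub a b)
  have hsum := hbig.summable.of_nonneg_of_le (fun n => abs_nonneg _) hle
  refine ⟨?_, hsum, ?_⟩
  · have := ((hsh a).sub (hsh b)).add (hasSum_indicator_le_sub a b)
    rw [sub_self, zero_add] at this
    exact this.congr_fun hsplit
  · refine (hsum.tsum_le_tsum hle hbig.summable).trans ?_
    rw [hbig.tsum_eq]
    linarith

/-- The constant in the factorization of a Lambert series, in terms of theta values. It is found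
by comparing the sums over all coefficients, weighted so as to approach the pole of the Lambert
series; the antisymmetry of the odd theta series makes the double sum converge absolutely. -/
theorem lambertConst_mul_thetaNull (hh : 0 < h) (h0 : 0 < α) (h1 : α < 1) :
    lambertConst h α * thetaNull h (α - 1 / 2) = thetaDeriv h := by
  set a : ℤ → ℝ := thetaWeight h (-(1 / 2)) with ha
  have haS : ∀ p, Summable fun j : ℤ => a j * (j + (-(1 / 2) : ℝ)) ^ p :=
    summable_thetaWeight hh (-(1 / 2))
  have hrefl : ∀ j : ℤ, a (1 - j) = -a j := fun j => by
    rw [ha, thetaWeight, thetaWeight, sub_eq_neg_add, neg_one_zpow_succ, neg_one_zpow_neg, neg_mul]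
    push_cast
    ring_nf
  have haM : HasMoments a fun j : ℤ => 2 * ((j : ℝ) + -(1 / 2)) := hasMoments_theta hh _ _
  -- the summands of the antisymmetrized double sum
  set f : ℤ × ℤ → ℝ := fun x =>
    a x.1 * (stepWeight h α (x.2 - x.1) - stepWeight h α (x.2 - (1 - x.1))) with hf
  set M := 2 * ∑' k : ℤ, |stepWeight h α k - if 0 ≤ k then 1 else 0| with hM
  have hstep := fun j : ℤ => hasSum_stepWeight_sub hh h0 h1 j (1 - j)
  have hfS : Summable f := by
    rw [← summable_norm_iff, summable_prod_of_nonneg fun x => norm_nonneg _]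
    refine ⟨fun j => ?_, ?_⟩
    · simp only [hf, norm_mul, Real.norm_eq_abs]
      exact (hstep j).2.1.mul_left _
    · have hb : Summable fun j : ℤ => |a j| * M + |a j| * |2 * ((j : ℝ) + -(1 / 2))| := by
        refine Summable.add ?_ ?_
        · simpa using (haM 0).mul_right M
        · simpa using haM 1
      refine hb.of_nonneg_of_le (fun j => tsum_nonneg fun _ => norm_nonneg _) fun j => ?_
      simp only [hf, norm_mul, Real.norm_eq_abs]
      rw [tsum_mul_left, ← mul_add]
      refine mul_le_mul_of_nonneg_left ((hstep j).2.2.trans ?_) (abs_nonneg _)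
      rw [← abs_neg (2 * _)]
      push_cast
      rw [hM]
      refine le_of_eq ?_
      ring_nf
  -- summation along the rows gives the derivative of the odd theta series
  have hrow : ∑' x, f x = 2 * thetaDeriv h := by
    have h2 : ∀ j : ℤ, ∑' n : ℤ, f (j, n) = -2 * (a j * (j + (-(1 / 2) : ℝ)) ^ 1) := fun j => by
      simp only [hf]
      rw [tsum_mul_left, (hstep j).1.tsum_eq]
      push_cast
      ring
    have h3 : thetaMoment h (1 / 2) 1 = -thetaMoment h (-(1 / 2)) 1 := by
      have := congrArg (PowerSeries.coeff 1) (thetaSeries_add_one h (-(1 / 2)) 1)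
      rw [map_neg, coeff_thetaSeries, coeff_thetaSeries] at this
      norm_num at this ⊢
      exact this
    rw [hfS.tsum_prod, tsum_congr h2, tsum_mul_left, thetaDeriv, h3, thetaMoment]
    ring
  -- along the columns the two terms of `f` contribute equally
  have hcol : ∀ n : ℤ, ∑' j : ℤ, f (j, n) =
      2 * Real.exp (-(h / 4)) * Real.exp (h * (n + α)) * lambertThetaConv h α n := fun n => by
    have h2 : ∀ j : ℤ, a j * stepWeight h α (n - j) =
        Real.exp (-(h / 4)) * Real.exp (h * (n + α)) *
          (cosechWeight h α (n - j) * thetaWeight h 0 j) := fun j => by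
      rw [ha, stepWeight, thetaWeight, thetaWeight]
      have : Real.exp (-h * (j + -(1 / 2)) ^ 2) * Real.exp (h * (((n - j : ℤ) : ℝ) + α)) =
          Real.exp (-(h / 4)) * Real.exp (h * (n + α)) * Real.exp (-h * (j + 0) ^ 2) := by
        rw [← Real.exp_add, ← Real.exp_add, ← Real.exp_add]
        push_cast
        ring_nf
      linear_combination (-1 : ℝ) ^ j * cosechWeight h α (n - j) * this
    have hs : Summable fun j : ℤ => a j * stepWeight h α (n - j) :=
      ((summable_conv hh h0.le h1 n).mul_left _).congr fun j => (h2 j).symm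
    have hs' : HasSum (fun j : ℤ => a j * stepWeight h α (n - (1 - j)))
        (-∑' j : ℤ, a j * stepWeight h α (n - j)) := by
      have := (Equiv.subLeft (1 : ℤ)).hasSum_iff.2 hs.hasSum.neg
      refine this.congr_fun fun j => ?_
      simp [hrefl]
    simp only [hf, mul_sub]
    rw [(hs.hasSum.sub hs').tsum_eq, tsum_congr h2, tsum_mul_left, lambertThetaConv]
    ring
  have hfS' : Summable fun x : ℤ × ℤ => f (x.2, x.1) := hfS.prod_symm
  have h2 : ∑' x, f x = ∑' n : ℤ, ∑' j : ℤ, f (j, n) := by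
    rw [← hfS'.tsum_prod (f := fun x : ℤ × ℤ => f (x.2, x.1))]
    exact ((Equiv.prodComm ℤ ℤ).tsum_eq f).symm
  have h3 : ∀ n : ℤ, 2 * Real.exp (-(h / 4)) * Real.exp (h * (n + α)) * lambertThetaConv h α n =
      2 * lambertConst h α * (thetaWeight h (α - 1 / 2) n * (n + (α - 1 / 2)) ^ 0) := fun n => by
    rw [lambertThetaConv_eq hh h0 h1, pow_zero, mul_one, thetaWeight, thetaWeight]
    have : Real.exp (-(h / 4)) * Real.exp (h * (n + α)) * Real.exp (-h * (n + α) ^ 2) =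
        Real.exp (-h * (n + (α - 1 / 2)) ^ 2) := by
      rw [← Real.exp_add, ← Real.exp_add]
      ring_nf
    linear_combination 2 * lambertConst h α * (-1 : ℝ) ^ n * this
  rw [hrow] at h2
  simp only [hcol] at h2
  rw [tsum_congr h3, tsum_mul_left] at h2
  rw [thetaNull, thetaMoment]
  linarith

end lambert

/-! ### The theta constants and the triangular numbers -/

open Filter Topology

/-- The value `∑ j, exp (-h * (j + β) ^ 2)` at the origin of a theta series without signs. -/
noncomputable def gaussNull (h β : ℝ) : ℝ := ∑' j : ℤ, Real.exp (-h * (j + β) ^ 2)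

/-- The sum `∑ j ≥ 0, exp (-h * (2 * j + 1) ^ 2 / 8)`. For `q = exp (-h)` it is `q ^ (1 / 8)` times
the generating function of the triangular numbers. -/
noncomputable def triangleTheta (h : ℝ) : ℝ := ∑' j : ℕ, Real.exp (-h * (2 * j + 1) ^ 2 / 8)

section constants

variable {h : ℝ}

theorem summable_gaussian (hh : 0 < h) (β : ℝ) :
    Summable fun j : ℤ => Real.exp (-h * (j + β) ^ 2) :=
  (hasMoments_gaussian hh β 0).summable_weight

/-- The product of two sums over `ℤ` after splitting the pairs of indices by parity. -/
theorem tsum_mul_parity {w w' A B A' B' : ℤ → ℝ} (h : Summable w) (h' : Summable w')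
    (hA : Summable A) (hB : Summable B) (hA' : Summable A') (hB' : Summable B')
    (h1 : ∀ x y, w (x + y) * w' (x - y) = A x * B y)
    (h3 : ∀ x y, w (x + y + 1) * w' (x - y) = A' x * B' y) :
    (∑' j, w j) * ∑' j, w' j = (∑' j, A j) * (∑' j, B j) + (∑' j, A' j) * ∑' j, B' j := by
  have hm : ∀ {v : ℤ → ℝ}, Summable v → HasMoments v fun _ => (0 : ℝ) := fun hv p => by
    rcases p with _ | p
    · simpa using hv.abs
    · simp
  have := congrArg PowerSeries.constantCoeff
    (expSum_mul_parity (hm h) (hm h') (hm hA) (hm hB) (hm hA') (hm hB') h1 (by simp) h3 (by simp))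
  simpa only [map_mul, map_add, constantCoeff_expSum] using this

/-- The duplication formula for the theta value with half-integral indices. -/
theorem gaussNull_half_sq (hh : 0 < h) :
    gaussNull (h / 2) (1 / 2) ^ 2 = 2 * gaussNull h (1 / 2) * gaussNull h 0 := by
  have h2 : 0 < h / 2 := by positivity
  have h1 : gaussNull h 1 = gaussNull h 0 := by
    rw [gaussNull, gaussNull,
      ← (Equiv.addRight (1 : ℤ)).tsum_eq fun j : ℤ => Real.exp (-h * (j + 0) ^ 2)]
    refine tsum_congr fun j => ?_
    simp
  have := tsum_mul_parity (summable_gaussian h2 (1 / 2)) (summable_gaussian h2 (1 / 2))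
    (summable_gaussian hh (1 / 2)) (summable_gaussian hh 0)
    (summable_gaussian hh 1) (summable_gaussian hh (1 / 2)) (fun x y => ?_) (fun x y => ?_)
  · rw [sq, gaussNull, this]
    simp only [← gaussNull.eq_def, h1]
    ring
  all_goals
    rw [← Real.exp_add, ← Real.exp_add]
    push_cast
    ring_nf

theorem summable_theta (hh : 0 < h) (β : ℝ) : Summable (thetaWeight h β) := by
  simpa using summable_thetaWeight hh β 0

theorem thetaNull_eq_tsum (h β : ℝ) : thetaNull h β = ∑' j, thetaWeight h β j := by
  simp [thetaNull, thetaMoment]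

/-- The product of the even theta values with and without signs; in the parity splitting the second
part contains the odd theta value, which is zero. -/
theorem thetaNull_mul_gaussNull (hh : 0 < h) :
    thetaNull h 0 * gaussNull h 0 = thetaNull (2 * h) 0 ^ 2 := by
  have h2 : 0 < 2 * h := by positivity
  have := tsum_mul_parity (summable_theta hh 0) (summable_gaussian hh 0)
    (summable_theta h2 0) (summable_theta h2 0)
    (summable_theta h2 (1 / 2)).neg (summable_theta h2 (1 / 2)) (fun x y => ?_) (fun x y => ?_)
  · rw [thetaNull_eq_tsum, gaussNull, this, tsum_neg, ← thetaNull_eq_tsum, ← thetaNull_eq_tsum,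
      thetaMoment_half_zero]
    ring
  · simp only [thetaWeight]
    have h1 : Real.exp (-h * (((x + y : ℤ) : ℝ) + 0) ^ 2) *
        Real.exp (-h * (((x - y : ℤ) : ℝ) + 0) ^ 2) =
        Real.exp (-(2 * h) * (x + 0) ^ 2) * Real.exp (-(2 * h) * (y + 0) ^ 2) := by
      rw [← Real.exp_add, ← Real.exp_add]
      push_cast
      ring_nf
    rw [mul_assoc, h1, zpow_add₀ (by norm_num)]
    ring
  · simp only [thetaWeight]
    have h1 : Real.exp (-h * (((x + y + 1 : ℤ) : ℝ) + 0) ^ 2) *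
        Real.exp (-h * (((x - y : ℤ) : ℝ) + 0) ^ 2) =
        Real.exp (-(2 * h) * (x + 1 / 2) ^ 2) * Real.exp (-(2 * h) * (y + 1 / 2) ^ 2) := by
      rw [← Real.exp_add, ← Real.exp_add]
      push_cast
      ring_nf
    rw [mul_assoc, h1, neg_one_zpow_succ, zpow_add₀ (by norm_num)]
    ring

/-- The duplication formula for the odd theta series, at the level of derivatives. -/
theorem thetaDeriv_mul_gaussNull (hh : 0 < h) :
    thetaDeriv h * gaussNull h (1 / 2) = 2 * thetaNull (2 * h) 0 * thetaDeriv (2 * h) := by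
  have h2 : 0 < 2 * h := by positivity
  have hA := hasMoments_theta h2 1 1
  have hev : thetaSeries (2 * h) 1 1 = -thetaSeries (2 * h) 0 1 := by
    simpa using thetaSeries_add_one (2 * h) 0 1
  have := expSum_mul_parity (hasMoments_theta hh (1 / 2) 1)
    (hasMoments_gaussian hh (1 / 2) 1).zero_exponent
    (hasMoments_theta h2 (1 / 2) 1) (hasMoments_theta h2 0 1)
    hA.neg (hasMoments_theta h2 (1 / 2) 1)
    (fun x y => ?_) (fun x y => ?_) (fun x y => ?_) (fun x y => ?_)
  · rw [expSum_neg] at this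
    simp only [← thetaSeries.eq_def] at this
    rw [expSum_zero_exponent, ← gaussNull.eq_def, hev] at this
    have h1 := congrArg (PowerSeries.coeff 1) this
    have h3 := thetaMoment_half_zero (2 * h)
    rw [map_add, PowerSeries.coeff_mul_C, neg_neg, PowerSeries.coeff_mul, PowerSeries.coeff_mul,
      Nat.sum_antidiagonal_eq_sum_range_succ_mk, Nat.sum_antidiagonal_eq_sum_range_succ_mk] at h1
    simp only [sum_range_succ, sum_range_zero, coeff_thetaSeries, Nat.sub_self, Nat.sub_zero] at h1
    simp only [thetaNull] at h3
    norm_num [h3] at h1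
    norm_num
    linarith
  · simp only [thetaWeight]
    have h1 : Real.exp (-h * (((x + y : ℤ) : ℝ) + 1 / 2) ^ 2) *
        Real.exp (-h * (((x - y : ℤ) : ℝ) + 1 / 2) ^ 2) =
        Real.exp (-(2 * h) * (x + 1 / 2) ^ 2) * Real.exp (-(2 * h) * (y + 0) ^ 2) := by
      rw [← Real.exp_add, ← Real.exp_add]
      push_cast
      ring_nf
    rw [mul_assoc, h1, zpow_add₀ (by norm_num)]
    ring
  · push_cast
    ring
  · simp only [thetaWeight]
    have h1 : Real.exp (-h * (((x + y + 1 : ℤ) : ℝ) + 1 / 2) ^ 2) *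
        Real.exp (-h * (((x - y : ℤ) : ℝ) + 1 / 2) ^ 2) =
        Real.exp (-(2 * h) * (x + 1) ^ 2) * Real.exp (-(2 * h) * (y + 1 / 2) ^ 2) := by
      rw [← Real.exp_add, ← Real.exp_add]
      push_cast
      ring_nf
    rw [mul_assoc, h1, neg_one_zpow_succ, zpow_add₀ (by norm_num)]
    ring
  · push_cast
    ring

theorem gaussNull_half_eq (hh : 0 < h) : gaussNull (h / 2) (1 / 2) = 2 * triangleTheta h := by
  have hs := summable_gaussian (half_pos hh) (1 / 2)
  have h1 : ∀ n : ℕ, Real.exp (-(h / 2) * (((n : ℤ) : ℝ) + 1 / 2) ^ 2) =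
      Real.exp (-h * (2 * n + 1) ^ 2 / 8) := fun n => by
    push_cast
    ring_nf
  have h2 : ∀ n : ℕ, Real.exp (-(h / 2) * (((-(n + 1 : ℤ) : ℤ) : ℝ) + 1 / 2) ^ 2) =
      Real.exp (-h * (2 * n + 1) ^ 2 / 8) := fun n => by
    push_cast
    ring_nf
  have s1 : Summable fun n : ℕ => Real.exp (-h * (2 * n + 1) ^ 2 / 8) :=
    (hs.comp_injective Nat.cast_injective).congr fun n => h1 n
  have := HasSum.of_nat_of_neg_add_one
    (f := fun j : ℤ => Real.exp (-(h / 2) * ((j : ℝ) + 1 / 2) ^ 2))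
    (s1.hasSum.congr_fun h1) (s1.hasSum.congr_fun h2)
  rw [gaussNull, this.tsum_eq, triangleTheta]
  ring

theorem triangleTheta_pos (hh : 0 < h) : 0 < triangleTheta h := by
  have hs := summable_gaussian (half_pos hh) (1 / 2)
  have : 0 < gaussNull (h / 2) (1 / 2) :=
    hs.tsum_pos (fun _ => (Real.exp_pos _).le) 0 (Real.exp_pos _)
  rw [gaussNull_half_eq hh] at this
  linarith

/-- As `h → ∞`, an exponentially damped sum tends to the sum of its undamped terms. -/
theorem tendsto_tsum_exp {a m : ℤ → ℝ} (hm : ∀ j, 0 ≤ m j)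
    (ha : Summable fun j => |a j| * Real.exp (-m j)) :
    Tendsto (fun h : ℝ => ∑' j, a j * Real.exp (-h * m j)) atTop
      (𝓝 (∑' j, if m j = 0 then a j else 0)) := by
  refine tendsto_tsum_of_dominated_convergence ha (fun j => ?_) ?_
  · split_ifs with hj
    · simp [hj]
    · have hpos : 0 < m j := lt_of_le_of_ne (hm j) (Ne.symm hj)
      have : Tendsto (fun h : ℝ => -h * m j) atTop atBot :=
        (tendsto_neg_atTop_atBot).atBot_mul_const hpos
      simpa using (Real.tendsto_exp_atBot.comp this).const_mul (a j)
  · filter_upwards [eventually_ge_atTop 1] with h hh j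
    rw [Real.norm_eq_abs, abs_mul, abs_of_pos (Real.exp_pos _)]
    gcongr
    nlinarith [hm j]

theorem tendsto_thetaNull : Tendsto (fun h => thetaNull h 0) atTop (𝓝 1) := by
  have hs : Summable fun j : ℤ => |(-1 : ℝ) ^ j| * Real.exp (-(j : ℝ) ^ 2) := by
    refine (summable_gaussian one_pos 0).congr fun j => ?_
    rw [abs_zpow]
    simp
  have := tendsto_tsum_exp (a := fun j => (-1) ^ j) (m := fun j => (j : ℝ) ^ 2)
    (fun j => by positivity) hs
  rw [tsum_eq_single 0 fun j hj => by simp [hj]] at this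
  simpa [thetaNull, thetaMoment, thetaWeight] using this

theorem int_sq_add_self_nonneg (j : ℤ) : 0 ≤ (j : ℝ) ^ 2 + j := by
  have : 0 ≤ j ^ 2 + j := by
    rcases le_or_gt 0 j with h | h <;> nlinarith
  exact_mod_cast this

theorem int_sq_add_self_eq_zero (j : ℤ) : (j : ℝ) ^ 2 + j = 0 ↔ j ∈ ({0, -1} : Finset ℤ) := by
  rw [mem_insert, mem_singleton, show (j : ℝ) ^ 2 + j = j * (j + 1) by ring, mul_eq_zero]
  refine or_congr (by simp) ⟨fun h => ?_, fun h => by simp [h]⟩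
  have : (j : ℝ) = -1 := by linarith
  exact_mod_cast this

theorem tsum_ite_sq_add_self (a : ℤ → ℝ) :
    (∑' j : ℤ, if (j : ℝ) ^ 2 + j = 0 then a j else 0) = a 0 + a (-1) := by
  rw [tsum_eq_sum (s := {0, -1}) fun j hj => if_neg fun h => hj ((int_sq_add_self_eq_zero j).1 h)]
  simp

theorem exp_shift (h : ℝ) (j : ℤ) :
    Real.exp (h / 4) * Real.exp (-h * (j + 1 / 2) ^ 2) = Real.exp (-h * ((j : ℝ) ^ 2 + j)) := by
  rw [← Real.exp_add]
  ring_nf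

theorem tendsto_gaussNull_half :
    Tendsto (fun h => Real.exp (h / 4) * gaussNull h (1 / 2)) atTop (𝓝 2) := by
  have hs : Summable fun j : ℤ => |(1 : ℝ)| * Real.exp (-((j : ℝ) ^ 2 + j)) := by
    refine ((summable_gaussian one_pos (1 / 2)).mul_left (Real.exp (1 / 4))).congr fun j => ?_
    rw [exp_shift]
    simp
  have := tendsto_tsum_exp (a := fun _ => 1) (m := fun j => (j : ℝ) ^ 2 + j)
    int_sq_add_self_nonneg hs
  rw [tsum_ite_sq_add_self] at this
  norm_num at this
  refine this.congr fun h => ?_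
  rw [gaussNull, ← tsum_mul_left]
  refine tsum_congr fun j => ?_
  rw [exp_shift]
  ring_nf

theorem tendsto_thetaDeriv :
    Tendsto (fun h => Real.exp (h / 4) * thetaDeriv h) atTop (𝓝 1) := by
  have hs : Summable fun j : ℤ => |(-1 : ℝ) ^ j * (j + 1 / 2)| * Real.exp (-((j : ℝ) ^ 2 + j)) := by
    refine (((hasMoments_gaussian one_pos (1 / 2) 1) 1).mul_left (Real.exp (1 / 4))).congr
      fun j => ?_
    rw [abs_neg_one_zpow_mul, abs_of_pos (Real.exp_pos _), ← mul_assoc, exp_shift]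
    simp
    ring
  have := tendsto_tsum_exp (a := fun j => (-1) ^ j * (j + 1 / 2)) (m := fun j => (j : ℝ) ^ 2 + j)
    int_sq_add_self_nonneg hs
  rw [tsum_ite_sq_add_self] at this
  norm_num at this
  refine this.congr fun h => ?_
  rw [thetaDeriv, thetaMoment, ← tsum_mul_left]
  refine tsum_congr fun j => ?_
  have := exp_shift h j
  rw [thetaWeight]
  norm_num at this ⊢
  linear_combination (-1) ^ j * ((j : ℝ) + 1 / 2) * this.symm

theorem tendsto_two_pow_mul (hh : 0 < h) : Tendsto (fun n : ℕ => 2 ^ n * h) atTop atTop :=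
  (tendsto_pow_atTop_atTop_of_one_lt one_lt_two).atTop_mul_const hh

/-- A zero at `h` would produce a zero at each `2 ^ n * h`, although the theta value tends to `1`
for `h → ∞`. -/
theorem thetaNull_ne_zero (hh : 0 < h) : thetaNull h 0 ≠ 0 := fun h0 => by
  have hn : ∀ n : ℕ, thetaNull (2 ^ n * h) 0 = 0 := fun n => by
    induction n with
    | zero => simpa using h0
    | succ n ih =>
      have := thetaNull_mul_gaussNull (h := 2 ^ n * h) (by positivity)
      rw [ih, zero_mul, ← mul_assoc, ← pow_succ'] at this
      exact pow_eq_zero_iff two_ne_zero |>.1 this.symm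
  have := tendsto_thetaNull.comp (tendsto_two_pow_mul hh)
  simp only [Function.comp_def, hn] at this
  exact zero_ne_one (tendsto_nhds_unique tendsto_const_nhds this)

theorem gaussNull_pos (hh : 0 < h) (β : ℝ) : 0 < gaussNull h β :=
  (summable_gaussian hh β).tsum_pos (fun _ => (Real.exp_pos _).le) 0 (Real.exp_pos _)

/-- Jacobi's derivative formula: the derivative of the odd theta series at the origin is the
product of the values of the three even ones. Both sides satisfy the same functional equation
under doubling of `h`, and they are asymptotically equal for `h → ∞`. -/
theorem thetaDeriv_eq (hh : 0 < h) : thetaDeriv h = triangleTheta h ^ 2 * thetaNull h 0 := by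
  -- `Y` is twice the right-hand side, in a form whose duplication and limit are known
  set Y : ℝ → ℝ := fun h => gaussNull h (1 / 2) * thetaNull (2 * h) 0 ^ 2 with hY
  have hYne : ∀ h, 0 < h → Y h ≠ 0 := fun h hh =>
    mul_ne_zero (gaussNull_pos hh _).ne' (pow_ne_zero _ (thetaNull_ne_zero (by positivity)))
  have hYs : ∀ h, 0 < h → Y h * gaussNull h (1 / 2) = 2 * thetaNull (2 * h) 0 * Y (2 * h) := by
    intro h hh
    have e1 := gaussNull_half_sq (h := 2 * h) (by positivity)
    have e2 := thetaNull_mul_gaussNull (h := 2 * h) (by positivity)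
    rw [mul_div_cancel_left₀ _ two_ne_zero] at e1
    simp only [hY]
    linear_combination thetaNull (2 * h) 0 ^ 2 * e1 +
      2 * gaussNull (2 * h) (1 / 2) * thetaNull (2 * h) 0 * e2
  -- the quotient is invariant under doubling, hence equal to its limit
  have hstep : ∀ h, 0 < h → 2 * thetaDeriv h / Y h = 2 * thetaDeriv (2 * h) / Y (2 * h) := by
    intro h hh
    rw [div_eq_div_iff (hYne h hh) (hYne _ (by positivity))]
    have e1 := thetaDeriv_mul_gaussNull hh
    have e2 := hYs h hh
    have h1 := (gaussNull_pos hh (1 / 2)).ne'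
    have h2 := thetaNull_ne_zero (h := 2 * h) (by positivity)
    refine mul_right_cancel₀ (mul_ne_zero h1 h2) ?_
    linear_combination 2 * thetaNull (2 * h) 0 * Y (2 * h) * e1 -
      2 * thetaNull (2 * h) 0 * thetaDeriv (2 * h) * e2
  have hpow : ∀ n : ℕ, 2 * thetaDeriv (2 ^ n * h) / Y (2 ^ n * h) = 2 * thetaDeriv h / Y h := by
    intro n
    induction n with
    | zero => simp
    | succ n ih => rw [pow_succ', mul_assoc, ← hstep _ (by positivity), ih]
  have hlim : Tendsto (fun h => 2 * thetaDeriv h / Y h) atTop (𝓝 1) := by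
    have l1 := (tendsto_thetaDeriv.const_mul 2).div (tendsto_gaussNull_half.mul
      ((tendsto_thetaNull.comp (tendsto_id.const_mul_atTop (two_pos (α := ℝ)))).pow 2))
      (by norm_num)
    norm_num at l1
    refine l1.congr fun h => ?_
    simp only [Pi.div_apply, hY]
    have := (Real.exp_pos (h / 4)).ne'
    norm_num
    rw [mul_left_comm, mul_assoc (Real.exp _), mul_div_mul_left _ _ this]
  have h1 := hlim.comp (tendsto_two_pow_mul hh)
  simp only [Function.comp_def, hpow] at h1
  have h2 := tendsto_nhds_unique tendsto_const_nhds h1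
  rw [div_eq_one_iff_eq (hYne h hh)] at h2
  have e1 := gaussNull_half_sq hh
  have e2 := thetaNull_mul_gaussNull hh
  rw [gaussNull_half_eq hh] at e1
  simp only [hY] at h2
  linear_combination h2 / 2 - thetaNull h 0 / 4 * e1 - gaussNull h (1 / 2) / 2 * e2

theorem thetaDeriv_ne_zero (hh : 0 < h) : thetaDeriv h ≠ 0 := by
  rw [thetaDeriv_eq hh]
  exact mul_ne_zero (pow_ne_zero _ (triangleTheta_pos hh).ne') (thetaNull_ne_zero hh)

end constants

/-! ### Hankel determinants and the Toda equation -/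

/-- The Hankel determinant of size `n` of the sequence `a`. -/
def hankelDet {R : Type*} [CommRing R] (a : ℕ → R) (n : ℕ) : R :=
  (Matrix.of fun i j : Fin n => a (i + j)).det

section toda

variable {R S : Type*} [CommRing R] [CommSemiring S] [Algebra S R]

/-- The determinant of the matrix that arises from the Hankel matrix of size `n + 1` of the sequence
`a` by replacing the index `n` of the last row by `r` and that of the last column by `s`. -/
def borderedHankel (a : ℕ → R) (n r s : ℕ) : R :=
  (Matrix.of fun i j : Fin n ⊕ Fin 1 =>
    a (Sum.elim Fin.val (fun _ => r) i + Sum.elim Fin.val (fun _ => s) j)).det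

/-- With `r = s = n` nothing is replaced. -/
theorem borderedHankel_self (a : ℕ → R) (n : ℕ) : borderedHankel a n n n = hankelDet a (n + 1) := by
  rw [borderedHankel, hankelDet, ← Matrix.det_submatrix_equiv_self finSumFinEquiv]
  congr 1
  ext i j
  rcases i with i | i <;> rcases j with j | j <;> simp

theorem borderedHankel_comm (a : ℕ → R) (n r s : ℕ) :
    borderedHankel a n r s = borderedHankel a n s r := by
  rw [borderedHankel, borderedHankel, ← Matrix.det_transpose]
  congr 1
  ext i j
  simp [add_comm]

theorem derivation_prod {ι : Type*} [DecidableEq ι] (D : Derivation S R R) (s : Finset ι)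
    (f : ι → R) : D (∏ i ∈ s, f i) = ∑ i ∈ s, ∏ j ∈ s, Function.update f i (D (f i)) j := by
  induction s using Finset.induction_on with
  | empty => simp
  | insert k s hk ih =>
    rw [prod_insert hk, D.leibniz, ih, sum_insert hk, smul_eq_mul, smul_eq_mul, add_comm]
    congr 1
    · rw [prod_insert hk, Function.update_self, mul_comm]
      congr 1
      exact prod_congr rfl fun j hj => by
        rw [Function.update_of_ne (ne_of_mem_of_not_mem hj hk)]
    · rw [mul_sum]
      refine sum_congr rfl fun i hi => ?_
      rw [prod_insert hk, Function.update_of_ne (ne_of_mem_of_not_mem hi hk).symm]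

/-- The derivative of a determinant is the sum of the determinants with one differentiated
column. -/
theorem derivation_det {ι : Type*} [DecidableEq ι] [Fintype ι] (D : Derivation S R R)
    (M : Matrix ι ι R) :
    D M.det = ∑ k, (M.updateCol k fun i => D (M i k)).det := by
  simp only [Matrix.det_apply, map_sum]
  rw [sum_comm]
  refine sum_congr rfl fun σ _ => ?_
  rw [← smul_sum, Units.smul_def, Units.smul_def, map_zsmul, derivation_prod]
  congr 1
  refine sum_congr rfl fun k _ => prod_congr rfl fun j _ => ?_
  by_cases hj : j = k
  · subst hj; simp
  · simp [Matrix.updateCol_ne hj, Function.update_of_ne hj]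

/-- If the derivation shifts the sequence, only the column that was replaced contributes to the
derivative: differentiating another column makes it equal to the next one. -/
theorem derivation_borderedHankel (D : Derivation S R R) {a : ℕ → R}
    (ha : ∀ k, D (a k) = a (k + 1)) (n r : ℕ) :
    D (borderedHankel a n r n) = borderedHankel a n r (n + 1) := by
  rw [borderedHankel, derivation_det, sum_eq_single (Sum.inr 0)]
  · rw [borderedHankel]
    congr 1
    ext i j
    rcases j with j | j
    · simp
    · fin_cases j
      simp [ha, add_assoc]
  · rintro (k | k) - hk
    · -- the differentiated column agrees with the next one
      set k' : Fin n ⊕ Fin 1 := if h : (k : ℕ) + 1 < n then Sum.inl ⟨k + 1, h⟩ else Sum.inr 0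
      have hne : k' ≠ Sum.inl k := by
        simp only [k']
        split_ifs
        · simp [Fin.ext_iff]
        · simp
      refine Matrix.det_zero_of_column_eq hne fun i => ?_
      rw [Matrix.updateCol_ne hne, Matrix.updateCol_self]
      simp only [Matrix.of_apply, ha, k']
      split_ifs with h
      · simp [add_assoc]
      · have : n = k + 1 := by omega
        simp only [Sum.elim_inr, Sum.elim_inl]
        congr 1
        omega
    · exact absurd (by fin_cases k; rfl) hk
  · simp

/-- Schur's formula for a determinant with one bordering row and column. -/
theorem det_border {K ι : Type*} [Field K] [DecidableEq ι] [Fintype ι] (A : Matrix ι ι K)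
    [Invertible A] (b c : ι → K) (d : K) :
    (Matrix.fromBlocks A (Matrix.of fun i (_ : Fin 1) => b i) (Matrix.of fun (_ : Fin 1) j => c j)
      (Matrix.of fun _ _ => d)).det = A.det * (d - ∑ i, ∑ j, c i * (⅟A) i j * b j) := by
  rw [Matrix.det_fromBlocks₁₁, Matrix.det_fin_one]
  congr 1
  simp only [Matrix.sub_apply, Matrix.of_apply, Matrix.mul_apply, sum_mul]
  rw [sum_comm]

/-- The Desnanot–Jacobi identity over a field: all five determinants are expressed by the Schur
complement of the Hankel matrix of size `n`. -/
theorem hankelDet_desnanot_jacobi_of_field {K : Type*} [Field K] (b : ℕ → K) (n : ℕ)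
    (hn : hankelDet b n ≠ 0) :
    hankelDet b (n + 2) * hankelDet b n =
      borderedHankel b n n n * borderedHankel b n (n + 1) (n + 1) -
        borderedHankel b n n (n + 1) * borderedHankel b n (n + 1) n := by
  set A : Matrix (Fin n) (Fin n) K := Matrix.of fun i j => b (i + j) with hA
  let _ : Invertible A := Matrix.invertibleOfIsUnitDet A (isUnit_iff_ne_zero.2 hn)
  have hP : ∀ r s, borderedHankel b n r s =
      A.det * (b (r + s) - ∑ i : Fin n, ∑ j : Fin n, b (r + i) * (⅟A) i j * b (j + s)) := by
    intro r s
    rw [← det_border]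
    rw [borderedHankel]
    congr 1
    ext i j
    rcases i with i | i <;> rcases j with j | j <;> simp [hA]
  have hQ : hankelDet b (n + 2) = A.det *
      (Matrix.of fun r s : Fin 2 => b ((n + r) + (n + s)) -
        ∑ i : Fin n, ∑ j : Fin n, b (n + r + i) * (⅟A) i j * b (j + (n + s))).det := by
    have : hankelDet b (n + 2) = (Matrix.fromBlocks A
        (Matrix.of fun (i : Fin n) (s : Fin 2) => b (i + (n + s)))
        (Matrix.of fun (r : Fin 2) (j : Fin n) => b (n + r + j))
        (Matrix.of fun r s : Fin 2 => b ((n + r) + (n + s)))).det := by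
      rw [hankelDet, ← Matrix.det_submatrix_equiv_self finSumFinEquiv]
      congr 1
      ext i j
      rcases i with i | i <;> rcases j with j | j <;> simp [hA]
    rw [this, Matrix.det_fromBlocks₁₁]
    congr 2
    ext r s
    simp only [Matrix.sub_apply, Matrix.of_apply, Matrix.mul_apply, sum_mul]
    rw [sum_comm]
  rw [hQ, hP, hP, hP, hP, Matrix.det_fin_two]
  simp only [Matrix.of_apply, Fin.val_zero, Fin.val_one, add_zero]
  have : hankelDet b n = A.det := rfl
  rw [this]
  ring

/-- The Desnanot–Jacobi identity for Hankel determinants. -/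
theorem hankelDet_desnanot_jacobi [IsDomain R] (a : ℕ → R) (n : ℕ) (hn : hankelDet a n ≠ 0) :
    hankelDet a (n + 2) * hankelDet a n =
      borderedHankel a n n n * borderedHankel a n (n + 1) (n + 1) -
        borderedHankel a n n (n + 1) * borderedHankel a n (n + 1) n := by
  have hinj : Function.Injective (algebraMap R (FractionRing R)) := IsFractionRing.injective R _
  apply hinj
  have h1 : ∀ m, algebraMap R (FractionRing R) (hankelDet a m) =
      hankelDet (fun k => algebraMap R (FractionRing R) (a k)) m := fun m => by
    rw [hankelDet, hankelDet, RingHom.map_det]; rfl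
  have h2 : ∀ r s, algebraMap R (FractionRing R) (borderedHankel a n r s) =
      borderedHankel (fun k => algebraMap R (FractionRing R) (a k)) n r s := fun r s => by
    rw [borderedHankel, borderedHankel, RingHom.map_det]; rfl
  rw [map_mul, map_sub, map_mul, map_mul, h1, h1, h2, h2, h2, h2]
  refine hankelDet_desnanot_jacobi_of_field _ n ?_
  rw [← h1]
  exact (map_ne_zero_iff _ hinj).2 hn

end toda

/-- The iterated derivatives of a power series. -/
noncomputable def iterDeriv (f : PowerSeries ℝ) (k : ℕ) : PowerSeries ℝ :=
  (PowerSeries.derivative ℝ)^[k] f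

theorem derivative_iterDeriv (f : PowerSeries ℝ) (k : ℕ) :
    PowerSeries.derivative ℝ (iterDeriv f k) = iterDeriv f (k + 1) := by
  rw [iterDeriv, iterDeriv, Function.iterate_succ_apply']

/-- The Toda equation for the Hankel determinants of the derivatives of a function. -/
theorem toda {a : ℕ → PowerSeries ℝ} (ha : ∀ k, PowerSeries.derivative ℝ (a k) = a (k + 1)) (n : ℕ)
    (hn : hankelDet a n ≠ 0) :
    hankelDet a (n + 2) * hankelDet a n = bracket (hankelDet a (n + 1)) := by
  have h1 : PowerSeries.derivative ℝ (hankelDet a (n + 1)) = borderedHankel a n n (n + 1) := by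
    rw [← borderedHankel_self, derivation_borderedHankel _ ha]
  have h2 : PowerSeries.derivative ℝ (borderedHankel a n n (n + 1)) =
      borderedHankel a n (n + 1) (n + 1) := by
    rw [borderedHankel_comm, derivation_borderedHankel _ ha]
  rw [hankelDet_desnanot_jacobi a n hn, bracket, h1, h2, ← borderedHankel_self,
    borderedHankel_comm a n (n + 1) n]
  ring

/-! ### Evaluation of the Hankel determinants of Lambert series -/

/-- The product `(0! * 1! * ⋯ * (n - 1)!) ^ 2`. -/
noncomputable def superFactorialSq (n : ℕ) : ℝ := ∏ l ∈ range n, (l.factorial : ℝ) ^ 2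

theorem superFactorialSq_ne_zero (n : ℕ) : superFactorialSq n ≠ 0 :=
  prod_ne_zero_iff.2 fun l _ => pow_ne_zero _ (Nat.cast_ne_zero.2 l.factorial_ne_zero)

theorem superFactorialSq_succ_succ (n : ℕ) :
    superFactorialSq (n + 2) * superFactorialSq n = (n + 1) ^ 2 * superFactorialSq (n + 1) ^ 2 := by
  simp only [superFactorialSq, prod_range_succ, Nat.factorial_succ]
  push_cast
  ring

/-- Two solutions of the Toda equation with the same initial values coincide: if `H` satisfies the
Toda equation and `T` the corresponding theta relation, then `H n` is, up to a constant, the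
quotient of `T n` by `θ ^ (n + s) ^ 2`. -/
theorem toda_unique {H T : ℕ → PowerSeries ℝ} {θ : PowerSeries ℝ} {k : ℕ → ℝ} {c : ℝ} {s : ℕ}
    (hH : ∀ n, H n ≠ 0 → H (n + 2) * H n = bracket (H (n + 1)))
    (hT : ∀ n, bracket (T (n + 1)) * θ ^ 2 -
        PowerSeries.C (((n + 1 + s : ℕ) : ℝ) ^ 2) * bracket θ * T (n + 1) ^ 2 =
      PowerSeries.C (((n + 1 + s : ℕ) : ℝ) ^ 2 * c ^ 2) * (T (n + 2) * T n))
    (hT0 : ∀ n, T n ≠ 0) (hk0 : ∀ n, k n ≠ 0)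
    (hk : ∀ n, k (n + 2) * k n = ((n + 1 + s : ℕ) : ℝ) ^ 2 * c ^ 2 * k (n + 1) ^ 2)
    (h0 : H 0 * θ ^ (s ^ 2) = PowerSeries.C (k 0) * T 0)
    (h1 : H 1 * θ ^ ((1 + s) ^ 2) = PowerSeries.C (k 1) * T 1) (n : ℕ) :
    H n * θ ^ ((n + s) ^ 2) = PowerSeries.C (k n) * T n := by
  have hC : ∀ n, PowerSeries.C (k n) ≠ 0 := fun n => by
    rw [Ne, map_eq_zero_iff _ PowerSeries.C_injective]
    exact hk0 n
  induction n using Nat.strong_induction_on with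
  | _ n ih =>
  rcases n with _ | _ | n
  · simpa using h0
  · simpa using h1
  · have i0 := ih n (by omega)
    have i1 := ih (n + 1) (by omega)
    have hHn : H n ≠ 0 := fun h => by
      rw [h, zero_mul] at i0
      exact mul_ne_zero (hC n) (hT0 n) i0.symm
    have hb := congrArg bracket i1
    rw [bracket_mul, bracket_C_mul] at hb
    have hp := bracket_pow_mul θ ((n + 1 + s) ^ 2)
    have e2 : (n + 2 + s) ^ 2 + (n + s) ^ 2 = 2 * (n + 1 + s) ^ 2 + 2 := by ring
    have e3 : θ ^ ((n + 2 + s) ^ 2) * θ ^ ((n + s) ^ 2) = (θ ^ ((n + 1 + s) ^ 2)) ^ 2 * θ ^ 2 := by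
      rw [← pow_add, e2, pow_add, ← pow_mul, mul_comm 2]
    have e4 : θ ^ (2 * (n + 1 + s) ^ 2) = (θ ^ ((n + 1 + s) ^ 2)) ^ 2 := by
      rw [← pow_mul, mul_comm 2]
    have hkC := congrArg (PowerSeries.C (R := ℝ)) (hk n)
    have hTn := hT n
    have e5 : PowerSeries.C (((n + 1 + s : ℕ) : ℝ) ^ 2) =
        ((((n + 1 + s) ^ 2 : ℕ)) : PowerSeries ℝ) := by
      rw [← Nat.cast_pow, map_natCast]
    simp only [map_mul, e5] at hkC hTn
    simp only [map_pow] at hkC hTn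
    refine mul_right_cancel₀ (mul_ne_zero (hC n) (hT0 n)) ?_
    rw [e4] at hp
    have hH2 := hH n hHn
    rw [← i0]
    -- compare with the bracket of the identity for `n + 1`
    have step : H (n + 2) * θ ^ ((n + 2 + s) ^ 2) * (H n * θ ^ ((n + s) ^ 2)) =
        bracket (H (n + 1)) * ((θ ^ ((n + 1 + s) ^ 2)) ^ 2 * θ ^ 2) := by
      rw [← hH2, ← e3]; ring
    rw [step, i0]
    set X := θ ^ ((n + 1 + s) ^ 2)
    have hsq : H (n + 1) ^ 2 * X ^ 2 = PowerSeries.C (k (n + 1)) ^ 2 * T (n + 1) ^ 2 := by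
      rw [← mul_pow, i1, mul_pow]
    linear_combination θ ^ 2 * hb - H (n + 1) ^ 2 * hp -
      (((n + 1 + s) ^ 2 : ℕ) : PowerSeries ℝ) * bracket θ * hsq +
      PowerSeries.C (k (n + 1)) ^ 2 * hTn - T (n + 2) * T n * hkC

theorem hankelDet_zero {R : Type*} [CommRing R] (a : ℕ → R) : hankelDet a 0 = 1 := by
  simp [hankelDet]

theorem hankelDet_one {R : Type*} [CommRing R] (a : ℕ → R) : hankelDet a 1 = a 0 := by
  simp [hankelDet]

theorem map_hankelDet {R S : Type*} [CommRing R] [CommRing S] (f : R →+* S) (a : ℕ → R) (n : ℕ) :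
    f (hankelDet a n) = hankelDet (fun k => f (a k)) n := by
  rw [hankelDet, hankelDet, RingHom.map_det]
  rfl

/-- The moments of the Lambert series. -/
noncomputable def cosechMoment (h α : ℝ) (p : ℕ) : ℝ :=
  ∑' j : ℤ, cosechWeight h α j * (j + α) ^ p

theorem iterDeriv_expSum {ι : Type*} (w e : ι → ℝ) (p : ℕ) :
    iterDeriv (expSum w e) p = expSum (fun i => w i * e i ^ p) e := by
  induction p with
  | zero => simp [iterDeriv]
  | succ p ih =>
    rw [← derivative_iterDeriv, ih, derivative_expSum]
    simp only [pow_succ, mul_assoc]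

theorem constantCoeff_iterDeriv_lambertSeries (h α : ℝ) (p : ℕ) :
    PowerSeries.constantCoeff (iterDeriv (lambertSeries h α) p) = cosechMoment h α p := by
  rw [lambertSeries, iterDeriv_expSum, constantCoeff_expSum, cosechMoment]

section evaluation

variable {h α : ℝ}

theorem thetaSeries_add_nat (h β x : ℝ) (n : ℕ) :
    thetaSeries h (β + n) x = PowerSeries.C ((-1) ^ n) * thetaSeries h β x := by
  induction n with
  | zero => simp
  | succ n ih =>
    rw [Nat.cast_succ, ← add_assoc, thetaSeries_add_one, ih, pow_succ]
    simp

theorem thetaSeries_ne_zero_of_thetaNull {β : ℝ} (hβ : thetaNull h β ≠ 0) (x : ℝ) :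
    thetaSeries h β x ≠ 0 := fun h0 => hβ <| by
  rw [← constantCoeff_thetaSeries h β x, h0, map_zero]

theorem thetaSeries_half_ne_zero (hh : 0 < h) {x : ℝ} (hx : x ≠ 0) :
    thetaSeries h (1 / 2) x ≠ 0 := fun h0 => by
  have := coeff_thetaSeries h (1 / 2) x 1
  rw [h0] at this
  simp only [map_zero, pow_one, Nat.factorial_one, Nat.cast_one, div_one] at this
  exact mul_ne_zero hx (thetaDeriv_ne_zero hh) this.symm

theorem thetaNull_sub_half_ne_zero (hh : 0 < h) (h0 : 0 < α) (h1 : α < 1) :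
    thetaNull h (α - 1 / 2) ≠ 0 := fun h2 => thetaDeriv_ne_zero hh <| by
  rw [← lambertConst_mul_thetaNull hh h0 h1, h2, mul_zero]

theorem thetaSeries_shift_ne_zero {β : ℝ} (n : ℕ) {x : ℝ} (h1 : thetaSeries h β x ≠ 0)
    (h2 : thetaSeries h (β + 1 / 2) x ≠ 0) : thetaSeries h (β + n / 2) x ≠ 0 := by
  have hC : ∀ N : ℕ, PowerSeries.C ((-1 : ℝ) ^ N) ≠ 0 := fun N => by
    rw [Ne, map_eq_zero_iff _ PowerSeries.C_injective]
    exact pow_ne_zero _ (by norm_num)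
  obtain ⟨N, rfl | rfl⟩ := n.even_or_odd'
  · rw [show β + ((2 * N : ℕ) : ℝ) / 2 = β + N by push_cast; ring, thetaSeries_add_nat]
    exact mul_ne_zero (hC N) h1
  · rw [show β + ((2 * N + 1 : ℕ) : ℝ) / 2 = β + 1 / 2 + N by push_cast; ring, thetaSeries_add_nat]
    exact mul_ne_zero (hC N) h2

/-- The Hankel determinants of a Lambert series; this is the confluent case of Frobenius' elliptic
determinant evaluation. -/
theorem hankelDet_lambertSeries (hh : 0 < h) (h0 : 0 < α) (h1 : α ≤ 1 / 2) (n : ℕ) :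
    hankelDet (iterDeriv (lambertSeries h α)) n * thetaSeries h 0 1 ^ (n ^ 2) =
      PowerSeries.C (thetaDeriv h ^ (n ^ 2) / thetaNull h (α - 1 / 2) * superFactorialSq n) *
        thetaSeries h (α - 1 / 2 + n / 2) n := by
  have hc := thetaDeriv_ne_zero hh
  have hN := thetaNull_sub_half_ne_zero hh h0 (by linarith)
  refine toda_unique (H := hankelDet (iterDeriv (lambertSeries h α)))
    (T := fun n => thetaSeries h (α - 1 / 2 + n / 2) n) (θ := thetaSeries h 0 1)
    (k := fun n => thetaDeriv h ^ (n ^ 2) / thetaNull h (α - 1 / 2) * superFactorialSq n)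
    (c := thetaDeriv h) (s := 0)
    (fun n hn => toda (derivative_iterDeriv _) n hn) (fun n => ?_)
    (fun n => ?_)
    (fun n => mul_ne_zero (div_ne_zero (pow_ne_zero _ hc) hN) (superFactorialSq_ne_zero n))
    (fun n => ?_) ?_ ?_ n
  · have := bracket_thetaSeries hh (α - 1 / 2 + (n + 1 : ℕ) / 2) (n + 1 : ℕ)
    rw [add_zero, this]
    congr 2
    · congr 1
      · push_cast; ring
      · push_cast; ring
    · congr 1
      · push_cast; ring
      · push_cast; ring
  · rcases n.eq_zero_or_pos with rfl | hn
    · simpa using thetaSeries_ne_zero_of_thetaNull hN 0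
    · have hn' : (n : ℝ) ≠ 0 := by exact_mod_cast hn.ne'
      refine thetaSeries_shift_ne_zero n (thetaSeries_ne_zero_of_thetaNull hN _) ?_
      rw [sub_add_cancel]
      rcases h1.eq_or_lt with rfl | h1
      · exact thetaSeries_half_ne_zero hh hn'
      · have := thetaNull_sub_half_ne_zero (α := α + 1 / 2) hh (by linarith) (by linarith)
        rw [add_sub_cancel_right] at this
        exact thetaSeries_ne_zero_of_thetaNull this _
  · have := superFactorialSq_succ_succ n
    have e : thetaDeriv h ^ ((n + 2) ^ 2) * thetaDeriv h ^ (n ^ 2) =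
        thetaDeriv h ^ 2 * (thetaDeriv h ^ ((n + 1) ^ 2)) ^ 2 := by
      rw [← pow_add, ← pow_mul, ← pow_add]
      congr 1
      ring
    generalize thetaNull h (α - 1 / 2) = t at hN ⊢
    field_simp
    push_cast
    linear_combination superFactorialSq (n + 2) * superFactorialSq n * e +
      thetaDeriv h ^ 2 * (thetaDeriv h ^ ((n + 1) ^ 2)) ^ 2 * this
  · rw [hankelDet_zero]
    have : thetaSeries h (α - 1 / 2 + ((0 : ℕ) : ℝ) / 2) ((0 : ℕ) : ℝ) =
        PowerSeries.C (thetaNull h (α - 1 / 2)) := by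
      rw [thetaNull_eq_tsum]
      simp [thetaSeries, expSum_zero_exponent]
    rw [this, ← map_mul]
    generalize thetaNull h (α - 1 / 2) = t at hN ⊢
    simp [superFactorialSq, hN]
  · rw [hankelDet_one]
    have h2 := lambertSeries_mul_theta_eq hh h0 (by linarith)
    have h3 := lambertConst_mul_thetaNull hh h0 (by linarith)
    rw [← eq_div_iff hN] at h3
    rw [h3] at h2
    simp [superFactorialSq, iterDeriv] at h2 ⊢
    exact h2

/-- The Hankel determinants of the moments of a Lambert series, by evaluation of
`hankelDet_lambertSeries` at the origin. The factor `θ ^ (n ^ 2)` cancels by Jacobi's derivative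
formula. -/
theorem hankelDet_cosechMoment (hh : 0 < h) (h0 : 0 < α) (h1 : α ≤ 1 / 2) (n : ℕ) :
    hankelDet (cosechMoment h α) n = superFactorialSq n * triangleTheta h ^ (2 * n ^ 2) *
      (thetaNull h (α - 1 / 2 + n / 2) / thetaNull h (α - 1 / 2)) := by
  have h2 := congrArg PowerSeries.constantCoeff (hankelDet_lambertSeries hh h0 h1 n)
  rw [map_mul, map_mul, map_pow, map_hankelDet, constantCoeff_thetaSeries,
    constantCoeff_thetaSeries, PowerSeries.constantCoeff_C, thetaDeriv_eq hh, mul_pow,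
    ← pow_mul] at h2
  simp only [constantCoeff_iterDeriv_lambertSeries] at h2
  refine mul_right_cancel₀ (pow_ne_zero (n ^ 2) (thetaNull_ne_zero hh)) (h2.trans ?_)
  ring

end evaluation

/-- The even and the odd integers. -/
noncomputable def evenOddEquiv : ℤ ⊕ ℤ ≃ ℤ :=
  Equiv.ofBijective (Sum.elim (fun a => 2 * a) fun a => 2 * a + 1) <| by
    constructor
    · rintro (a | a) (b | b) h <;> simp at h ⊢ <;> omega
    · intro j
      obtain ⟨a, rfl | rfl⟩ := j.even_or_odd'
      · exact ⟨Sum.inl a, rfl⟩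
      · exact ⟨Sum.inr a, rfl⟩

theorem tsum_int_even_add_odd {f : ℤ → ℝ} (hf : Summable f) :
    ∑' j, f j = ∑' a, f (2 * a) + ∑' a, f (2 * a + 1) := by
  have h := (evenOddEquiv.summable_iff (f := f)).2 hf
  rw [← evenOddEquiv.tsum_eq f]
  exact Summable.tsum_sum (f := fun x => f (evenOddEquiv x)) (h.comp_injective Sum.inl_injective)
    (h.comp_injective Sum.inr_injective)

theorem expSum_even_add_odd {w e : ℤ → ℝ} (h : HasMoments w e) :
    expSum w e = expSum (fun a => w (2 * a)) (fun a => e (2 * a)) +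
      expSum (fun a => w (2 * a + 1)) fun a => e (2 * a + 1) := by
  ext p
  rw [map_add, coeff_expSum, coeff_expSum, coeff_expSum, tsum_int_even_add_odd (h.summable p),
    add_div]

section kiepert

variable {h : ℝ}

theorem hasMoments_even {w e : ℤ → ℝ} (h : HasMoments w e) :
    HasMoments (fun a => w (2 * a)) fun a => e (2 * a) :=
  h.comp_injective (σ := fun a : ℤ => 2 * a) fun a b hab => by simpa using hab

theorem hasMoments_odd {w e : ℤ → ℝ} (h : HasMoments w e) :
    HasMoments (fun a => w (2 * a + 1)) fun a => e (2 * a + 1) :=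
  h.comp_injective (σ := fun a : ℤ => 2 * a + 1) fun a b hab => by simpa using hab

theorem thetaDeriv_eq_tsum (hh : 0 < h) :
    thetaDeriv h = ∑' b : ℤ, Real.exp (-h * (2 * b + 1 / 2) ^ 2) * (4 * b + 1) := by
  have hs := summable_thetaWeight hh (1 / 2) 1
  have e1 : ∀ b : ℤ, thetaWeight h (1 / 2) (2 * b) * (((2 * b : ℤ) : ℝ) + 1 / 2) ^ 1 =
      1 / 2 * (Real.exp (-h * (2 * b + 1 / 2) ^ 2) * (4 * b + 1)) := fun b => by
    rw [thetaWeight, Even.neg_one_zpow ⟨b, by ring⟩]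
    push_cast
    ring
  have e2 : ∀ b : ℤ, thetaWeight h (1 / 2) (2 * (-1 - b) + 1) *
      (((2 * (-1 - b) + 1 : ℤ) : ℝ) + 1 / 2) ^ 1 =
      1 / 2 * (Real.exp (-h * (2 * b + 1 / 2) ^ 2) * (4 * b + 1)) := fun b => by
    rw [thetaWeight, Odd.neg_one_zpow ⟨-1 - b, by ring⟩]
    push_cast
    rw [show (2 * (-1 - (b : ℝ)) + 1 + 1 / 2) ^ 2 = (2 * b + 1 / 2) ^ 2 by ring]
    ring
  rw [thetaDeriv, thetaMoment, tsum_int_even_add_odd hs, tsum_congr e1, tsum_mul_left,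
    ← (Equiv.subLeft (-1 : ℤ)).tsum_eq fun a : ℤ =>
      thetaWeight h (1 / 2) (2 * a + 1) * (((2 * a + 1 : ℤ) : ℝ) + 1 / 2) ^ 1]
  simp only [Equiv.subLeft_apply]
  rw [tsum_congr e2, tsum_mul_left]
  ring

theorem HasMoments.wronskian {ι κ : Type*} {w e : ι → ℝ} {v f : κ → ℝ} (h : HasMoments w e)
    (h' : HasMoments v f) :
    HasMoments (fun x : ι × κ => w x.1 * v x.2 * (f x.2 - e x.1)) fun x => e x.1 + f x.2 := by
  have mm := (h.prod h'.mul_exponent).sub (h.mul_exponent.prod h')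
  have hw : (fun x : ι × κ => w x.1 * v x.2 * (f x.2 - e x.1)) =
      fun x => w x.1 * (v x.2 * f x.2) - w x.1 * e x.1 * v x.2 := by
    ext x
    ring
  rw [hw]
  exact mm

theorem expSum_wronskian {ι κ : Type*} {w e : ι → ℝ} {v f : κ → ℝ} (h : HasMoments w e)
    (h' : HasMoments v f) :
    expSum w e * PowerSeries.derivative ℝ (expSum v f) -
        PowerSeries.derivative ℝ (expSum w e) * expSum v f =
      expSum (fun x : ι × κ => w x.1 * v x.2 * (f x.2 - e x.1)) fun x => e x.1 + f x.2 := by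
  rw [derivative_expSum, derivative_expSum, expSum_mul h h'.mul_exponent,
    expSum_mul h.mul_exponent h', ← expSum_sub (h.prod h'.mul_exponent) (h.mul_exponent.prod h')]
  congr 1
  ext x
  ring

/-- The factor that carries the difference of the two indices in `gaussSeries_wronskian`. -/
theorem hasMoments_thetaDeriv (hh : 0 < h) :
    HasMoments (fun b : ℤ => Real.exp (-h * (2 * b + 1 / 2) ^ 2) * (4 * b + 1))
      fun _ => (0 : ℝ) := by
  have h1 := hasMoments_even (((hasMoments_gaussian hh (1 / 2) 2).mul_exponent).zero_exponent)
  have h2 : (fun b : ℤ => Real.exp (-h * (2 * b + 1 / 2) ^ 2) * (4 * b + 1)) =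
      fun b : ℤ => Real.exp (-h * (((2 * b : ℤ) : ℝ) + 1 / 2) ^ 2) *
        (2 * (((2 * b : ℤ) : ℝ) + 1 / 2)) := by
    ext b
    push_cast
    ring
  rw [h2]
  exact h1

theorem gaussWeight_mul_even (h : ℝ) (a b : ℤ) :
    gaussWeight h 0 (a - b) * gaussWeight h (1 / 2) (a + b) =
      thetaWeight h (1 / 2) (2 * a) * Real.exp (-h * (2 * b + 1 / 2) ^ 2) := by
  rw [thetaWeight, Even.neg_one_zpow ⟨a, by ring⟩, one_mul, gaussWeight, gaussWeight,
    ← Real.exp_add, ← Real.exp_add]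
  push_cast
  ring_nf

theorem gaussWeight_mul_odd (h : ℝ) (a b : ℤ) :
    gaussWeight h 0 (a + b + 1) * gaussWeight h (1 / 2) (a - b) =
      -(thetaWeight h (1 / 2) (2 * a + 1) * Real.exp (-h * (2 * b + 1 / 2) ^ 2)) := by
  rw [thetaWeight, Odd.neg_one_zpow ⟨a, by ring⟩, neg_one_mul, neg_mul (Real.exp _), neg_neg,
    gaussWeight, gaussWeight, ← Real.exp_add, ← Real.exp_add]
  push_cast
  ring_nf

/-- The right-hand side of `gaussSeries_wronskian` as a double sum, split by the parity of the first
index. -/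
theorem thetaDeriv_mul_thetaSeries (hh : 0 < h) :
    PowerSeries.C (thetaDeriv h) * thetaSeries h (1 / 2) 2 =
      expSum (fun x : ℤ × ℤ => thetaWeight h (1 / 2) (2 * x.1) *
          (Real.exp (-h * (2 * x.2 + 1 / 2) ^ 2) * (4 * x.2 + 1)))
        (fun x => 2 * (((2 * x.1 : ℤ) : ℝ) + 1 / 2) + 0) +
      expSum (fun x : ℤ × ℤ => thetaWeight h (1 / 2) (2 * x.1 + 1) *
          (Real.exp (-h * (2 * x.2 + 1 / 2) ^ 2) * (4 * x.2 + 1)))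
        (fun x => 2 * (((2 * x.1 + 1 : ℤ) : ℝ) + 1 / 2) + 0) := by
  have mT := hasMoments_theta hh (1 / 2) 2
  have mB := hasMoments_thetaDeriv hh
  rw [← expSum_mul (hasMoments_even mT) mB, ← expSum_mul (hasMoments_odd mT) mB,
    expSum_zero_exponent, ← thetaDeriv_eq_tsum hh, ← add_mul, ← expSum_even_add_odd mT, mul_comm]
  rfl

/-- The Wronskian of the two parts of the square of the theta series is the odd theta series at the
double argument. -/
theorem gaussSeries_wronskian (hh : 0 < h) :
    gaussSeries h 0 1 * PowerSeries.derivative ℝ (gaussSeries h (1 / 2) 1) -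
        PowerSeries.derivative ℝ (gaussSeries h 0 1) * gaussSeries h (1 / 2) 1 =
      PowerSeries.C (thetaDeriv h) * thetaSeries h (1 / 2) 2 := by
  have m0 := hasMoments_gauss hh 0 1
  have m1 := hasMoments_gauss hh (1 / 2) 1
  rw [thetaDeriv_mul_thetaSeries hh]
  unfold gaussSeries
  rw [expSum_wronskian m0 m1, expSum_parity (m0.wronskian m1),
    ← expSum_equiv ((Equiv.refl ℤ).prodCongr (Equiv.neg ℤ))
      (fun x : ℤ × ℤ => thetaWeight h (1 / 2) (2 * x.1) *
          (Real.exp (-h * (2 * x.2 + 1 / 2) ^ 2) * (4 * x.2 + 1)))]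
  refine congrArg₂ (· + ·) (congrArg₂ expSum (funext fun x => ?_) (funext fun x => ?_))
    (congrArg₂ expSum (funext fun x => ?_) (funext fun x => ?_))
  · have e1 := gaussWeight_mul_even h x.1 (-x.2)
    rw [sub_neg_eq_add, ← sub_eq_add_neg] at e1
    simp only [Function.comp, Equiv.prodCongr_apply, Prod.map, Equiv.refl_apply, Equiv.neg_apply]
    rw [e1]
    push_cast
    ring
  · simp only [Function.comp, Equiv.prodCongr_apply, Prod.map, Equiv.refl_apply, Equiv.neg_apply]
    push_cast
    ring
  · simp only []
    rw [gaussWeight_mul_odd]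
    push_cast
    ring
  · push_cast
    ring

/-- The second derivative of the Lambert series without its term at zero. -/
theorem iterDeriv_two_lambertSeries_zero (hh : 0 < h) :
    iterDeriv (lambertSeries h 0) 2 * thetaSeries h 0 1 ^ 4 =
      PowerSeries.C (thetaDeriv h ^ 3) * thetaSeries h (1 / 2) 2 := by
  set θ := thetaSeries h 0 1 with hθ
  set f := lambertSeries h 0
  have e0 : f * θ = -PowerSeries.derivative ℝ θ := lambertSeries_zero_mul_theta hh
  have e1 := congrArg (PowerSeries.derivative ℝ) e0
  have e2 := congrArg (PowerSeries.derivative ℝ) e1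
  have hi : iterDeriv f 2 = PowerSeries.derivative ℝ (PowerSeries.derivative ℝ f) := rfl
  have hV := thetaSeries_sq hh 0 1
  have hV' := congrArg (PowerSeries.derivative ℝ) hV
  have hB := two_mul_bracket_thetaSeries hh 0 1
  have hB' := congrArg (PowerSeries.derivative ℝ) hB
  have hW := gaussSeries_wronskian hh
  have hK := congrArg (PowerSeries.C (R := ℝ)) (thetaDeriv_sq hh)
  rw [← hθ] at hV hV' hB hB'
  have hC : ∀ x : ℝ, PowerSeries.derivative ℝ (PowerSeries.C x) = 0 := fun x => by simp
  have h2 : PowerSeries.derivative ℝ (2 : PowerSeries ℝ) = 0 := by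
    rw [← map_ofNat (PowerSeries.C (R := ℝ)), hC]
  simp only [bracket, Derivation.leibniz, smul_eq_mul, map_add, map_neg, map_sub, one_pow, map_one,
    one_mul, hC, h2, zero_add, mul_zero, add_zero, map_mul, map_pow, map_ofNat, sq θ,
    sq (PowerSeries.derivative ℝ θ)] at e1 e2 hV hV' hB hB' hK
  rw [hi]
  refine mul_left_cancel₀ powerSeries_two_ne_zero ?_
  rw [map_pow]
  set E := gaussSeries h 0 1
  set O := gaussSeries h (1 / 2) 1
  set b0 := PowerSeries.C (gaussMoment h 0 0)
  set b1 := PowerSeries.C (gaussMoment h (1 / 2) 0)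
  set b0'' := PowerSeries.C (gaussMoment h 0 2)
  set b1'' := PowerSeries.C (gaussMoment h (1 / 2) 2)
  set c := PowerSeries.C (thetaDeriv h)
  generalize hθ1 : PowerSeries.derivative ℝ θ = θ1 at *
  generalize hθ2 : PowerSeries.derivative ℝ θ1 = θ2 at *
  generalize hθ3 : PowerSeries.derivative ℝ θ2 = θ3 at *
  generalize hf1 : PowerSeries.derivative ℝ f = f1 at *
  generalize hf2 : PowerSeries.derivative ℝ f1 = f2 at *
  generalize hE1 : PowerSeries.derivative ℝ E = E1 at *
  generalize hO1 : PowerSeries.derivative ℝ O = O1 at *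
  -- `f'' θ ^ 4 = B V' - B' V` for `V = θ ^ 2` and the bracket `B` of `θ`
  have hmain : f2 * θ ^ 4 = (θ * θ2 - θ1 * θ1) * (2 * θ * θ1) -
      (θ * θ3 - θ1 * θ2) * (θ * θ) := by
    linear_combination θ ^ 3 * e2 - 2 * θ ^ 2 * θ1 * e1 + (2 * θ * θ1 ^ 2 - θ ^ 2 * θ2) * e0
  linear_combination 2 * hmain + 2 * θ * θ1 * hB + (E * b0'' - O * b1'') * hV' - θ * θ * hB' -
    (b0'' * E1 - b1'' * O1) * hV - (E * O1 - E1 * O) * hK + 2 * c ^ 2 * hW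

/-- The Hankel determinants of the second derivatives of the Lambert series without its term at
zero; this is Kiepert's determinant evaluation. -/
theorem hankelDet_lambertSeries_zero (hh : 0 < h) (n : ℕ) :
    hankelDet (fun k => iterDeriv (lambertSeries h 0) (k + 2)) n *
        thetaSeries h 0 1 ^ ((n + 1) ^ 2) =
      PowerSeries.C (thetaDeriv h ^ (n ^ 2 + 2 * n) * superFactorialSq (n + 1)) *
        thetaSeries h (n / 2) (n + 1 : ℕ) := by
  have hc := thetaDeriv_ne_zero hh
  refine toda_unique (H := hankelDet fun k => iterDeriv (lambertSeries h 0) (k + 2))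
    (T := fun n => thetaSeries h (n / 2) (n + 1 : ℕ)) (θ := thetaSeries h 0 1)
    (k := fun n => thetaDeriv h ^ (n ^ 2 + 2 * n) * superFactorialSq (n + 1))
    (c := thetaDeriv h) (s := 1)
    (fun n hn => toda (fun k => derivative_iterDeriv _ _) n hn) (fun n => ?_) (fun n => ?_)
    (fun n => mul_ne_zero (pow_ne_zero _ hc) (superFactorialSq_ne_zero _))
    (fun n => ?_) ?_ ?_ n
  · rw [bracket_thetaSeries hh]
    congr 2
    · congr 1
      · push_cast; ring
      · push_cast; ring
    · congr 1
      · push_cast; ring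
      · push_cast; ring
  · have hn' : ((n + 1 : ℕ) : ℝ) ≠ 0 := by positivity
    rw [← zero_add ((n : ℝ) / 2)]
    refine thetaSeries_shift_ne_zero n
      (thetaSeries_ne_zero_of_thetaNull (thetaNull_ne_zero hh) _) ?_
    rw [zero_add]
    exact thetaSeries_half_ne_zero hh hn'
  · have := superFactorialSq_succ_succ (n + 1)
    push_cast at this ⊢
    have e : thetaDeriv h ^ ((n + 2) ^ 2 + 2 * (n + 2)) * thetaDeriv h ^ (n ^ 2 + 2 * n) =
        thetaDeriv h ^ 2 * (thetaDeriv h ^ ((n + 1) ^ 2 + 2 * (n + 1))) ^ 2 := by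
      rw [← pow_add, ← pow_mul, ← pow_add]
      congr 1
      ring
    linear_combination superFactorialSq (n + 3) * superFactorialSq (n + 1) * e +
      thetaDeriv h ^ 2 * (thetaDeriv h ^ ((n + 1) ^ 2 + 2 * (n + 1))) ^ 2 * this
  · rw [hankelDet_zero]
    simp [superFactorialSq]
  · rw [hankelDet_one]
    have h2 := iterDeriv_two_lambertSeries_zero hh
    norm_num [superFactorialSq, prod_range_succ] at h2 ⊢
    exact h2

/-- The Hankel determinants of even size of the moments of order at least `2` of the Lambert series
without its term at zero, by evaluation of `hankelDet_lambertSeries_zero` at the origin. -/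
theorem hankelDet_cosechMoment_zero (hh : 0 < h) (n : ℕ) :
    hankelDet (fun p => cosechMoment h 0 (p + 2)) (2 * n) =
      (-1) ^ n * superFactorialSq (2 * n + 1) * triangleTheta h ^ (8 * n * (n + 1)) := by
  have h2 := congrArg PowerSeries.constantCoeff (hankelDet_lambertSeries_zero hh (2 * n))
  rw [map_mul, map_mul, map_pow, map_hankelDet, constantCoeff_thetaSeries,
    constantCoeff_thetaSeries, PowerSeries.constantCoeff_C, thetaDeriv_eq hh, mul_pow,
    ← pow_mul, show (((2 * n : ℕ) : ℝ)) / 2 = 0 + n by push_cast; ring, thetaNull_add_nat] at h2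
  simp only [constantCoeff_iterDeriv_lambertSeries] at h2
  refine mul_right_cancel₀ (pow_ne_zero ((2 * n + 1) ^ 2) (thetaNull_ne_zero hh)) (h2.trans ?_)
  ring

end kiepert

/-! ### Sums over tuples -/

theorem hasSum_mul_real {A B : Type*} {f : A → ℝ} {g : B → ℝ} {a b : ℝ} (hf : HasSum f a)
    (hg : HasSum g b) : HasSum (fun x : A × B => f x.1 * g x.2) (a * b) :=
  hf.mul hg (summable_mul_of_summable_norm hf.summable.norm hg.summable.norm)

theorem HasSum.prod_fin {n : ℕ} {X : Fin n → Type} {f : ∀ i, X i → ℝ} {a : Fin n → ℝ}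
    (h : ∀ i, HasSum (f i) (a i)) :
    HasSum (fun z : ∀ i, X i => ∏ i, f i (z i)) (∏ i, a i) := by
  induction n with
  | zero =>
    simp only [univ_eq_empty, prod_empty]
    exact hasSum_unique fun _ : ∀ i, X i => (1 : ℝ)
  | succ n ih =>
    have h1 := ih fun i => h i.succ
    have h2 := hasSum_mul_real (h 0) h1
    rw [Fin.prod_univ_succ, ← (Fin.consEquiv X).hasSum_iff]
    refine h2.congr_fun fun z => ?_
    simp [Fin.prod_univ_succ, Fin.consEquiv]

theorem HasSum.prod_pi {ι : Type} [Fintype ι] {X : ι → Type} {f : ∀ i, X i → ℝ} {a : ι → ℝ}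
    (h : ∀ i, HasSum (f i) (a i)) :
    HasSum (fun z : ∀ i, X i => ∏ i, f i (z i)) (∏ i, a i) := by
  set e := (Fintype.equivFin ι).symm
  have h1 := HasSum.prod_fin fun i => h (e i)
  rw [← (Equiv.piCongrLeft X e).hasSum_iff, ← e.prod_comp]
  refine h1.congr_fun fun z => ?_
  simp only [Function.comp]
  rw [← e.prod_comp]
  simp only [Equiv.piCongrLeft_apply_apply]

section andreief

variable {β : Type} {n : ℕ}

/-- Rearranging a tuple with distinct keys into increasing order. -/
theorem injective_strictMono_comp_perm (key : β → ℕ) :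
    Function.Injective fun x : {z : Fin n → β // StrictMono fun i => key (z i)} ×
      Equiv.Perm (Fin n) => fun i => x.1.1 (x.2 i) := by
  rintro ⟨⟨z, hz⟩, σ⟩ ⟨⟨z', hz'⟩, τ⟩ h
  simp only at h
  have h1 : ∀ i, z' i = z (σ (τ⁻¹ i)) := fun i => by simpa using (congrFun h (τ⁻¹ i)).symm
  have h2 : StrictMono fun i => σ (τ⁻¹ i) := fun i j hij => by
    have := hz' hij
    simp only [h1] at this
    exact hz.lt_iff_lt.1 this
  have h3 : (fun i => σ (τ⁻¹ i)) = id := by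
    have := h2.range_inj (strictMono_id (α := Fin n))
    refine this.1 ?_
    rw [Set.range_id]
    exact (σ.surjective.comp (τ⁻¹).surjective).range_eq
  have h4 : σ = τ := by
    ext i
    have := congrFun h3 (τ i)
    simp at this
    rw [this]
  subst h4
  simp only [Prod.mk.injEq, Subtype.mk.injEq, and_true]
  ext i
  rw [h1]
  simp

/-- A tuple with distinct keys is a permutation of one with increasing keys. -/
theorem exists_strictMono_comp_perm (key : β → ℕ) (z : Fin n → β)
    (h : Function.Injective fun i => key (z i)) :
    ∃ x : {z : Fin n → β // StrictMono fun i => key (z i)} × Equiv.Perm (Fin n),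
      (fun i => x.1.1 (x.2 i)) = z := by
  set f := fun i => key (z i)
  refine ⟨⟨⟨fun i => z (Tuple.sort f i), ?_⟩, (Tuple.sort f)⁻¹⟩, ?_⟩
  · exact (Tuple.monotone_sort f).strictMono_of_injective (h.comp (Tuple.sort f).injective)
  · ext i
    simp

open Matrix in
/-- Andréief's identity: a Hankel determinant of moments is the sum of the products of the weights
and the squared differences of the nodes, over the tuples in increasing order. The nodes depend on
the index only through the key. -/
theorem hasSum_hankelDet_of_key (key : β → ℕ) (ω : β → ℝ) (ν : ℕ → ℝ) (μ : ℕ → ℝ)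
    (h : ∀ p, HasSum (fun z => ω z * ν (key z) ^ p) (μ p)) (n : ℕ) :
    HasSum (fun z : Fin n → β => if StrictMono fun i => key (z i) then
      (∏ i, ω (z i)) * ∏ i, ∏ j ∈ Ioi i, (ν (key (z j)) - ν (key (z i))) ^ 2 else 0)
      (hankelDet μ n) := by
  set V : (Fin n → β) → ℝ := fun z => (vandermonde fun i => ν (key (z i))).det with hV
  have hVs : ∀ z (σ : Equiv.Perm (Fin n)), V (fun i => z (σ i)) = Equiv.Perm.sign σ * V z :=
    fun z σ => det_permute σ (vandermonde fun i => ν (key (z i)))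
  set g : (Fin n → β) → ℝ := fun z => (∏ i, ω (z i) * ν (key (z i)) ^ (i : ℕ)) * V z with hg
  -- expanding the Vandermonde determinant in `g` gives the Leibniz formula for the moments
  have h1 : HasSum g (hankelDet μ n) := by
    have e1 : ∀ z, g z = ∑ σ : Equiv.Perm (Fin n), ((Equiv.Perm.sign σ : ℤ) : ℝ) *
        ∏ i, ω (z i) * ν (key (z i)) ^ ((σ i : ℕ) + i) := fun z => by
      simp only [hg, hV]
      rw [← det_transpose, det_apply', mul_sum]
      refine sum_congr rfl fun σ _ => ?_
      rw [mul_left_comm, ← prod_mul_distrib]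
      congr 1
      refine prod_congr rfl fun i _ => ?_
      simp only [transpose_apply, vandermonde_apply]
      ring
    rw [hankelDet, det_apply']
    refine (hasSum_sum fun σ _ => (HasSum.prod_pi fun i => h ((σ i : ℕ) + i)).mul_left
      ((Equiv.Perm.sign σ : ℤ) : ℝ)).congr_fun fun z => ?_
    exact e1 z
  have h2 := (injective_strictMono_comp_perm (n := n) key).hasSum_iff (f := g) (a := hankelDet μ n)
    fun z hz => by
      have : ¬ Function.Injective fun i => key (z i) := fun hi =>
        hz (exists_strictMono_comp_perm key z hi)
      simp only [Function.Injective] at this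
      push Not at this
      obtain ⟨i, j, hij, hne⟩ := this
      simp only [hg, hV]
      rw [det_vandermonde_eq_zero_iff.2 ⟨i, j, by rw [hij], hne⟩, mul_zero]
  -- grouping the tuples into the orbits of the increasing ones
  have h3 := (h2.2 h1).prod_fiberwise fun z => hasSum_fintype _
  have h4 : ∀ z : Fin n → β, ∑ σ : Equiv.Perm (Fin n), g (fun i => z (σ i)) =
      (∏ i, ω (z i)) * ∏ i, ∏ j ∈ Ioi i, (ν (key (z j)) - ν (key (z i))) ^ 2 := fun z => by
    have e2 : ∀ σ : Equiv.Perm (Fin n), g (fun i => z (σ i)) = (∏ i, ω (z i)) * V z *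
        (((Equiv.Perm.sign σ : ℤ) : ℝ) * ∏ i, ν (key (z (σ i))) ^ (i : ℕ)) := fun σ => by
      simp only [hg]
      rw [hVs, prod_mul_distrib, Equiv.prod_comp σ fun i => ω (z i)]
      ring
    simp only [e2]
    rw [← mul_sum]
    have e3 : ∑ σ : Equiv.Perm (Fin n), ((Equiv.Perm.sign σ : ℤ) : ℝ) *
        ∏ i, ν (key (z (σ i))) ^ (i : ℕ) = V z := by
      simp only [hV]
      rw [det_apply']
      rfl
    rw [e3, mul_assoc, ← sq]
    simp only [hV]
    rw [det_vandermonde, ← prod_pow]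
    simp only [prod_pow]
  rw [← hasSum_subtype_iff_of_support_subset (s := {z | StrictMono fun i => key (z i)})]
  · refine h3.congr_fun fun z => ?_
    simp only [Function.comp]
    rw [if_pos z.2, ← h4]
  · intro z hz
    by_contra h'
    simp only [Set.mem_ofPred_eq] at h'
    simp [h'] at hz

end andreief

/-! ### Hankel determinants under scaling, and with vanishing even moments -/

theorem hankelDet_smul_pow {R : Type*} [CommRing R] (x y : R) (a : ℕ → R) (n : ℕ) :
    hankelDet (fun p => y * x ^ p * a p) n = y ^ n * x ^ (n * (n - 1)) * hankelDet a n := by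
  have h : (Matrix.of fun i j : Fin n => y * x ^ ((i : ℕ) + j) * a (i + j)) =
      Matrix.of fun i j : Fin n => (y * x ^ (i : ℕ)) *
        (Matrix.of fun i j : Fin n => x ^ (j : ℕ) * (Matrix.of fun i j : Fin n =>
          a (i + j)) i j) i j := by
    ext i j
    simp only [Matrix.of_apply]
    ring
  rw [hankelDet, h, Matrix.det_mul_column, Matrix.det_mul_row, prod_mul_distrib, prod_const,
    card_univ, Fintype.card_fin, prod_pow_eq_pow_sum, Fin.sum_univ_eq_sum_range (fun i => i) n,
    ← sum_range_id_mul_two, hankelDet]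
  ring

/-- The even and the odd elements of `Fin (2 * N)`. -/
def finEvenOddEquiv (N : ℕ) : Fin N ⊕ Fin N ≃ Fin (2 * N) where
  toFun := Sum.elim (fun i => ⟨2 * i, by omega⟩) fun i => ⟨2 * i + 1, by omega⟩
  invFun k := if (k : ℕ) % 2 = 0 then Sum.inl ⟨k / 2, by omega⟩ else Sum.inr ⟨k / 2, by omega⟩
  left_inv := by
    rintro (i | i)
    · simp
    · have : (2 * (i : ℕ) + 1) % 2 = 1 := by omega
      simp only [Sum.elim_inr, this, one_ne_zero, if_false, Sum.inr.injEq, Fin.ext_iff]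
      omega
  right_inv k := by
    dsimp only
    split_ifs with h <;> simp only [Sum.elim_inl, Sum.elim_inr, Fin.ext_iff] <;> omega

/-- If the even moments vanish, a Hankel determinant of even size is, up to the sign, the square of
the Hankel determinant of the odd moments. -/
theorem hankelDet_of_even_eq_zero {R : Type*} [CommRing R] {a : ℕ → R} (h : ∀ p, a (2 * p) = 0)
    (N : ℕ) : hankelDet a (2 * N) = (-1) ^ N * hankelDet (fun p => a (2 * p + 1)) N ^ 2 := by
  set A := Matrix.of fun i j : Fin N => a (2 * (i + j) + 1)
  have h1 : (Matrix.of fun i j : Fin (2 * N) => a (i + j)).submatrix (finEvenOddEquiv N)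
      (finEvenOddEquiv N) = Matrix.fromBlocks 0 A A 0 := by
    ext (i | i) (j | j)
    · simp [finEvenOddEquiv, ← mul_add, h]
    · simp only [finEvenOddEquiv, A, Equiv.coe_fn_mk, Matrix.submatrix_apply, Matrix.of_apply,
        Sum.elim_inl, Sum.elim_inr, Matrix.fromBlocks_apply₁₂]
      congr 1
      ring
    · simp only [finEvenOddEquiv, A, Equiv.coe_fn_mk, Matrix.submatrix_apply, Matrix.of_apply,
        Sum.elim_inl, Sum.elim_inr, Matrix.fromBlocks_apply₂₁]
      congr 1
      ring
    · simp only [finEvenOddEquiv, Equiv.coe_fn_mk, Matrix.submatrix_apply, Matrix.of_apply,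
        Sum.elim_inr, Matrix.fromBlocks_apply₂₂, Matrix.zero_apply]
      rw [← h (i + j + 1)]
      congr 1
      ring
  have h2 : (Matrix.fromBlocks 0 A A 0 : Matrix (Fin N ⊕ Fin N) (Fin N ⊕ Fin N) R) =
      Matrix.fromBlocks A 0 0 A * (Matrix.fromBlocks 1 (-1) 0 1 * Matrix.fromBlocks 1 1 1 0) := by
    simp [Matrix.fromBlocks_multiply]
  rw [hankelDet, ← Matrix.det_submatrix_equiv_self (finEvenOddEquiv N), h1, h2, Matrix.det_mul,
    Matrix.det_mul, Matrix.det_fromBlocks_zero₁₂, Matrix.det_fromBlocks_zero₂₁,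
    Matrix.det_fromBlocks_one₁₁]
  simp [Matrix.det_neg, hankelDet, A]
  ring

/-! ### Moments of the two symmetric Lambert series -/

section symmetric

variable {h : ℝ}

theorem cosechWeight_neg_of (h α : ℝ) {i j : ℤ} (hij : (i : ℝ) + α = -(j + α)) :
    cosechWeight h α i = -cosechWeight h α j := by
  rw [cosechWeight, cosechWeight, hij, mul_neg, Real.sinh_neg, mul_neg, div_neg]

theorem summable_cosechMoment (hh : 0 < h) {α : ℝ} (h0 : 0 ≤ α) (h1 : α < 1) (p : ℕ) :
    Summable fun j : ℤ => cosechWeight h α j * (j + α) ^ p :=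
  (hasMoments_cosech hh h0 h1).summable p

/-- The odd moments as sums over the positive half-integers. -/
theorem cosechMoment_half_odd (hh : 0 < h) (p : ℕ) :
    cosechMoment h (1 / 2) (2 * p + 1) =
      2 * ∑' j : ℕ, cosechWeight h (1 / 2) j * (j + 1 / 2 : ℝ) ^ (2 * p + 1) := by
  have hs := summable_cosechMoment hh (α := 1 / 2) (by norm_num) (by norm_num) (2 * p + 1)
  have e : ∀ n : ℕ, cosechWeight h (1 / 2) (-((n : ℤ) + 1)) *
      (((-((n : ℤ) + 1) : ℤ) : ℝ) + 1 / 2) ^ (2 * p + 1) =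
      cosechWeight h (1 / 2) n * (n + 1 / 2 : ℝ) ^ (2 * p + 1) := fun n => by
    have h1 : (((-((n : ℤ) + 1) : ℤ) : ℝ) + 1 / 2) = -(((n : ℤ) : ℝ) + 1 / 2) := by
      push_cast; ring
    rw [cosechWeight_neg_of h _ h1, h1, Odd.neg_pow ⟨p, rfl⟩]
    push_cast; ring
  rw [cosechMoment, ← tsum_nat_add_neg_add_one hs, ← tsum_mul_left]
  refine tsum_congr fun n => ?_
  rw [e]
  push_cast; ring

theorem cosechMoment_half_even (h : ℝ) (p : ℕ) : cosechMoment h (1 / 2) (2 * p) = 0 := by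
  have e : cosechMoment h (1 / 2) (2 * p) = -cosechMoment h (1 / 2) (2 * p) := by
    conv_lhs => rw [cosechMoment, ← (Equiv.subLeft (-1 : ℤ)).tsum_eq]
    rw [cosechMoment, ← tsum_neg]
    refine tsum_congr fun j => ?_
    have h1 : ((Equiv.subLeft (-1 : ℤ) j : ℤ) : ℝ) + 1 / 2 = -((j : ℝ) + 1 / 2) := by
      simp only [Equiv.subLeft_apply]
      push_cast; ring
    rw [cosechWeight_neg_of h _ h1, h1, Even.neg_pow ⟨p, by ring⟩, neg_mul]
  linarith

/-- The odd moments as sums over the positive integers. -/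
theorem cosechMoment_zero_odd (hh : 0 < h) (p : ℕ) :
    cosechMoment h 0 (2 * p + 1) =
      2 * ∑' j : ℕ, cosechWeight h 0 (j + 1) * (j + 1 : ℝ) ^ (2 * p + 1) := by
  have hs := summable_cosechMoment hh (α := 0) le_rfl one_pos (2 * p + 1)
  set f : ℤ → ℝ := fun j => cosechWeight h 0 j * (j + 0) ^ (2 * p + 1) with hf
  have h1 : Summable fun n : ℕ => f (n + 1) :=
    hs.comp_injective (i := fun n : ℕ => (n : ℤ) + 1) fun a b hab => by simpa using hab
  have h2 : Summable fun n : ℕ => f (-(n + 1)) :=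
    hs.comp_injective (i := fun n : ℕ => -((n : ℤ) + 1)) fun a b hab => by simpa using hab
  have e : ∀ n : ℕ, f (-(n + 1)) =
      cosechWeight h 0 (n + 1) * (n + 1 : ℝ) ^ (2 * p + 1) := fun n => by
    have h3 : (((-((n : ℤ) + 1) : ℤ) : ℝ) + 0) = -((((n : ℤ) + 1 : ℤ) : ℝ) + 0) := by
      push_cast; ring
    simp only [hf]
    rw [cosechWeight_neg_of h _ h3, h3, Odd.neg_pow ⟨p, rfl⟩]
    push_cast; ring
  have h0 : f 0 = 0 := by simp [hf]
  have h3 : ∀ n : ℕ, f (n + 1) = cosechWeight h 0 (n + 1) * (n + 1 : ℝ) ^ (2 * p + 1) := fun n => by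
    simp [hf]
  have h4 : ∑' j, f j = _ := tsum_of_add_one_of_neg_add_one h1 h2
  rw [cosechMoment, h4, h0, add_zero, tsum_congr e, tsum_congr h3]
  exact (two_mul _).symm

theorem cosechMoment_zero_even (h : ℝ) (p : ℕ) : cosechMoment h 0 (2 * p) = 0 := by
  have e : cosechMoment h 0 (2 * p) = -cosechMoment h 0 (2 * p) := by
    conv_lhs => rw [cosechMoment, ← (Equiv.neg ℤ).tsum_eq]
    rw [cosechMoment, ← tsum_neg]
    refine tsum_congr fun j => ?_
    have h1 : ((Equiv.neg ℤ j : ℤ) : ℝ) + 0 = -((j : ℝ) + 0) := by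
      simp
    rw [cosechWeight_neg_of h _ h1, h1, Even.neg_pow ⟨p, by ring⟩, neg_mul]
  linarith

/-- The product of the factorials below `n`. -/
def factorialProdBelow (n : ℕ) : ℚ := ∏ l ∈ range n, (l.factorial : ℚ)

theorem superFactorialSq_eq (n : ℕ) : superFactorialSq n = (factorialProdBelow n : ℝ) ^ 2 := by
  rw [superFactorialSq, factorialProdBelow, prod_pow]
  push_cast
  rfl

theorem factorialProdBelow_pos (n : ℕ) : 0 < factorialProdBelow n :=
  prod_pos fun l _ => Nat.cast_pos.2 l.factorial_pos

/-- The square of the Hankel determinant of the odd moments is the Hankel determinant of all moments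
of double size, which is known. -/
theorem sq_hankelDet_half (hh : 0 < h) (N : ℕ) :
    hankelDet (fun p => cosechMoment h (1 / 2) (2 * p + 1)) N ^ 2 =
      (factorialProdBelow (2 * N) * triangleTheta h ^ (4 * N ^ 2)) ^ 2 := by
  have h1 := hankelDet_of_even_eq_zero (cosechMoment_half_even h) N
  rw [hankelDet_cosechMoment hh (by norm_num) le_rfl, superFactorialSq_eq,
    show (1 / 2 - 1 / 2 + ((2 * N : ℕ) : ℝ) / 2) = 0 + N by push_cast; ring, thetaNull_add_nat,
    sub_self, mul_div_assoc, div_self (thetaNull_ne_zero hh)] at h1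
  have h2 : ((-1 : ℝ) ^ N) * (-1) ^ N = 1 := by rw [← mul_pow]; simp
  calc _ = (-1) ^ N *
        ((-1) ^ N * hankelDet (fun p => cosechMoment h (1 / 2) (2 * p + 1)) N ^ 2) := by
        rw [← mul_assoc, h2, one_mul]
    _ = ((-1) ^ N * (-1) ^ N) *
        (factorialProdBelow (2 * N) * triangleTheta h ^ (4 * N ^ 2)) ^ 2 := by
        rw [← h1]; ring
    _ = _ := by rw [h2, one_mul]

/-- The analogue of `sq_hankelDet_half` for the Lambert series without its term at zero. -/
theorem sq_hankelDet_zero (hh : 0 < h) (N : ℕ) :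
    hankelDet (fun p => cosechMoment h 0 (2 * (p + 1) + 1)) N ^ 2 =
      (factorialProdBelow (2 * N + 1) * triangleTheta h ^ (4 * N * (N + 1))) ^ 2 := by
  have h1 := hankelDet_of_even_eq_zero (a := fun p => cosechMoment h 0 (p + 2))
    (fun p => cosechMoment_zero_even h (p + 1)) N
  rw [hankelDet_cosechMoment_zero hh, superFactorialSq_eq] at h1
  have h2 : ((-1 : ℝ) ^ N) ≠ 0 := by positivity
  refine mul_left_cancel₀ h2 (h1.symm.trans ?_)
  ring

end symmetric

/-! ### The classes of positive integers up to sign modulo `D` -/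

/-- The representative in `[0, D / 2]` of `k` modulo `D` up to sign. -/
def foldMod (D k : ℕ) : ℕ := min (k % D) (D - k % D)

/-- The node attached to `k`: it is `k ^ 2` in the classes of `0` and `D / 2`, and otherwise it is
the element of `{k, -k}` which is congruent to `foldMod D k`. -/
def classNode (D k : ℕ) : ℚ :=
  if k % D = 0 ∨ 2 * (k % D) = D then (k : ℚ) ^ 2 else if 2 * (k % D) < D then k else -k

/-- The weight attached to `k`: it is `k ^ 3` in the class of `0`, `k` in the class of `D / 2`, and
otherwise the sign of `classNode D k`. -/
def classWeight (D k : ℕ) : ℚ :=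
  if k % D = 0 then (k : ℚ) ^ 3 else if 2 * (k % D) = D then k
  else if 2 * (k % D) < D then 1 else -1

/-- The weight of the pair `(k, l)` in the class of `c`; it vanishes unless `k` is a positive
integer of this class and `l` is odd. -/
noncomputable def pairWeight (η : ℝ) (D c : ℕ) (z : ℕ × ℕ) : ℝ :=
  if 0 < z.1 ∧ Odd z.2 ∧ foldMod D z.1 = c then
    classWeight D z.1 * Real.exp (-η) ^ (z.1 * z.2) else 0

section moments

variable {η : ℝ}

/-- The sum over the odd `l` of `exp (-x * l)`. -/
theorem hasSum_exp_odd {x : ℝ} (hx : 0 < x) :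
    HasSum (fun l : ℕ => Real.exp (-x) ^ (2 * l + 1)) (1 / (2 * Real.sinh x)) := by
  have h1 : Real.exp (-x) ^ 2 < 1 :=
    pow_lt_one₀ (Real.exp_pos _).le (Real.exp_lt_one_iff.2 (by linarith)) two_ne_zero
  have h2 := (hasSum_geometric_of_lt_one (by positivity) h1).mul_right (Real.exp (-x))
  have h3 : (1 - Real.exp (-x) ^ 2)⁻¹ * Real.exp (-x) = 1 / (2 * Real.sinh x) := by
    have e : Real.exp x * Real.exp (-x) = 1 := by rw [← Real.exp_add]; simp
    have hs : 2 * Real.sinh x = Real.exp x - Real.exp (-x) := by rw [Real.sinh_eq]; ring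
    have hs' : 0 < Real.sinh x := Real.sinh_pos_iff.2 hx
    have h1' : (1 - Real.exp (-x) ^ 2) ≠ 0 := by linarith
    have hs2 : Real.exp x - Real.exp (-x) ≠ 0 := by rw [← hs]; positivity
    rw [hs, inv_mul_eq_div, div_eq_div_iff h1' hs2]
    linear_combination e
  rw [h3] at h2
  refine h2.congr_fun fun l => ?_
  rw [pow_succ, pow_mul]

/-- The moments of a class as a single sum, for a parametrization `κ` of the class. -/
theorem hasSum_pairWeight {J : Type*} (hη : 0 < η) (D c : ℕ) (κ : J → ℕ)
    (hinj : Function.Injective κ) (hκ : ∀ j, 0 < κ j ∧ foldMod D (κ j) = c)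
    (hsurj : ∀ k, 0 < k → foldMod D k = c → ∃ j, κ j = k) (p : ℕ) {t : J → ℝ} {a : ℝ}
    (ht : ∀ j, classWeight D (κ j) * classNode D (κ j) ^ p * (1 / (2 * Real.sinh (η * κ j))) = t j)
    (hs : HasSum t a) :
    HasSum (fun z => pairWeight η D c z * (classNode D z.1 : ℝ) ^ p) a := by
  have hg : Function.Injective fun x : J × ℕ => (κ x.1, 2 * x.2 + 1) := by
    rintro ⟨j, l⟩ ⟨j', l'⟩ h
    simp only [Prod.mk.injEq] at h
    rw [Prod.mk.injEq]
    exact ⟨hinj h.1, by omega⟩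
  rw [← hg.hasSum_iff]
  · set F : J × ℕ → ℝ := fun x => (classWeight D (κ x.1) * classNode D (κ x.1) ^ p : ℝ) *
      Real.exp (-(η * κ x.1)) ^ (2 * x.2 + 1) with hF
    have hrow : ∀ j, HasSum (fun l => F (j, l)) (t j) := fun j => by
      rw [← ht]
      exact (hasSum_exp_odd (mul_pos hη (Nat.cast_pos.2 (hκ j).1))).mul_left _
    have hrow' : ∀ j, HasSum (fun l => ‖F (j, l)‖) ‖t j‖ := fun j => by
      have hpos : 0 < η * κ j := mul_pos hη (Nat.cast_pos.2 (hκ j).1)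
      have h1 : 0 ≤ 1 / (2 * Real.sinh (η * κ j)) := by
        have := Real.sinh_pos_iff.2 hpos
        positivity
      rw [← ht, norm_mul, Real.norm_of_nonneg h1]
      refine ((hasSum_exp_odd hpos).mul_left _).congr_fun fun l => ?_
      rw [hF]
      simp only
      rw [norm_mul, Real.norm_of_nonneg (pow_nonneg (Real.exp_pos _).le _)]
    have hsum : Summable F := by
      refine Summable.of_norm ?_
      rw [summable_prod_of_nonneg fun _ => norm_nonneg _]
      refine ⟨fun j => (hrow' j).summable, ?_⟩
      simp only [fun j => (hrow' j).tsum_eq]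
      exact hs.summable.norm
    have h1 : HasSum F a := by
      have := hsum.hasSum.prod_fiberwise hrow
      rw [← this.unique hs]
      exact hsum.hasSum
    refine h1.congr_fun fun x => ?_
    simp only [Function.comp, pairWeight, hF]
    rw [if_pos ⟨(hκ _).1, ⟨x.2, rfl⟩, (hκ _).2⟩, ← Real.exp_nat_mul, ← Real.exp_nat_mul]
    rw [show ((κ x.1 * (2 * x.2 + 1) : ℕ) : ℝ) * -η =
      ((2 * x.2 + 1 : ℕ) : ℝ) * -(η * κ x.1) by push_cast; ring]
    ring
  · rintro ⟨k, l⟩ h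
    rw [pairWeight, if_neg, zero_mul]
    rintro ⟨h1, ⟨l', hl⟩, h2⟩
    obtain ⟨j, rfl⟩ := hsurj k h1 h2
    exact h ⟨(j, l'), Prod.ext rfl hl.symm⟩

/-- The moments of a class different from those of `0` and `D / 2`. -/
theorem hasSum_pairWeight_generic (hη : 0 < η) {D c : ℕ} (h0 : 0 < c) (h1 : 2 * c < D) (p : ℕ) :
    HasSum (fun z => pairWeight η D c z * (classNode D z.1 : ℝ) ^ p)
      ((D : ℝ) ^ p * cosechMoment (D * η) (c / D) p) := by
  have hD : (0 : ℝ) < D := by exact_mod_cast (by omega : 0 < D)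
  have hc : (c : ℝ) / D < 1 := by
    rw [div_lt_one hD]
    exact_mod_cast (by omega : c < D)
  -- the class consists of the absolute values of `D * j + c`, the sign of which is that of `j`
  have hmod : ∀ j : ℤ, 0 < ((D : ℤ) * j + c).natAbs ∧
      (0 ≤ j ∧ ((D : ℤ) * j + c).natAbs % D = c ∧ (((D : ℤ) * j + c).natAbs : ℤ) = D * j + c ∨
        j < 0 ∧ ((D : ℤ) * j + c).natAbs % D = D - c ∧
        (((D : ℤ) * j + c).natAbs : ℤ) = -(D * j + c)) := fun j => by
    rcases lt_or_ge j 0 with hj | hj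
    · obtain ⟨n, rfl⟩ : ∃ n : ℕ, j = -(n + 1) := ⟨(-j - 1).toNat, by omega⟩
      have e : (D : ℤ) * -((n : ℤ) + 1) + c = -((D * n + (D - c) : ℕ) : ℤ) := by
        push_cast [Nat.cast_sub (by omega : c ≤ D)]
        ring
      rw [e, Int.natAbs_neg, Int.natAbs_natCast]
      refine ⟨by omega, Or.inr ⟨hj, ?_, by simp⟩⟩
      rw [Nat.mul_add_mod]
      exact Nat.mod_eq_of_lt (by omega)
    · lift j to ℕ using hj
      have e : (D : ℤ) * j + c = ((D * j + c : ℕ) : ℤ) := by push_cast; ring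
      rw [e, Int.natAbs_natCast]
      refine ⟨by omega, Or.inl ⟨by omega, ?_, rfl⟩⟩
      rw [Nat.mul_add_mod]
      exact Nat.mod_eq_of_lt (by omega)
  refine hasSum_pairWeight hη D c (fun j : ℤ => ((D : ℤ) * j + c).natAbs) ?_ ?_ ?_ p
    (t := fun j => (D : ℝ) ^ p * (cosechWeight (D * η) (c / D) j * (j + c / D) ^ p)) ?_
    ((summable_cosechMoment (by positivity) (by positivity) hc p).hasSum.mul_left _)
  · intro i j hij
    simp only at hij
    have hD' : (D : ℤ) ≠ 0 := by omega
    rcases (hmod i).2 with ⟨_, hi, hi'⟩ | ⟨_, hi, hi'⟩ <;>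
      rcases (hmod j).2 with ⟨_, hj, hj'⟩ | ⟨_, hj, hj'⟩ <;> rw [hij] at hi hi'
    · exact mul_left_cancel₀ hD' (by linarith)
    · omega
    · omega
    · exact mul_left_cancel₀ hD' (by linarith)
  · intro j
    refine ⟨(hmod j).1, ?_⟩
    simp only [foldMod]
    rcases (hmod j).2 with ⟨_, hi, _⟩ | ⟨_, hi, _⟩ <;> rw [hi] <;> omega
  · intro k hk hf
    have hlt := Nat.mod_lt k (by omega : 0 < D)
    have hdm := Nat.div_add_mod k D
    rw [foldMod] at hf
    rcases min_choice (k % D) (D - k % D) with h | h <;> rw [h] at hf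
    · refine ⟨(k / D : ℕ), ?_⟩
      rw [← hf]
      exact_mod_cast congrArg Int.natAbs (congrArg (Nat.cast (R := ℤ)) hdm)
    · refine ⟨-((k / D : ℕ) + 1), ?_⟩
      have e : (D : ℤ) * -(((k / D : ℕ) : ℤ) + 1) + c = -((D * (k / D) + k % D : ℕ) : ℤ) := by
        rw [← hf]
        push_cast [Nat.cast_sub hlt.le]
        ring
      rw [e, Int.natAbs_neg, Int.natAbs_natCast, hdm]
  · intro j
    have hD' : (D : ℝ) ≠ 0 := hD.ne'
    have hz : (((D : ℤ) * j + c : ℤ) : ℝ) = D * (j + c / D) := by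
      push_cast
      field_simp
    simp only [classWeight, classNode]
    rcases (hmod j).2 with ⟨_, hi, hi'⟩ | ⟨_, hi, hi'⟩
    · rw [hi, if_neg (by omega), if_neg (by omega), if_pos h1, if_neg (by omega), if_pos h1]
      have hk : ((((D : ℤ) * j + c).natAbs : ℕ) : ℝ) = D * (j + c / D) := by
        have := congrArg (Int.cast (R := ℝ)) hi'
        rwa [Int.cast_natCast, hz] at this
      push_cast
      rw [hk, mul_pow, cosechWeight, show η * (D * ((j : ℝ) + c / D)) = D * η * (j + c / D) by ring]
      ring
    · rw [hi, if_neg (by omega), if_neg (by omega), if_neg (by omega), if_neg (by omega),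
        if_neg (by omega)]
      have hk : ((((D : ℤ) * j + c).natAbs : ℕ) : ℝ) = -(D * (j + c / D)) := by
        have := congrArg (Int.cast (R := ℝ)) hi'
        rwa [Int.cast_natCast, Int.cast_neg, hz] at this
      push_cast
      rw [hk, neg_neg, mul_pow, cosechWeight,
        show η * -(D * ((j : ℝ) + c / D)) = -(D * η * (j + c / D)) by ring, Real.sinh_neg, mul_neg,
        div_neg]
      ring

/-- The moments of the class of `D / 2`. -/
theorem hasSum_pairWeight_half (hη : 0 < η) {c : ℕ} (h0 : 0 < c) (p : ℕ) :
    HasSum (fun z => pairWeight η (2 * c) c z * (classNode (2 * c) z.1 : ℝ) ^ p)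
      (((2 * c : ℕ) : ℝ) / 2 * (((2 * c : ℕ) : ℝ) ^ 2) ^ p *
        cosechMoment ((2 * c : ℕ) * η) (1 / 2) (2 * p + 1)) := by
  have hc : (0 : ℝ) < c := Nat.cast_pos.2 h0
  have hη' : 0 < ((2 * c : ℕ) : ℝ) * η := by push_cast; positivity
  have hmod : ∀ j : ℕ, (2 * c * j + c) % (2 * c) = c := fun j => by
    rw [Nat.mul_add_mod]
    exact Nat.mod_eq_of_lt (by omega)
  have hs := (summable_cosechMoment hη' (α := 1 / 2) (by norm_num) (by norm_num)
    (2 * p + 1)).comp_injective Nat.cast_injective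
  have key := hs.hasSum.mul_left (((2 * c : ℕ) : ℝ) * (((2 * c : ℕ) : ℝ) ^ 2) ^ p)
  simp only [Function.comp, Int.cast_natCast] at key
  rw [cosechMoment_half_odd hη', ← mul_assoc, mul_comm _ (2 : ℝ), ← mul_assoc, mul_div_cancel₀ _
    (two_ne_zero (α := ℝ))]
  refine hasSum_pairWeight hη (2 * c) c (fun j : ℕ => 2 * c * j + c) ?_ ?_ ?_ p ?_ key
  · intro i j hij
    simpa [h0.ne'] using hij
  · intro j
    refine ⟨by omega, ?_⟩
    rw [foldMod, hmod]
    omega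
  · intro k hk hf
    refine ⟨k / (2 * c), ?_⟩
    have hlt := Nat.mod_lt k (by omega : 0 < 2 * c)
    have hdm := Nat.div_add_mod k (2 * c)
    rw [foldMod] at hf
    have : k % (2 * c) = c := by omega
    omega
  · intro j
    simp only [classWeight, classNode, hmod]
    rw [if_neg (by omega), if_pos trivial, if_pos (Or.inr trivial), cosechWeight]
    push_cast
    rw [show η * (2 * c * j + c) = 2 * c * η * (j + 1 / 2 : ℝ) by ring,
      show (2 * c * j + c : ℝ) = 2 * c * (j + 1 / 2) by ring]
    generalize (j + 1 / 2 : ℝ) = y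
    ring

/-- The moments of the class of `0`. -/
theorem hasSum_pairWeight_zero (hη : 0 < η) {D : ℕ} (hD : 0 < D) (p : ℕ) :
    HasSum (fun z => pairWeight η D 0 z * (classNode D z.1 : ℝ) ^ p)
      ((D : ℝ) ^ 3 / 2 * ((D : ℝ) ^ 2) ^ p * cosechMoment (D * η) 0 (2 * (p + 1) + 1)) := by
  have hc : (0 : ℝ) < D := Nat.cast_pos.2 hD
  have hη' : 0 < (D : ℝ) * η := by positivity
  have hs := (summable_cosechMoment hη' (α := 0) le_rfl one_pos
    (2 * (p + 1) + 1)).comp_injective (i := fun n : ℕ => (n : ℤ) + 1)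
      fun a b hab => by simpa using hab
  have key := hs.hasSum.mul_left ((D : ℝ) ^ 3 * ((D : ℝ) ^ 2) ^ p)
  simp only [Function.comp, Int.cast_natCast, Int.cast_add, Int.cast_one, add_zero] at key
  rw [cosechMoment_zero_odd hη', ← mul_assoc, mul_comm _ (2 : ℝ), ← mul_assoc, mul_div_cancel₀ _
    (two_ne_zero (α := ℝ))]
  have hmod : ∀ j : ℕ, D * (j + 1) % D = 0 := fun j => Nat.mul_mod_right _ _
  refine hasSum_pairWeight hη D 0 (fun j : ℕ => D * (j + 1)) ?_ ?_ ?_ p ?_ key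
  · intro i j hij
    simpa [hD.ne'] using hij
  · intro j
    refine ⟨by positivity, ?_⟩
    rw [foldMod, hmod]
    simp
  · intro k hk hf
    have hlt := Nat.mod_lt k hD
    rw [foldMod] at hf
    obtain ⟨j, rfl⟩ : D ∣ k := Nat.dvd_of_mod_eq_zero (by omega)
    exact ⟨j - 1, by rw [Nat.sub_add_cancel (Nat.pos_of_mul_pos_left hk)]⟩
  · intro j
    simp only [classWeight, classNode, hmod]
    rw [if_pos trivial, if_pos (Or.inl trivial), cosechWeight]
    push_cast
    rw [show η * (D * (j + 1)) = D * η * (j + 1 + 0 : ℝ) by ring]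
    generalize Real.sinh _ = x
    generalize (j + 1 : ℝ) = y
    ring

end moments

/-! ### The sum over one class -/

section classes

variable {η : ℝ}

/-- The Hankel determinant of the moments of the class of `c`. -/
noncomputable def classDet (η : ℝ) (D c n : ℕ) : ℝ :=
  hankelDet (fun p => ∑' z, pairWeight η D c z * (classNode D z.1 : ℝ) ^ p) n

theorem classDet_zero (η : ℝ) (D c : ℕ) : classDet η D c 0 = 1 := hankelDet_zero _

theorem foldMod_le (D k : ℕ) : 2 * foldMod D k ≤ D := by
  rw [foldMod]
  omega

theorem summable_pairWeight (hη : 0 < η) {D : ℕ} (hD : 0 < D) (c p : ℕ) :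
    Summable fun z => pairWeight η D c z * (classNode D z.1 : ℝ) ^ p := by
  rcases Nat.eq_zero_or_pos c with rfl | hc
  · exact (hasSum_pairWeight_zero hη hD p).summable
  rcases lt_trichotomy (2 * c) D with h | rfl | h
  · exact (hasSum_pairWeight_generic hη hc h p).summable
  · exact (hasSum_pairWeight_half hη hc p).summable
  · refine summable_zero.congr fun z => ?_
    rw [pairWeight, if_neg, zero_mul]
    rintro ⟨_, _, h'⟩
    have := foldMod_le D z.1
    omega

/-- The sum over the increasing tuples of one class. -/
theorem hasSum_classDet (hη : 0 < η) {D : ℕ} (hD : 0 < D) (c n : ℕ) :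
    HasSum (fun z : Fin n → ℕ × ℕ => if StrictMono fun i => (z i).1 then
      (∏ i, pairWeight η D c (z i)) *
        ∏ i, ∏ j ∈ Ioi i, ((classNode D (z j).1 : ℝ) - classNode D (z i).1) ^ 2 else 0)
      (classDet η D c n) :=
  hasSum_hankelDet_of_key Prod.fst (pairWeight η D c) (fun k => (classNode D k : ℝ)) _
    (fun p => (summable_pairWeight hη hD c p).hasSum) n

/-- In the classes of `0` and `D / 2` all weights are nonnegative. This fixes the sign of the
determinant, of which the earlier evaluations give the square. -/
theorem classDet_nonneg (hη : 0 < η) {D : ℕ} (hD : 0 < D) {c : ℕ} (hc : c = 0 ∨ 2 * c = D)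
    (n : ℕ) : 0 ≤ classDet η D c n := by
  refine (hasSum_classDet hη hD c n).nonneg fun z => ?_
  have h : ∀ z, 0 ≤ pairWeight η D c z := fun z => by
    rw [pairWeight]
    split_ifs with h
    · refine mul_nonneg (Rat.cast_nonneg.2 ?_) (by positivity)
      have h3 := h.2.2
      rw [foldMod] at h3
      have hlt := Nat.mod_lt z.1 hD
      rw [classWeight]
      split_ifs with h1 h2 h4
      · positivity
      · positivity
      · positivity
      · omega
    · exact le_rfl
  split_ifs
  · exact mul_nonneg (prod_nonneg fun i _ => h _)
      (prod_nonneg fun i _ => prod_nonneg fun j _ => sq_nonneg _)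
  · exact le_rfl

/-- The determinant of the class of `D / 2`. -/
theorem classDet_half (hη : 0 < η) {c : ℕ} (hc : 0 < c) (N : ℕ) :
    classDet η (2 * c) c N = (2 ^ N)⁻¹ * ((2 * c : ℕ) : ℝ) ^ (N * (2 * N - 1)) *
      factorialProdBelow (2 * N) * triangleTheta ((2 * c : ℕ) * η) ^ (4 * N ^ 2) := by
  have hD : 0 < 2 * c := by omega
  have hDη : 0 < ((2 * c : ℕ) : ℝ) * η := mul_pos (Nat.cast_pos.2 hD) hη
  have hF : (0 : ℝ) < factorialProdBelow (2 * N) := Rat.cast_pos.2 (factorialProdBelow_pos _)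
  have hT := triangleTheta_pos hDη
  refine (pow_left_inj₀ (classDet_nonneg hη hD (Or.inr rfl) N) (by positivity) two_ne_zero).1 ?_
  rw [classDet]
  simp only [fun p => (hasSum_pairWeight_half hη hc p).tsum_eq]
  rw [hankelDet_smul_pow, mul_pow, sq_hankelDet_half hDη]
  generalize triangleTheta _ = T
  generalize (factorialProdBelow (2 * N) : ℝ) = F
  generalize ((2 * c : ℕ) : ℝ) = D
  rcases N with _ | N
  · simp
  · rw [show 2 * (N + 1) - 1 = 2 * N + 1 by omega, Nat.add_sub_cancel]
    rw [div_pow]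
    ring

/-- The determinant of the class of `0`. -/
theorem classDet_zero_class (hη : 0 < η) {D : ℕ} (hD : 0 < D) (N : ℕ) :
    classDet η D 0 N = (2 ^ N)⁻¹ * (D : ℝ) ^ (N * (2 * N + 1)) *
      factorialProdBelow (2 * N + 1) * triangleTheta (D * η) ^ (4 * N * (N + 1)) := by
  have hDη : 0 < (D : ℝ) * η := mul_pos (Nat.cast_pos.2 hD) hη
  have hF : (0 : ℝ) < factorialProdBelow (2 * N + 1) := Rat.cast_pos.2 (factorialProdBelow_pos _)
  have hT := triangleTheta_pos hDη
  refine (pow_left_inj₀ (classDet_nonneg hη hD (Or.inl rfl) N) (by positivity) two_ne_zero).1 ?_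
  rw [classDet]
  simp only [fun p => (hasSum_pairWeight_zero hη hD p).tsum_eq]
  rw [hankelDet_smul_pow, mul_pow, sq_hankelDet_zero hDη]
  generalize triangleTheta _ = T
  generalize (factorialProdBelow (2 * N + 1) : ℝ) = F
  rcases N with _ | N
  · simp
  · rw [Nat.add_sub_cancel]
    rw [div_pow]
    ring

/-- The determinant of a class different from those of `0` and `D / 2`. The quotient of theta values
is a sign for even `n`. -/
theorem classDet_generic (hη : 0 < η) {D c : ℕ} (h0 : 0 < c) (h1 : 2 * c < D) (n : ℕ) :
    classDet η D c n = (D : ℝ) ^ (n * (n - 1)) * factorialProdBelow n ^ 2 *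
      triangleTheta (D * η) ^ (2 * n ^ 2) *
      (thetaNull (D * η) (c / D - 1 / 2 + n / 2) / thetaNull (D * η) (c / D - 1 / 2)) := by
  have hD : (0 : ℝ) < D := Nat.cast_pos.2 (by omega)
  have hc : (c : ℝ) / D ≤ 1 / 2 := by
    rw [div_le_div_iff₀ hD two_pos]
    exact_mod_cast (by omega : c * 2 ≤ 1 * D)
  rw [classDet]
  simp only [fun p => (hasSum_pairWeight_generic hη h0 h1 p).tsum_eq]
  have := hankelDet_smul_pow (D : ℝ) 1 (cosechMoment (D * η) (c / D)) n
  simp only [one_mul, one_pow] at this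
  rw [this, hankelDet_cosechMoment (by positivity) (by positivity) hc, superFactorialSq_eq]
  ring

theorem thetaNull_class_ne_zero (hη : 0 < η) {D c : ℕ} (h0 : 0 < c) (h1 : 2 * c < D) :
    thetaNull (D * η) (c / D - 1 / 2) ≠ 0 := by
  have hD : (0 : ℝ) < D := Nat.cast_pos.2 (by omega)
  refine thetaNull_sub_half_ne_zero (by positivity) (by positivity) ?_
  rw [div_lt_one hD]
  exact_mod_cast (by omega : c < D)

/-- The product of the determinants of equal size of classes different from those of `0` and
`D / 2`. If the size is odd, the theta values that occur cancel in the product, because the set of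
classes is invariant under `c ↦ D / 2 - c`. -/
theorem prod_classDet_generic (hη : 0 < η) {D : ℕ} {A : Finset ℕ}
    (hA : ∀ c ∈ A, 0 < c ∧ 2 * c < D) (n : ℕ)
    (hn : Odd n → Even D ∧ ∀ c ∈ A, D / 2 - c ∈ A) :
    ∏ c ∈ A, classDet η D c n = ((-1) ^ (n / 2) * (D : ℝ) ^ (n * (n - 1)) *
      factorialProdBelow n ^ 2 * triangleTheta (D * η) ^ (2 * n ^ 2)) ^ #A := by
  have key : ∏ c ∈ A, (thetaNull (D * η) (c / D - 1 / 2 + n / 2) /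
      thetaNull (D * η) (c / D - 1 / 2)) = ((-1) ^ (n / 2)) ^ #A := by
    rcases Nat.even_or_odd' n with ⟨N, rfl | rfl⟩
    · rw [← prod_const]
      refine prod_congr rfl fun c hc => ?_
      rw [show ((2 * N : ℕ) : ℝ) / 2 = N by push_cast; ring, thetaNull_add_nat, mul_div_assoc,
        div_self (thetaNull_class_ne_zero hη (hA c hc).1 (hA c hc).2), mul_one]
      simp
    · obtain ⟨⟨e, rfl⟩, hA'⟩ := hn ⟨N, rfl⟩
      have e1 : ∀ c : ℕ, thetaNull ((e + e : ℕ) * η) (c / (e + e : ℕ) - 1 / 2 +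
          ((2 * N + 1 : ℕ) : ℝ) / 2) = (-1) ^ N * thetaNull ((e + e : ℕ) * η) (c / (e + e : ℕ)) :=
        fun c => by
          rw [← thetaNull_add_nat]
          congr 1
          push_cast
          ring
      -- the reflection `c ↦ D / 2 - c` matches the numerators with the denominators
      have e2 : ∏ c ∈ A, thetaNull ((e + e : ℕ) * η) (c / (e + e : ℕ)) =
          ∏ c ∈ A, thetaNull ((e + e : ℕ) * η) (c / (e + e : ℕ) - 1 / 2) := by
        refine prod_bij' (fun c _ => (e + e) / 2 - c) (fun c _ => (e + e) / 2 - c) hA' hA'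
          (fun c hc => ?_) (fun c hc => ?_) fun c hc => ?_
        · have := (hA c hc).2; omega
        · have := (hA c hc).2; omega
        · have h2 := (hA c hc).2
          have he : (0 : ℝ) < e := Nat.cast_pos.2 (by omega)
          rw [← thetaNull_neg]
          congr 1
          rw [show (e + e) / 2 - c = e - c by omega]
          push_cast [Nat.cast_sub (by omega : c ≤ e)]
          field_simp
          ring
      simp only [e1]
      rw [prod_div_distrib, prod_mul_distrib, prod_const, e2, mul_div_assoc, div_self, mul_one,
        show (2 * N + 1) / 2 = N by omega]
      exact prod_ne_zero_iff.2 fun c hc => thetaNull_class_ne_zero hη (hA c hc).1 (hA c hc).2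
  rw [prod_congr rfl fun c hc => classDet_generic hη (hA c hc).1 (hA c hc).2 n, prod_mul_distrib,
    prod_const, key, ← mul_pow]
  congr 1
  ring

end classes

/-! ### Factorization of sums over tuples into sums over classes -/

section factorization

variable {β C : Type}

/-- A tuple whose indices are divided into classes is a family of tuples, one for each class. -/
def fiberEquiv {m : ℕ} (b : Fin m → C) (β : Type) :
    (Fin m → β) ≃ ∀ c, {i // b i = c} → β where
  toFun z _ t := z t.1
  invFun y i := y (b i) ⟨i, rfl⟩
  left_inv _ := rfl
  right_inv y := by
    ext c ⟨i, h⟩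
    subst h
    rfl

/-- Transport of the sum over the increasing tuples from `Fin n` to another finite linear order with
`n` elements. -/
theorem hasSum_of_hasSum_fin {T : Type} [Fintype T] [LinearOrder T] (key : β → ℕ) (ω : β → ℝ)
    (ν : ℕ → ℝ) {a : ℝ} {n : ℕ} (hn : Fintype.card T = n)
    (h : HasSum (fun z : Fin n → β => if StrictMono fun i => key (z i) then
      (∏ i, ω (z i)) * ∏ i, ∏ j ∈ Ioi i, (ν (key (z j)) - ν (key (z i))) ^ 2 else 0) a) :
    HasSum (fun z : T → β => if StrictMono fun i => key (z i) then
      (∏ i, ω (z i)) * ∏ i, ∏ j,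
        (if i < j then (ν (key (z j)) - ν (key (z i))) ^ 2 else 1) else 0) a := by
  set e := monoEquivOfFin T hn
  rw [← (e.toEquiv.arrowCongr (Equiv.refl β)).hasSum_iff]
  refine h.congr_fun fun z => ?_
  have h1 : StrictMono (fun i => key (z (e.symm i))) ↔ StrictMono fun i => key (z i) := by
    refine ⟨fun h i j hij => ?_, fun h => h.comp e.symm.strictMono⟩
    simpa using h (e.strictMono hij)
  simp only [Function.comp, Equiv.arrowCongr_apply, Equiv.coe_refl, id]
  have h2 : ∀ i, e.toEquiv.symm i = e.symm i := fun _ => rfl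
  simp only [h2, h1]
  congr 1
  rw [← e.toEquiv.prod_comp, ← e.toEquiv.prod_comp fun i => ∏ j, _]
  have h3 : ∀ i, e.symm (e.toEquiv i) = i := fun i => e.symm_apply_apply i
  simp only [h3]
  congr 1
  refine prod_congr rfl fun i _ => ?_
  rw [← e.toEquiv.prod_comp]
  have h4 : ∀ j, e.toEquiv i < e.toEquiv j ↔ i < j := fun j => e.lt_iff_lt
  simp only [h3, h4]
  rw [← prod_filter]
  congr 1
  ext j
  simp

/-- The sum over the tuples that increase along each class factors into the sums over the
classes. -/
theorem hasSum_prod_classes [Fintype C] [DecidableEq C] {m : ℕ} (b : Fin m → C) (key : β → ℕ)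
    (ω : C → β → ℝ) (ν : ℕ → ℝ) (a : C → ℕ → ℝ)
    (h : ∀ c n, HasSum (fun z : Fin n → β => if StrictMono fun i => key (z i) then
      (∏ i, ω c (z i)) * ∏ i, ∏ j ∈ Ioi i, (ν (key (z j)) - ν (key (z i))) ^ 2 else 0) (a c n)) :
    HasSum (fun z : Fin m → β => if ∀ i j, i < j → b i = b j → key (z i) < key (z j) then
      (∏ i, ω (b i) (z i)) * ∏ i, ∏ j,
        (if i < j ∧ b i = b j then (ν (key (z j)) - ν (key (z i))) ^ 2 else 1) else 0)
      (∏ c, a c #{i | b i = c}) := by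
  have h1 := HasSum.prod_pi fun c => hasSum_of_hasSum_fin (T := {i // b i = c}) key (ω c) ν
    (Fintype.card_subtype _) (h c _)
  rw [← (fiberEquiv b β).hasSum_iff] at h1
  refine h1.congr_fun fun z => ?_
  simp only [Function.comp]
  have e : ∀ c t, fiberEquiv b β z c t = z t.1 := fun _ _ => rfl
  have hmono : (∀ i j, i < j → b i = b j → key (z i) < key (z j)) ↔
      ∀ c, StrictMono fun t => key (fiberEquiv b β z c t) :=
    ⟨fun H c s t hst => H s t hst (s.2.trans t.2.symm),
      fun H i j hij hb => H (b j) (a := ⟨i, hb⟩) (b := ⟨j, rfl⟩) hij⟩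
  by_cases hz : ∀ c, StrictMono fun t => key (fiberEquiv b β z c t)
  · rw [if_pos (hmono.2 hz), prod_congr rfl fun c _ => if_pos (hz c), prod_mul_distrib]
    simp only [e]
    congr 1
    · rw [← Fintype.prod_fiberwise b]
      exact prod_congr rfl fun c _ => prod_congr rfl fun t _ => by rw [t.2]
    · rw [← Fintype.prod_fiberwise b]
      refine prod_congr rfl fun c _ => prod_congr rfl fun s _ => ?_
      have h2 := prod_subtype (F := inferInstance) (univ.filter fun j => b j = c)
        (p := fun j => b j = c) (by simp)
        fun j => if s.1 < j then (ν (key (z j)) - ν (key (z s))) ^ 2 else 1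
      rw [prod_filter] at h2
      refine Eq.trans (prod_congr rfl fun j _ => ?_) h2
      rw [s.2]
      by_cases h3 : b j = c
      · simp [h3]
      · simp [h3, Ne.symm h3]
  · rw [if_neg fun H => hz (hmono.1 H)]
    push Not at hz
    obtain ⟨c, hc⟩ := hz
    exact (prod_eq_zero (mem_univ c) (if_neg hc)).symm

end factorization

/-! ### The generating function of the sums over the solutions -/

/-- The pairs `(k, l)` of `m`-tuples of positive integers, the `l_i` odd, with
`k₁ l₁ + ⋯ + k_m l_m = N`, where `k_i` lies in the class of `b i` and the `k_i` increase along each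
class. -/
def classSol (D : ℕ) {m : ℕ} (b : Fin m → ℕ) (N : ℕ) : Finset ((Fin m → ℕ) × (Fin m → ℕ)) :=
  {p ∈ posSol m N | (∀ i, Odd (p.2 i)) ∧ (∀ i, foldMod D (p.1 i) = b i) ∧
    ∀ i j, i < j → b i = b j → p.1 i < p.1 j}

/-- The product of the weights of the `k_i` and of the squared differences of the nodes within each
class. -/
def classTerm (D : ℕ) {m : ℕ} (k : Fin m → ℕ) : ℚ :=
  (∏ i, classWeight D (k i)) * ∏ i, ∏ j,
    if i < j ∧ foldMod D (k i) = foldMod D (k j) then (classNode D (k j) - classNode D (k i)) ^ 2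
    else 1

/-- The generating function of the sums over the solutions is the product of the class determinants.
-/
theorem hasSum_classSol {η : ℝ} (hη : 0 < η) {D : ℕ} (hD : 0 < D) {m : ℕ} (b : Fin m → ℕ)
    (hb : ∀ i, 2 * b i ≤ D) :
    HasSum (fun N => ((∑ p ∈ classSol D b N, classTerm D p.1 : ℚ) : ℝ) * Real.exp (-η) ^ N)
      (∏ c ∈ range (D / 2 + 1), classDet η D c #{i | b i = c}) := by
  set b' : Fin m → Fin (D / 2 + 1) := fun i => ⟨b i, by have := hb i; omega⟩ with hb'
  have h1 := hasSum_prod_classes b' (Prod.fst (α := ℕ) (β := ℕ)) (fun c => pairWeight η D c)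
    (fun k => (classNode D k : ℝ)) (fun c n => classDet η D c n)
    fun c n => hasSum_classDet hη hD c n
  have e1 : ∏ c, classDet η D (c : Fin (D / 2 + 1)) #{i | b' i = c} =
      ∏ c ∈ range (D / 2 + 1), classDet η D c #{i | b i = c} := by
    rw [← Fin.prod_univ_eq_prod_range fun c => classDet η D c #{i | b i = c}]
    simp only [hb', Fin.ext_iff]
  rw [e1, ← (Equiv.arrowProdEquivProdArrow (Fin m) (fun _ => ℕ) fun _ => ℕ).symm.hasSum_iff] at h1
  have h2 := h1.tsum_fiberwise fun p : (Fin m → ℕ) × (Fin m → ℕ) => ∑ i, p.1 i * p.2 i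
  refine h2.congr_fun fun N => ?_
  rw [tsum_subtype ((fun p : (Fin m → ℕ) × (Fin m → ℕ) => ∑ i, p.1 i * p.2 i) ⁻¹' {N}),
    tsum_eq_sum (s := classSol D b N), Rat.cast_sum, sum_mul]
  · refine sum_congr rfl fun p hp => ?_
    rw [classSol, mem_filter, mem_posSol] at hp
    obtain ⟨⟨hpos, hN⟩, hodd, hf, hord⟩ := hp
    rw [Set.indicator_of_mem (by simpa using hN)]
    simp only [Function.comp, Equiv.arrowProdEquivProdArrow, Equiv.coe_fn_symm_mk, hb',
      Fin.mk.injEq]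
    have e3 : ∀ i, pairWeight η D (b i) (p.1 i, p.2 i) =
        classWeight D (p.1 i) * Real.exp (-η) ^ (p.1 i * p.2 i) := fun i =>
      if_pos ⟨(hpos i).1, hodd i, hf i⟩
    rw [if_pos hord, prod_congr rfl fun i _ => e3 i, prod_mul_distrib,
      prod_pow_eq_pow_sum, hN, classTerm]
    simp only [hf]
    push_cast
    have e2 : ∀ i j, (((if i < j ∧ b i = b j then (classNode D (p.1 j) - classNode D (p.1 i)) ^ 2
        else 1 : ℚ)) : ℝ) = if i < j ∧ b i = b j then
          ((classNode D (p.1 j) : ℝ) - classNode D (p.1 i)) ^ 2 else 1 := fun i j => by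
      split_ifs <;> push_cast <;> rfl
    simp only [e2]
    ring
  · intro p hp
    by_cases hN : ∑ i, p.1 i * p.2 i = N
    · rw [Set.indicator_of_mem (by simpa using hN)]
      simp only [Function.comp, Equiv.arrowProdEquivProdArrow, Equiv.coe_fn_symm_mk, hb',
        Fin.mk.injEq]
      split_ifs with hord
      · have h3 : ∃ i, ¬(0 < p.1 i ∧ Odd (p.2 i) ∧ foldMod D (p.1 i) = b i) := by
          by_contra! H
          refine hp ?_
          rw [classSol, mem_filter, mem_posSol]
          exact ⟨⟨fun i => ⟨(H i).1, (H i).2.1.pos⟩, hN⟩, fun i => (H i).2.1, fun i => (H i).2.2,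
            hord⟩
        obtain ⟨i, hi⟩ := h3
        rw [prod_eq_zero (mem_univ i), zero_mul]
        rw [pairWeight, if_neg hi]
      · rfl
    · rw [Set.indicator_of_notMem (by simpa using hN)]

/-! ### Comparison of coefficients -/

/-- A power series that vanishes on `(0, 1)` is zero. -/
theorem eq_zero_of_hasSum_pow {c : ℕ → ℝ}
    (h : ∀ q : ℝ, 0 < q → q < 1 → HasSum (fun n => c n * q ^ n) 0) (n : ℕ) : c n = 0 := by
  induction n using Nat.strong_induction_on with
  | _ n ih =>
    -- dividing by `q ^ n` and letting `q → 0`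
    have hs : ∀ q : ℝ, 0 < q → q < 1 → HasSum (fun k => c (n + k) * q ^ k) 0 := fun q h0 h1 => by
      have h2 := (hasSum_nat_add_iff' n).2 (h q h0 h1)
      rw [sum_eq_zero fun i hi => by rw [ih i (mem_range.1 hi), zero_mul], sub_zero] at h2
      have h3 := h2.mul_right ((q ^ n)⁻¹)
      rw [zero_mul] at h3
      refine h3.congr_fun fun k => ?_
      have : q ^ n ≠ 0 := pow_ne_zero _ h0.ne'
      rw [add_comm n k]
      field_simp
      ring
    have hsn : Summable fun k => |c (n + (k + 1))| * (1 / 2) ^ k := by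
      have h2 := (summable_nat_add_iff 1).2 (hs (1 / 2) (by norm_num) (by norm_num)).summable.abs
      refine (h2.mul_right 2).congr fun k => ?_
      rw [abs_mul, abs_of_pos (by positivity : (0 : ℝ) < (1 / 2) ^ (k + 1)), pow_succ]
      ring
    set K := ∑' k, |c (n + (k + 1))| * (1 / 2 : ℝ) ^ k
    have hbound : ∀ q : ℝ, 0 < q → q ≤ 1 / 2 → |c n| ≤ q * K := fun q h0 h1 => by
      have h2 := hs q h0 (by linarith)
      have h3 := (hasSum_nat_add_iff' 1).2 h2
      simp only [sum_range_one, pow_zero, mul_one, add_zero, zero_sub] at h3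
      have h4 : ∀ k, |c (n + (k + 1)) * q ^ (k + 1)| ≤ q * (|c (n + (k + 1))| * (1 / 2) ^ k) :=
        fun k => by
          rw [abs_mul, abs_of_pos (by positivity : 0 < q ^ (k + 1)), pow_succ]
          have : q ^ k ≤ (1 / 2) ^ k := pow_le_pow_left₀ h0.le h1 k
          calc _ = q * (|c (n + (k + 1))| * q ^ k) := by ring
            _ ≤ _ := by gcongr
      have h5 := h3.norm_le_of_bounded (hsn.hasSum.mul_left q) h4
      rwa [Real.norm_eq_abs, abs_neg] at h5
    by_contra hne
    have hpos : 0 < |c n| := abs_pos.2 hne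
    have hK : 0 < K := by
      have := hbound (1 / 2) (by norm_num) le_rfl
      linarith
    have h6 := hbound (min (1 / 2) (|c n| / (2 * K))) (by positivity) (min_le_left _ _)
    have h7 : min (1 / 2) (|c n| / (2 * K)) * K ≤ |c n| / (2 * K) * K := by
      gcongr
      exact min_le_right _ _
    have h8 : |c n| / (2 * K) * K = |c n| / 2 := by field_simp
    linarith

/-- Coefficients are determined by the sums of the series at `q = exp (-η)`. -/
theorem eq_of_hasSum_exp {a b : ℕ → ℝ} {S : ℝ → ℝ}
    (ha : ∀ η : ℝ, 0 < η → HasSum (fun n => a n * Real.exp (-η) ^ n) (S η))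
    (hb : ∀ η : ℝ, 0 < η → HasSum (fun n => b n * Real.exp (-η) ^ n) (S η)) : a = b := by
  funext n
  refine sub_eq_zero.1 (eq_zero_of_hasSum_pow (c := fun n => a n - b n) (fun q h0 h1 => ?_) n)
  have hη : 0 < -Real.log q := by linarith [Real.log_neg h0 h1]
  have h2 := (ha _ hη).sub (hb _ hη)
  rw [sub_self, neg_neg, Real.exp_log h0] at h2
  exact h2.congr_fun fun n => by ring

theorem injective_triangle : Function.Injective fun j : ℕ => j * (j + 1) / 2 := by
  refine StrictMono.injective (strictMono_nat_of_lt_succ fun j => ?_)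
  have : (j + 1) * (j + 1 + 1) = j * (j + 1) + (j + 1) * 2 := by ring
  rw [this, Nat.add_mul_div_right _ _ two_pos]
  omega

theorem coeff_triangleSeries_triangle (j : ℕ) :
    PowerSeries.coeff (j * (j + 1) / 2) triangleSeries = 1 := by
  rw [triangleSeries, PowerSeries.coeff_mk, card_eq_one]
  refine ⟨j, ?_⟩
  ext i
  rw [mem_filter, mem_range, mem_singleton]
  refine ⟨fun h => injective_triangle h.2, ?_⟩
  rintro rfl
  exact ⟨Nat.lt_succ_of_le (le_of_triangle rfl), rfl⟩

theorem hasSum_triangleSeries {y : ℝ} (h0 : 0 < y) (h1 : y < 1) :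
    HasSum (fun n => ((PowerSeries.coeff n triangleSeries : ℕ) : ℝ) * y ^ n)
      (∑' j : ℕ, y ^ (j * (j + 1) / 2)) := by
  have hs : Summable fun j : ℕ => y ^ (j * (j + 1) / 2) :=
    (summable_geometric_of_lt_one h0.le h1).comp_injective injective_triangle
  rw [← injective_triangle.hasSum_iff]
  · refine hs.hasSum.congr_fun fun j => ?_
    simp only [Function.comp]
    rw [coeff_triangleSeries_triangle]
    simp
  · intro n hn
    rw [triangleSeries, PowerSeries.coeff_mk, filter_eq_empty_iff.2 fun j _ h => hn ⟨j, h⟩]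
    simp

theorem hasSum_triangleNum {y : ℝ} (h0 : 0 < y) (h1 : y < 1) (M : ℕ) :
    HasSum (fun n => (triangleNum M n : ℝ) * y ^ n) ((∑' j : ℕ, y ^ (j * (j + 1) / 2)) ^ M) := by
  induction M with
  | zero =>
    have := hasSum_ite_eq (0 : ℕ) (1 : ℝ)
    rw [pow_zero]
    refine this.congr_fun fun n => ?_
    rw [triangleNum, pow_zero, PowerSeries.coeff_one]
    split_ifs with h <;> simp [h]
  | succ M ih =>
    have h2 := hasSum_triangleSeries h0 h1
    have hn1 : Summable fun n => ‖(triangleNum M n : ℝ) * y ^ n‖ := ih.summable.norm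
    have hn2 : Summable fun n => ‖((PowerSeries.coeff n triangleSeries : ℕ) : ℝ) * y ^ n‖ :=
      h2.summable.norm
    have h3 := tsum_mul_tsum_eq_tsum_sum_antidiagonal_of_summable_norm hn1 hn2
    have h4 := (summable_norm_sum_mul_antidiagonal_of_summable_norm hn1 hn2).of_norm.hasSum
    rw [← h3, ih.tsum_eq, h2.tsum_eq, ← pow_succ] at h4
    refine h4.congr_fun fun n => ?_
    rw [triangleNum, pow_succ, PowerSeries.coeff_mul]
    push_cast
    rw [sum_mul]
    refine sum_congr rfl fun p hp => ?_
    rw [triangleNum, ← mem_antidiagonal.1 hp, pow_add]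
    ring

/-- The relation between `triangleTheta` and the generating function of the triangular numbers, from
`(2 * j + 1) ^ 2 / 8 = 1 / 8 + j * (j + 1) / 2`. -/
theorem triangleTheta_eq (x : ℝ) : triangleTheta x =
    Real.exp (-x) ^ (1 / 8 : ℝ) * ∑' j : ℕ, Real.exp (-x) ^ (j * (j + 1) / 2) := by
  rw [triangleTheta, ← tsum_mul_left]
  refine tsum_congr fun j => ?_
  rw [← Real.exp_mul, ← Real.exp_nat_mul, ← Real.exp_add, Nat.cast_div
    (even_iff_two_dvd.1 (Nat.even_mul_succ_self j)) (by norm_num)]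
  congr 1
  push_cast
  ring

/-- A power of the theta series of the triangular numbers as a power series in `exp (-η)`; `B` is
the exponent that comes from the factor `q ^ (1 / 8)`. -/
theorem hasSum_triangleTheta_pow {η : ℝ} (hη : 0 < η) {D M B : ℕ} (hD : 0 < D)
    (hB : D * M = 8 * B) :
    HasSum (fun n => (triangleNum M n : ℝ) * Real.exp (-η) ^ (B + D * n))
      (triangleTheta (D * η) ^ M) := by
  have hD' : (0 : ℝ) < D := Nat.cast_pos.2 hD
  have hy : Real.exp (-(D * η)) < 1 := Real.exp_lt_one_iff.2 (by nlinarith)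
  have h1 := (hasSum_triangleNum (Real.exp_pos _) hy M).mul_left (Real.exp (-η) ^ B)
  have h2 : (Real.exp (-(D * η)) ^ (1 / 8 : ℝ)) ^ M = Real.exp (-η) ^ B := by
    rw [← Real.exp_mul, ← Real.exp_nat_mul, ← Real.exp_nat_mul]
    congr 1
    have : (D : ℝ) * M = 8 * B := by exact_mod_cast hB
    linear_combination -η / 8 * this
  rw [triangleTheta_eq, mul_pow, h2]
  refine h1.congr_fun fun n => ?_
  rw [pow_add, pow_mul, ← Real.exp_nat_mul _ D, show (D : ℝ) * -η = -(D * η) by ring]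
  ring

/-- The comparison of coefficients: if the product of the class determinants is a multiple of a
power of the theta series of the triangular numbers, the sums over the solutions are the same
multiple of the numbers of representations as sums of triangular numbers. -/
theorem sum_classSol {D : ℕ} (hD : 0 < D) {m : ℕ} (b : Fin m → ℕ) (hb : ∀ i, 2 * b i ≤ D)
    {C : ℚ} {M B : ℕ} (hB : D * M = 8 * B)
    (h : ∀ η : ℝ, 0 < η → ∏ c ∈ range (D / 2 + 1), classDet η D c #{i | b i = c} =
      C * triangleTheta (D * η) ^ M) (x : ℕ) :
    ∑ p ∈ classSol D b (B + x), classTerm D p.1 = C * triangleNumDiv M x D := by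
  set t : ℕ → ℝ := fun N => if B ≤ N then C * triangleNumDiv M (N - B) D else 0 with ht
  have h1 := eq_of_hasSum_exp (b := t) (fun η hη => hasSum_classSol hη hD b hb) fun η hη => by
    have hinj : Function.Injective fun n => B + D * n := fun i j hij => by
      simpa [hD.ne'] using hij
    rw [h η hη, ← hinj.hasSum_iff]
    · refine ((hasSum_triangleTheta_pow hη hD hB).mul_left (C : ℝ)).congr_fun fun n => ?_
      simp only [Function.comp, ht]
      rw [if_pos (by omega), Nat.add_sub_cancel_left, triangleNumDiv, if_pos (Dvd.intro _ rfl),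
        Nat.mul_div_cancel_left _ hD]
      ring
    · intro N hN
      simp only [ht]
      split_ifs with h2
      · rw [triangleNumDiv, if_neg]
        · simp
        · rintro ⟨n, hn⟩
          exact hN ⟨n, by simp only; omega⟩
      · rw [zero_mul]
  have h2 := congrFun h1 (B + x)
  simp only [ht, if_pos (Nat.le_add_right B x), Nat.add_sub_cancel_left] at h2
  exact_mod_cast h2

theorem factorialProdBelow_zero : factorialProdBelow 0 = 1 := rfl

theorem factorialProdBelow_succ (n : ℕ) :
    factorialProdBelow (n + 1) = factorialProdBelow n * n.factorial := prod_range_succ _ _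

theorem factorialProd_eq (n d : ℕ) : factorialProd n d = factorialProdBelow (n + 1) ^ d := by
  rw [factorialProd, prod_pow, factorialProdBelow, range_eq_Ico,
    prod_eq_prod_Ico_succ_bot (by omega)]
  simp only [Nat.factorial_zero, Nat.cast_one, one_mul, zero_add]
  rfl

/-- The sums over the solutions if all classes that occur, except for those of `0` and `D / 2`,
contain the same number `n` of indices. -/
theorem sum_classSol_of_card {D : ℕ} (hD : 0 < D) {m : ℕ} {b : Fin m → ℕ}
    (hb : ∀ i, 2 * b i ≤ D) {A : Finset ℕ} (hA : ∀ c ∈ A, 0 < c ∧ 2 * c < D) {n N₀ N₁ B : ℕ}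
    (hn : Odd n → Even D ∧ ∀ c ∈ A, D / 2 - c ∈ A) (hcA : ∀ c ∈ A, #{i | b i = c} = n)
    (hc : ∀ c, 0 < c → 2 * c < D → c ∉ A → #{i | b i = c} = 0) (h0 : #{i | b i = 0} = N₀)
    (h1 : ∀ c, 0 < c → 2 * c = D → #{i | b i = c} = N₁) (hN₁ : Odd D → N₁ = 0)
    (hB : D * (2 * n ^ 2 * #A + 4 * N₀ * (N₀ + 1) + 4 * N₁ ^ 2) = 8 * B) (x : ℕ) :
    ∑ p ∈ classSol D b (B + x), classTerm D p.1 =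
      (((-1) ^ (n / 2) * (D : ℚ) ^ (n * (n - 1)) * factorialProdBelow n ^ 2) ^ #A *
        ((2 ^ N₀)⁻¹ * (D : ℚ) ^ (N₀ * (2 * N₀ + 1)) * factorialProdBelow (2 * N₀ + 1)) *
        ((2 ^ N₁)⁻¹ * (D : ℚ) ^ (N₁ * (2 * N₁ - 1)) * factorialProdBelow (2 * N₁))) *
      triangleNumDiv (2 * n ^ 2 * #A + 4 * N₀ * (N₀ + 1) + 4 * N₁ ^ 2) x D := by
  refine sum_classSol hD b hb hB (fun η hη => ?_) x
  set f : ℕ → ℝ := fun c => classDet η D c #{i | b i = c} with hf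
  have hf0 : f 0 = _ := (congrArg (classDet η D 0) h0).trans (classDet_zero_class hη hD N₀)
  have hfA : ∏ c ∈ A, f c = _ := (prod_congr rfl fun c h =>
    congrArg (classDet η D c) (hcA c h)).trans (prod_classDet_generic hη hA n hn)
  have hK : ∀ K, (∀ c, c < K ↔ 2 * c < D) → ∏ c ∈ range K, f c = f 0 * ∏ c ∈ A, f c :=
    fun K hK => by
      rw [← prod_insert fun h => lt_irrefl _ (hA 0 h).1]
      refine (prod_subset (fun c hc' => ?_) fun c hcK hcA' => ?_).symm
      · rw [mem_range, hK]
        rcases mem_insert.1 hc' with rfl | h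
        · omega
        · exact (hA c h).2
      · rw [mem_range, hK] at hcK
        rw [mem_insert, not_or] at hcA'
        simp only [hf]
        rw [hc c (Nat.pos_of_ne_zero hcA'.1) hcK hcA'.2, classDet_zero]
  rcases Nat.even_or_odd' D with ⟨e, rfl | rfl⟩
  · have hfe : f e = _ := (congrArg (classDet η (2 * e) e) (h1 e (by omega) rfl)).trans
      (classDet_half hη (by omega) N₁)
    simp only [hf] at hfe
    rw [show 2 * e / 2 = e by omega, prod_range_succ, hK e (by omega), hf0, hfA, hfe]
    push_cast
    rw [mul_pow _ (triangleTheta _ ^ _), ← pow_mul, pow_add, pow_add]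
    ring
  · rw [hN₁ ⟨e, rfl⟩] at hB ⊢
    rw [hK _ (by omega), hf0, hfA]
    push_cast
    rw [mul_pow _ (triangleTheta _ ^ _), ← pow_mul, pow_add, pow_add]
    simp only [factorialProdBelow_zero]
    norm_num
    ring

/-! ### The sets of solutions and the products over them in terms of the classes -/

/-- Congruence up to sign is equality of the representatives. -/
theorem congrPM_iff {n : ℕ} (hn : 0 < n) (a b : ℕ) :
    CongrPM n a b ↔ foldMod n a = foldMod n b := by
  have h1 : (a : ℤ) ≡ b [ZMOD n] ↔ a % n = b % n := Int.natCast_modEq_iff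
  have h2 : (a : ℤ) ≡ -b [ZMOD n] ↔ (a % n + b % n) % n = 0 := by
    rw [← Nat.add_mod, ← Nat.dvd_iff_mod_eq_zero, ← Int.natCast_dvd_natCast,
      Int.modEq_iff_dvd, ← dvd_neg]
    push_cast
    rw [show -(-(b : ℤ) - a) = a + b by ring]
  rw [CongrPM, h1, h2, foldMod, foldMod]
  have ha := Nat.mod_lt a hn
  have hb := Nat.mod_lt b hn
  generalize a % n = u at *
  generalize b % n = v at *
  have h3 : (u + v) % n = 0 ↔ u + v = 0 ∨ u + v = n := by
    rcases lt_or_ge (u + v) n with h | h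
    · rw [Nat.mod_eq_of_lt h]; omega
    · rw [Nat.mod_eq_sub_mod h, Nat.mod_eq_of_lt (by omega)]; omega
  rw [h3]
  omega

theorem mixedSol_eq {d : ℕ} (hd : 0 < d) (m N : ℕ) :
    mixedSol d m N = classSol d (fun i : Fin m => foldMod d (i + 1)) N := by
  rw [mixedSol, classSol]
  refine filter_congr fun p _ => and_congr_right fun _ => ?_
  have h1 : ∀ i : Fin m, CongrPM d (p.1 i) ((i : ℤ) + 1) ↔ foldMod d (p.1 i) = foldMod d (i + 1) :=
    fun i => by exact_mod_cast congrPM_iff hd (p.1 i) (i + 1)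
  simp only [OrderedMod, h1, congrPM_iff hd]
  exact and_congr_right fun h2 => by simp only [h2]

theorem mod_two_of_foldMod {d a b : ℕ} (hd : 0 < d) (h : foldMod (2 * d) a = foldMod (2 * d) b) :
    a % 2 = b % 2 := by
  have ha := Nat.mod_lt a (by omega : 0 < 2 * d)
  have hb := Nat.mod_lt b (by omega : 0 < 2 * d)
  have ha' := Nat.mod_mod_of_dvd a (dvd_mul_right 2 d)
  have hb' := Nat.mod_mod_of_dvd b (dvd_mul_right 2 d)
  rw [foldMod, foldMod] at h
  omega

theorem oddSol_eq {d : ℕ} (hd : 0 < d) (m N : ℕ) :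
    oddSol d m N = classSol (2 * d) (fun i : Fin m => foldMod (2 * d) (2 * i + 1)) N := by
  rw [oddSol, classSol]
  refine filter_congr fun p _ => ?_
  have hd2 : 0 < 2 * d := by omega
  have h1 : ∀ i : Fin m, CongrPM (2 * d) (p.1 i) (2 * (i : ℤ) + 1) ↔
      foldMod (2 * d) (p.1 i) = foldMod (2 * d) (2 * i + 1) :=
    fun i => by exact_mod_cast congrPM_iff hd2 (p.1 i) (2 * i + 1)
  have h3 : ∀ i j : Fin m, CongrPM (2 * d : ℕ) (p.1 i) (p.1 j) ↔
      foldMod (2 * d) (p.1 i) = foldMod (2 * d) (p.1 j) := fun i j => congrPM_iff hd2 _ _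
  simp only [OrderedMod, h1, h3]
  constructor
  · rintro ⟨ho, hf, h⟩
    exact ⟨fun i => (ho i).2, hf, by simpa only [hf] using h⟩
  · rintro ⟨ho, hf, h⟩
    refine ⟨fun i => ⟨Nat.odd_iff.2 ?_, ho i⟩, hf, by simpa only [hf] using h⟩
    rw [mod_two_of_foldMod hd (hf i)]
    omega

/-- The product over the pairs with `k_i ≡ ± k_j` in terms of the nodes. In the classes of `0` and
`D / 2` both congruences hold, and the product of both factors is `(k_j ^ 2 - k_i ^ 2) ^ 2`. -/
theorem pairProd_eq {D : ℕ} (hD : 0 < D) {m : ℕ} (k : Fin m → ℕ) :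
    pairProd D k = ∏ i, ∏ j, if i < j ∧ foldMod D (k i) = foldMod D (k j) then
      (classNode D (k j) - classNode D (k i)) ^ 2 else 1 := by
  rw [pairProd, prod_filter, prod_filter, Fintype.prod_prod_type, Fintype.prod_prod_type,
    ← prod_mul_distrib]
  refine prod_congr rfl fun i _ => ?_
  rw [← prod_mul_distrib]
  refine prod_congr rfl fun j _ => ?_
  by_cases hij : i < j
  swap
  · simp [hij]
  simp only [hij, true_and]
  generalize k i = a
  generalize k j = b
  have h1 : (a : ℤ) ≡ b [ZMOD D] ↔ a % D = b % D := Int.natCast_modEq_iff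
  have h2 : (a : ℤ) ≡ -b [ZMOD D] ↔ a % D + b % D = 0 ∨ a % D + b % D = D := by
    have ha := Nat.mod_lt a hD
    have hb := Nat.mod_lt b hD
    rw [Int.modEq_iff_dvd, ← dvd_neg, show -(-(b : ℤ) - a) = ((a + b : ℕ) : ℤ) by push_cast; ring,
      Int.natCast_dvd_natCast, Nat.dvd_iff_mod_eq_zero, Nat.add_mod]
    generalize a % D = u at *
    generalize b % D = v at *
    rcases lt_or_ge (u + v) D with h | h
    · rw [Nat.mod_eq_of_lt h]; omega
    · rw [Nat.mod_eq_sub_mod h, Nat.mod_eq_of_lt (by omega)]; omega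
  have h3 := congrPM_iff hD a b
  rw [CongrPM] at h3
  simp only [← h3, h1, h2]
  have ha := Nat.mod_lt a hD
  have hb := Nat.mod_lt b hD
  simp only [classNode]
  generalize a % D = u at *
  generalize b % D = v at *
  split_ifs <;> first | omega | ring

/-- The sign as a product of the signs of the classes; the hypothesis says that `R` consists of the
residues above `D / 2`. -/
theorem residueSign_eq {D : ℕ} {R : Finset ℕ} {m : ℕ} {k : Fin m → ℕ}
    (h : ∀ i, (∃ r ∈ R, k i ≡ r [MOD D]) ↔ D < 2 * (k i % D)) :
    residueSign D R k = ∏ i, if D < 2 * (k i % D) then -1 else 1 := by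
  rw [residueSign, prod_ite, prod_const, prod_const_one, mul_one]
  simp only [h]

/-- The summands in the two families in terms of the weights and nodes of the classes. -/
theorem classTerm_eq {D : ℕ} (hD : 0 < D) {R : Finset ℕ} {m : ℕ} {k : Fin m → ℕ}
    (h : ∀ i, (∃ r ∈ R, k i ≡ r [MOD D]) ↔ D < 2 * (k i % D)) :
    classTerm D k = residueSign D R k * (∏ i with k i % D = 0, (k i : ℚ) ^ 3) *
      (∏ i with 2 * (k i % D) = D, (k i : ℚ)) * pairProd D k := by
  rw [classTerm, pairProd_eq hD]
  refine congrArg (· * _) ?_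
  rw [residueSign_eq h, prod_filter, prod_filter, ← prod_mul_distrib, ← prod_mul_distrib]
  refine prod_congr rfl fun i _ => ?_
  rw [classWeight]
  split_ifs <;> first | omega | ring

/-! ### The number of indices in each class -/

theorem count_periodic {p : ℕ → Prop} [DecidablePred p] {a : ℕ} (hp : ∀ k, p (a + k) ↔ p k)
    (t r : ℕ) : Nat.count p (a * t + r) = t * Nat.count p a + Nat.count p r := by
  induction t with
  | zero => simp
  | succ t ih =>
    rw [show a * (t + 1) + r = a + (a * t + r) by ring, Nat.count_add]
    simp only [hp]
    rw [ih]
    ring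

theorem card_filter_fin (p : ℕ → Prop) [DecidablePred p] (m : ℕ) :
    #{i : Fin m | p i} = Nat.count p m := by
  rw [card_filter, Fin.sum_univ_eq_sum_range (fun i => if p i then 1 else 0) m, ← card_filter,
    Nat.count_eq_card_filter_range]

theorem foldMod_add_left (D k : ℕ) : foldMod D (D + k) = foldMod D k := by
  rw [foldMod, foldMod, Nat.add_mod_left]

theorem foldMod_of_le {D k : ℕ} (hk : k ≤ D) : foldMod D k = min k (D - k) := by
  rcases hk.lt_or_eq with h | rfl
  · rw [foldMod, Nat.mod_eq_of_lt h]
  · simp [foldMod]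

/-- The numbers of indices in the classes for the targets `1, …, M` modulo `d`. -/
theorem count_foldMod_succ {d M n : ℕ} (hd : 0 < d) (h : 2 * M = n * d) {c : ℕ} (hc : 2 * c ≤ d) :
    Nat.count (fun i => foldMod d (i + 1) = c) M =
      if c = 0 then n / 2 else if 2 * c = d then (n + 1) / 2 else n := by
  have hp : ∀ k, foldMod d (d + k + 1) = c ↔ foldMod d (k + 1) = c := fun k => by
    rw [add_assoc, foldMod_add_left]
  have hfull : Nat.count (fun i => foldMod d (i + 1) = c) d =
      if c = 0 then 1 else if 2 * c = d then 1 else 2 := by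
    rw [Nat.count_eq_card_filter_range]
    have h1 : {i ∈ range d | foldMod d (i + 1) = c} =
        if c = 0 then {d - 1} else if 2 * c = d then {c - 1} else {c - 1, d - c - 1} := by
      ext i
      rw [mem_filter, mem_range]
      split_ifs <;> simp only [mem_singleton, mem_insert] <;> constructor
      all_goals first
        | (rintro ⟨hi, h2⟩; rw [foldMod_of_le (by omega)] at h2; omega)
        | (intro hi; refine ⟨by omega, ?_⟩; rw [foldMod_of_le (by omega)]; omega)
    rw [h1]
    split_ifs
    · simp
    · simp
    · exact card_pair (by omega)
  rcases Nat.even_or_odd' n with ⟨N, rfl | rfl⟩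
  · have hM : M = d * N + 0 := by linarith
    rw [hM, count_periodic hp, hfull, Nat.count_zero]
    split_ifs <;> omega
  · obtain ⟨e, rfl⟩ : ∃ e, d = 2 * e := by
      rcases Nat.even_or_odd' d with ⟨e, rfl | rfl⟩
      · exact ⟨e, rfl⟩
      · exfalso
        have : 2 * M = 2 * (2 * N * e + N + e) + 1 := by rw [h]; ring
        omega
    have hM : M = 2 * e * N + e := by linarith
    have hhalf : Nat.count (fun i => foldMod (2 * e) (i + 1) = c) e = if c = 0 then 0 else 1 := by
      rw [Nat.count_eq_card_filter_range]
      have h1 : {i ∈ range e | foldMod (2 * e) (i + 1) = c} = if c = 0 then ∅ else {c - 1} := by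
        ext i
        rw [mem_filter, mem_range]
        split_ifs <;> simp only [mem_singleton, notMem_empty, iff_false] <;> try constructor
        all_goals first
          | (rintro ⟨hi, h2⟩; rw [foldMod_of_le (by omega)] at h2; omega)
          | (intro hi; refine ⟨by omega, ?_⟩; rw [foldMod_of_le (by omega)]; omega)
      rw [h1]
      split_ifs <;> simp
    rw [hM, count_periodic hp, hfull, hhalf]
    split_ifs <;> omega

/-- The numbers of indices in the classes for the targets `1, 3, …, 2 M - 1` modulo `2 d`. -/
theorem count_foldMod_odd {d M n : ℕ} (hd : 0 < d) (h : 2 * M = n * d) {c : ℕ} (hc : c ≤ d) :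
    Nat.count (fun i => foldMod (2 * d) (2 * i + 1) = c) M =
      if Even c then 0 else if c = d then n / 2 else n := by
  have hp : ∀ k, foldMod (2 * d) (2 * (d + k) + 1) = c ↔ foldMod (2 * d) (2 * k + 1) = c :=
    fun k => by rw [mul_add, add_assoc, foldMod_add_left]
  simp only [Nat.even_iff]
  have hfull : Nat.count (fun i => foldMod (2 * d) (2 * i + 1) = c) d =
      if c % 2 = 0 then 0 else if c = d then 1 else 2 := by
    rw [Nat.count_eq_card_filter_range]
    have h1 : {i ∈ range d | foldMod (2 * d) (2 * i + 1) = c} =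
        if c % 2 = 0 then ∅ else if c = d then {c / 2} else {c / 2, d - c / 2 - 1} := by
      ext i
      rw [mem_filter, mem_range]
      split_ifs <;> simp only [mem_singleton, mem_insert, notMem_empty, iff_false] <;>
        try constructor
      all_goals first
        | (rintro ⟨hi, h2⟩; rw [foldMod_of_le (by omega)] at h2; omega)
        | (intro hi; refine ⟨by omega, ?_⟩; rw [foldMod_of_le (by omega)]; omega)
    rw [h1]
    split_ifs
    · simp
    · simp
    · exact card_pair (by omega)
  rcases Nat.even_or_odd' n with ⟨N, rfl | rfl⟩
  · have hM : M = d * N + 0 := by linarith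
    rw [hM, count_periodic hp, hfull, Nat.count_zero]
    split_ifs <;> omega
  · obtain ⟨e, rfl⟩ : ∃ e, d = 2 * e := by
      rcases Nat.even_or_odd' d with ⟨e, rfl | rfl⟩
      · exact ⟨e, rfl⟩
      · exfalso
        have : 2 * M = 2 * (2 * N * e + N + e) + 1 := by rw [h]; ring
        omega
    have hM : M = 2 * e * N + e := by linarith
    have hhalf : Nat.count (fun i => foldMod (2 * (2 * e)) (2 * i + 1) = c) e =
        if c % 2 = 0 then 0 else 1 := by
      rw [Nat.count_eq_card_filter_range]
      have h1 : {i ∈ range e | foldMod (2 * (2 * e)) (2 * i + 1) = c} =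
          if c % 2 = 0 then ∅ else {c / 2} := by
        ext i
        rw [mem_filter, mem_range]
        split_ifs <;> simp only [mem_singleton, notMem_empty, iff_false] <;> try constructor
        all_goals first
          | (rintro ⟨hi, h2⟩; rw [foldMod_of_le (by omega)] at h2; omega)
          | (intro hi; refine ⟨by omega, ?_⟩; rw [foldMod_of_le (by omega)]; omega)
      rw [h1]
      split_ifs <;> simp
    rw [hM, count_periodic hp, hfull, hhalf]
    split_ifs <;> omega

/-! ### The two families -/

theorem neg_one_pow_choose_two (n : ℕ) : (-1 : ℚ) ^ n.choose 2 = (-1) ^ (n / 2) := by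
  induction n using Nat.twoStepInduction with
  | zero => simp
  | one => simp
  | more n ih _ =>
    have h : (n + 2).choose 2 = n.choose 2 + 2 * n + 1 := by
      have h1 : (n + 2).choose 2 = (n + 1).choose 1 + (n + 1).choose 2 := Nat.choose_succ_succ' _ _
      have h2 : (n + 1).choose 2 = n.choose 1 + n.choose 2 := Nat.choose_succ_succ' _ _
      rw [Nat.choose_one_right] at h1 h2
      omega
    rw [h, show (n + 2) / 2 = n / 2 + 1 by omega, pow_succ, pow_add, pow_mul, ih]
    simp [pow_succ]

theorem neg_one_pow_choose_mul (a n : ℕ) :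
    (-1 : ℚ) ^ (a.choose 2 * n.choose 2) = ((-1) ^ (n / 2)) ^ (a / 2) := by
  rw [pow_mul, neg_one_pow_choose_two, ← pow_mul, mul_comm, pow_mul, neg_one_pow_choose_two]

theorem exists_mem_Icc_modEq {D a b k : ℕ} (hb : b < D) :
    (∃ r ∈ Icc a b, k ≡ r [MOD D]) ↔ a ≤ k % D ∧ k % D ≤ b := by
  constructor
  · rintro ⟨r, hr, h⟩
    rw [mem_Icc] at hr
    rw [Nat.ModEq, Nat.mod_eq_of_lt (lt_of_le_of_lt hr.2 hb)] at h
    omega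
  · intro h
    exact ⟨k % D, mem_Icc.2 h, (Nat.mod_modEq k D).symm⟩

theorem mod_two_of_odd {d k : ℕ} (hd : 0 < d) (hk : Odd k) :
    k % (2 * d) % 2 = 1 ∧ k % (2 * d) < 2 * d := by
  rw [Nat.mod_mod_of_dvd k (dvd_mul_right 2 d)]
  exact ⟨Nat.odd_iff.1 hk, Nat.mod_lt _ (by omega)⟩

theorem exists_mem_filter_odd_modEq {d a b k : ℕ} (hb : b < 2 * d) (hk : Odd k) :
    (∃ r ∈ {r ∈ Icc a b | Odd r}, k ≡ r [MOD 2 * d]) ↔ a ≤ k % (2 * d) ∧ k % (2 * d) ≤ b := by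
  rw [← exists_mem_Icc_modEq hb]
  constructor
  · rintro ⟨r, hr, h⟩
    exact ⟨r, (mem_filter.1 hr).1, h⟩
  · rintro ⟨r, hr, h⟩
    refine ⟨r, mem_filter.2 ⟨hr, ?_⟩, h⟩
    have h2 : k % 2 = r % 2 := h.of_mul_right d
    rw [Nat.odd_iff, ← h2, Nat.odd_iff.1 hk]

theorem card_filter_pos_two_mul_lt (d : ℕ) : #{c ∈ range d | 0 < c ∧ 2 * c < d} = (d - 1) / 2 := by
  have : {c ∈ range d | 0 < c ∧ 2 * c < d} = Icc 1 ((d - 1) / 2) := by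
    ext c
    rw [mem_filter, mem_range, mem_Icc]
    omega
  rw [this, Nat.card_Icc, Nat.add_sub_cancel]

theorem card_filter_odd (d : ℕ) : #{c ∈ range d | Odd c} = d / 2 := by
  induction d with
  | zero => rfl
  | succ d ih =>
    rw [range_add_one, filter_insert]
    split_ifs with h
    · rw [card_insert_of_notMem (by simp), ih]
      rw [Nat.odd_iff] at h
      omega
    · rw [ih]
      rw [Nat.odd_iff] at h
      omega

/-- The second family for given numbers of indices in the classes. -/
theorem sum_mixedSol {d m n N₀ N₁ : ℕ} (hd : 0 < d) {R : Finset ℕ}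
    (hR : ∀ k, (∃ r ∈ R, k ≡ r [MOD d]) ↔ d < 2 * (k % d)) (hn : Odd n → Even d)
    (hcount : ∀ c, 2 * c ≤ d → Nat.count (fun i => foldMod d (i + 1) = c) m =
      if c = 0 then N₀ else if 2 * c = d then N₁ else n) (hN₁ : Odd d → N₁ = 0)
    (hB : d * (2 * n ^ 2 * ((d - 1) / 2) + 4 * N₀ * (N₀ + 1) + 4 * N₁ ^ 2) = 4 * m * (m + 1))
    (x : ℕ) :
    ∑ p ∈ mixedSol d m (m * (m + 1) / 2 + x), residueSign d R p.1 *
        (∏ i with p.1 i % d = 0, (p.1 i : ℚ) ^ 3) * (∏ i with 2 * (p.1 i % d) = d, (p.1 i : ℚ)) *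
        pairProd d p.1 =
      (((-1) ^ (n / 2) * (d : ℚ) ^ (n * (n - 1)) * factorialProdBelow n ^ 2) ^ ((d - 1) / 2) *
        ((2 ^ N₀)⁻¹ * (d : ℚ) ^ (N₀ * (2 * N₀ + 1)) * factorialProdBelow (2 * N₀ + 1)) *
        ((2 ^ N₁)⁻¹ * (d : ℚ) ^ (N₁ * (2 * N₁ - 1)) * factorialProdBelow (2 * N₁))) *
      triangleNumDiv (4 * m * (m + 1) / d) x d := by
  have hcount' : ∀ c, 2 * c ≤ d → #{i : Fin m | foldMod d (i + 1) = c} =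
      if c = 0 then N₀ else if 2 * c = d then N₁ else n := fun c hc =>
    (card_filter_fin (fun i => foldMod d (i + 1) = c) m).trans (hcount c hc)
  have h8 : 8 * (m * (m + 1) / 2) = 4 * m * (m + 1) := by
    have := Nat.two_mul_div_two_of_even (Nat.even_mul_succ_self m)
    rw [mul_assoc]
    omega
  have key := sum_classSol_of_card hd (b := fun i : Fin m => foldMod d (i + 1))
    (A := {c ∈ range d | 0 < c ∧ 2 * c < d}) (n := n) (N₀ := N₀) (N₁ := N₁)
    (B := m * (m + 1) / 2) (fun i => foldMod_le d _) (fun c hc => (mem_filter.1 hc).2)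
    (fun h => ⟨hn h, fun c hc => ?_⟩) (fun c hc => ?_) (fun c h0 h1 hc => ?_) ?_
    (fun c h0 h1 => ?_) hN₁ (by rw [card_filter_pos_two_mul_lt, hB, h8]) x
  · rw [← hB, Nat.mul_div_cancel_left _ hd, mixedSol_eq hd]
    rw [card_filter_pos_two_mul_lt] at key
    exact (sum_congr rfl fun p _ => (classTerm_eq hd fun i => hR _).symm).trans key
  · rw [mem_filter, mem_range] at hc ⊢
    obtain ⟨e, rfl⟩ := hn h
    omega
  · obtain ⟨_, h0, h1⟩ := mem_filter.1 hc
    rw [hcount' c h1.le, if_neg h0.ne', if_neg h1.ne]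
  · exact absurd (mem_filter.2 ⟨mem_range.2 (by omega), h0, h1⟩) hc
  · rw [hcount' 0 (by omega), if_pos rfl]
  · rw [hcount' c h1.le, if_neg h0.ne', if_pos h1]

/-- The first family for given numbers of indices in the classes. -/
theorem sum_oddSol {d m n N₁ : ℕ} (hd : 0 < d) {R : Finset ℕ}
    (hR : ∀ k, Odd k → ((∃ r ∈ R, k ≡ r [MOD 2 * d]) ↔ d < k % (2 * d))) (hn : Odd n → Even d)
    (hcount : ∀ c, c ≤ d → Nat.count (fun i => foldMod (2 * d) (2 * i + 1) = c) m =
      if Even c then 0 else if c = d then N₁ else n) (hN₁ : Even d → N₁ = 0)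
    (hB : d * (2 * n ^ 2 * (d / 2) + 4 * N₁ ^ 2) = 4 * m ^ 2) (x : ℕ) :
    ∑ p ∈ oddSol d m (m ^ 2 + x), residueSign (2 * d) R p.1 *
        (∏ i with p.1 i % (2 * d) = d, (p.1 i : ℚ)) * pairProd (2 * d) p.1 =
      (((-1) ^ (n / 2) * (2 * d : ℚ) ^ (n * (n - 1)) * factorialProdBelow n ^ 2) ^ (d / 2) *
        ((2 ^ N₁)⁻¹ * (2 * d : ℚ) ^ (N₁ * (2 * N₁ - 1)) * factorialProdBelow (2 * N₁))) *
      triangleNumDiv (4 * m ^ 2 / d) x (2 * d) := by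
  have hd2 : 0 < 2 * d := by omega
  have hcount' : ∀ c, c ≤ d → #{i : Fin m | foldMod (2 * d) (2 * i + 1) = c} =
      if Even c then 0 else if c = d then N₁ else n := fun c hc =>
    (card_filter_fin (fun i => foldMod (2 * d) (2 * i + 1) = c) m).trans (hcount c hc)
  have key := sum_classSol_of_card hd2 (b := fun i : Fin m => foldMod (2 * d) (2 * i + 1))
    (A := {c ∈ range d | Odd c}) (n := n) (N₀ := 0) (N₁ := N₁) (B := m ^ 2)
    (fun i => foldMod_le (2 * d) _) (fun c hc => ?_)
    (fun h => ⟨even_two_mul d, fun c hc => ?_⟩) (fun c hc => ?_) (fun c h0 h1 hc => ?_) ?_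
    (fun c h0 h1 => ?_) (fun h => absurd h (by simp)) ?_ x
  · rw [oddSol_eq hd, ← hB, Nat.mul_div_cancel_left _ hd]
    rw [card_filter_odd] at key
    simp only [mul_zero, add_zero, pow_zero, inv_one, one_mul, mul_one, zero_add] at key
    rw [show factorialProdBelow 1 = 1 by simp [factorialProdBelow], mul_one] at key
    push_cast at key
    rw [← key]
    refine sum_congr rfl fun p hp => ?_
    rw [← oddSol_eq hd, oddSol, mem_filter] at hp
    have ho := fun i => mod_two_of_odd hd (hp.2.1 i).1
    rw [classTerm_eq hd2 (R := R) fun i => (hR _ (hp.2.1 i).1).trans (by omega)]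
    have e1 : ({i | p.1 i % (2 * d) = 0} : Finset (Fin m)) = ∅ :=
      filter_eq_empty_iff.2 fun i _ h => by
        have := ho i
        omega
    have e2 : filter (fun i => 2 * (p.1 i % (2 * d)) = 2 * d) univ =
        filter (fun i => p.1 i % (2 * d) = d) univ := filter_congr fun i _ => by omega
    rw [e1, e2, prod_empty, mul_one]
  · rw [mem_filter, mem_range, Nat.odd_iff] at hc
    omega
  · rw [mem_filter, mem_range, Nat.odd_iff] at hc ⊢
    obtain ⟨e, rfl⟩ := hn h
    omega
  · rw [mem_filter, mem_range] at hc
    rw [hcount' c hc.1.le, if_neg (Nat.not_even_iff_odd.2 hc.2), if_neg hc.1.ne]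
  · rw [hcount' c (by omega), if_pos]
    by_contra h
    exact hc (mem_filter.2 ⟨mem_range.2 (by omega), Nat.not_even_iff_odd.1 h⟩)
  · rw [hcount' 0 (by omega), if_pos (by simp)]
  · obtain rfl : c = d := by omega
    rw [hcount' c le_rfl]
    split_ifs with h h'
    · exact (hN₁ h).symm
    · rfl
    · exact absurd rfl h'
  · rw [card_filter_odd]
    linear_combination 2 * hB

/-- The first family for odd `d`: with `N = m / d`, the class of `d` modulo `2 d` contains `N`
indices and the other odd classes contain `2 N` each. -/
theorem oddFamily_odd {d m : ℕ} (x : ℕ) (hd : Odd d) (hm : d ∣ m) :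
    ∑ p ∈ oddSol d m (m ^ 2 + x),
        residueSign (2 * d) {r ∈ Icc (d + 2) (2 * d - 1) | Odd r} p.1 *
          (∏ i with p.1 i ≡ d [MOD 2 * d], (p.1 i : ℚ)) * pairProd (2 * d) p.1 =
      (-1) ^ ((d - 1) / 2 * (m / d)) *
        ((2 : ℚ) ^ (2 * m - d - 1) * (d : ℚ) ^ (2 * m - d)) ^ (m / d) *
        factorialProd ((2 * m - d) / d) d * triangleNumDiv (4 * m ^ 2 / d) x (2 * d) := by
  obtain ⟨N, rfl⟩ := hm
  have hd0 := hd.pos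
  have hd2 := Nat.odd_iff.1 hd
  have key := sum_oddSol (d := d) (m := d * N) (n := 2 * N) (N₁ := N) hd0
    (R := {r ∈ Icc (d + 2) (2 * d - 1) | Odd r}) (fun k hk => ?_)
    (fun h => absurd h (by simp)) (fun c hc => ?_) (fun h => absurd hd (Nat.not_odd_iff_even.2 h))
    ?_ x
  · have e1 : ∀ p : (Fin (d * N) → ℕ) × (Fin (d * N) → ℕ),
        filter (fun i => p.1 i ≡ d [MOD 2 * d]) univ = filter (fun i => p.1 i % (2 * d) = d) univ :=
      fun p => filter_congr fun i _ => by
        rw [Nat.ModEq, Nat.mod_eq_of_lt (by omega : d < 2 * d)]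
    simp only [e1]
    rw [key]
    congr 1
    obtain ⟨e, rfl⟩ := hd
    rcases N with _ | N
    · simp [factorialProd, factorialProdBelow]
    · have h1 : 2 * ((2 * e + 1) * (N + 1)) - (2 * e + 1) = (2 * e + 1) * (2 * N + 1) := by
        rw [Nat.sub_eq_iff_eq_add (by nlinarith)]; ring
      rw [Nat.mul_div_cancel_left _ hd0, h1, Nat.mul_div_cancel_left _ hd0, factorialProd_eq,
        show (2 * e + 1) * (2 * N + 1) - 1 = (2 * e + 1) * (2 * N) + 2 * e by
          rw [Nat.sub_eq_iff_eq_add (by nlinarith)]; ring,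
        show (2 * e + 1) / 2 = e by omega, show (2 * e + 1 - 1) / 2 = e by omega,
        show 2 * (N + 1) - 1 = 2 * N + 1 by omega, show 2 * (N + 1) / 2 = N + 1 by omega]
      rw [show 2 * N + 1 + 1 = 2 * (N + 1) by ring]
      generalize factorialProdBelow _ = F
      generalize ((2 * e + 1 : ℕ) : ℚ) = D
      generalize (-1 : ℚ) = s
      have h2 : (2 : ℚ) ≠ 0 := two_ne_zero
      generalize (2 : ℚ) = t at h2
      rw [inv_mul_eq_div, ← mul_div_right_comm, ← mul_div_assoc, div_eq_iff (pow_ne_zero _ h2)]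
      ring
  · rw [exists_mem_filter_odd_modEq (by omega) hk]
    have := mod_two_of_odd hd0 hk
    omega
  · rw [count_foldMod_odd hd0 (n := 2 * N) (by ring) hc, show 2 * N / 2 = N by omega]
  · obtain ⟨e, rfl⟩ := hd
    rw [show (2 * e + 1) / 2 = e by omega]
    ring

/-- The first family for even `d`: each odd class modulo `2 d` contains `2 m / d` indices. -/
theorem oddFamily_even {d m : ℕ} (x : ℕ) (hd0 : 0 < d) (hd : Even d) (hm : d ∣ 2 * m) :
    ∑ p ∈ oddSol d m (m ^ 2 + x),
        residueSign (2 * d) {r ∈ Icc (d + 1) (2 * d - 1) | Odd r} p.1 * pairProd (2 * d) p.1 =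
      (-1) ^ (d / 2 * (2 * m / d).choose 2) * (2 * d : ℚ) ^ ((2 * m - d) * m / d) *
        factorialProd ((2 * m - d) / d) d * triangleNumDiv (4 * m ^ 2 / d) x (2 * d) := by
  obtain ⟨n, hn⟩ := hm
  obtain ⟨e, rfl⟩ := even_iff_two_dvd.1 hd
  have hmn : m = n * e := by linarith
  have key := sum_oddSol (d := 2 * e) (m := m) (n := n) (N₁ := 0) hd0
    (R := {r ∈ Icc (2 * e + 1) (2 * (2 * e) - 1) | Odd r}) (fun k hk => ?_) (fun _ => hd)
    (fun c hc => ?_) (fun _ => rfl) ?_ x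
  · have e1 : ∀ p ∈ oddSol (2 * e) m (m ^ 2 + x),
        residueSign (2 * (2 * e)) {r ∈ Icc (2 * e + 1) (2 * (2 * e) - 1) | Odd r} p.1 *
          (∏ i with p.1 i % (2 * (2 * e)) = 2 * e, (p.1 i : ℚ)) * pairProd (2 * (2 * e)) p.1 =
        residueSign (2 * (2 * e)) {r ∈ Icc (2 * e + 1) (2 * (2 * e) - 1) | Odd r} p.1 *
          pairProd (2 * (2 * e)) p.1 := fun p hp => by
      rw [oddSol, mem_filter] at hp
      have e2 : filter (fun i => p.1 i % (2 * (2 * e)) = 2 * e) univ = ∅ :=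
        filter_eq_empty_iff.2 fun i _ h => by
          have := mod_two_of_odd hd0 (hp.2.1 i).1
          omega
      rw [e2, prod_empty, mul_one]
    rw [← sum_congr rfl e1, key]
    congr 1
    rw [hn, Nat.mul_div_cancel_left _ hd0, mul_comm (2 * e / 2), pow_mul (-1 : ℚ),
      neg_one_pow_choose_two]
    rcases n with _ | n
    · simp [factorialProd, factorialProdBelow, hmn]
    · have h1 : 2 * e * (n + 1) - 2 * e = 2 * e * n := by
        rw [Nat.sub_eq_iff_eq_add (by nlinarith)]; ring
      rw [h1, mul_assoc (2 * e), Nat.mul_div_cancel_left _ hd0, Nat.mul_div_cancel_left _ hd0,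
        factorialProd_eq, hmn, Nat.add_sub_cancel, show 2 * e / 2 = e by omega, mul_zero,
        factorialProdBelow_zero]
      generalize factorialProdBelow _ = F
      generalize (2 * ((2 * e : ℕ) : ℚ)) = D
      generalize (-1 : ℚ) = s
      simp only [pow_zero, zero_mul, inv_one, mul_one]
      rw [mul_pow, mul_pow, ← pow_mul, ← pow_mul, ← pow_mul, show n * ((n + 1) * e) =
        (n + 1) * n * e by ring]
  · rw [exists_mem_filter_odd_modEq (by omega) hk]
    have := mod_two_of_odd hd0 hk
    omega
  · rw [count_foldMod_odd hd0 (n := n) (by linarith) hc]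
    split_ifs with h1 h2
    · rfl
    · exact absurd (h2 ▸ hd) h1
    · rfl
  · rw [show 2 * e / 2 = e by omega, hmn]
    ring

theorem filter_modEq_zero {m d : ℕ} (k : Fin m → ℕ) :
    filter (fun i => k i ≡ 0 [MOD d]) univ = filter (fun i => k i % d = 0) univ :=
  filter_congr fun i _ => by rw [Nat.ModEq, Nat.zero_mod]

/-- The second family for odd `d`, for given numbers `N₀` of indices in the class of `0` and `n` in
the other classes. -/
theorem mixedFamily_odd_of_dvd {d m : ℕ} (x : ℕ) (hd : Odd d) {n N₀ : ℕ} (hn : Even n)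
    (hcount : ∀ c, 2 * c ≤ d → Nat.count (fun i => foldMod d (i + 1) = c) m =
      if c = 0 then N₀ else n)
    (hB : d * (2 * n ^ 2 * ((d - 1) / 2) + 4 * N₀ * (N₀ + 1)) = 4 * m * (m + 1)) :
    ∑ p ∈ mixedSol d m (m * (m + 1) / 2 + x),
        residueSign d (Icc ((d + 1) / 2) (d - 1)) p.1 *
          (∏ i with p.1 i ≡ 0 [MOD d], (p.1 i : ℚ) ^ 3) * pairProd d p.1 =
      (((-1) ^ (n / 2) * (d : ℚ) ^ (n * (n - 1)) * factorialProdBelow n ^ 2) ^ ((d - 1) / 2) *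
        ((2 ^ N₀)⁻¹ * (d : ℚ) ^ (N₀ * (2 * N₀ + 1)) * factorialProdBelow (2 * N₀ + 1))) *
        triangleNumDiv (4 * m * (m + 1) / d) x d := by
  have hd0 := hd.pos
  have hd2 := Nat.odd_iff.1 hd
  have key := sum_mixedSol (d := d) (m := m) (n := n) (N₀ := N₀) (N₁ := 0) hd0
    (R := Icc ((d + 1) / 2) (d - 1)) (fun k => ?_)
    (fun h => absurd hn (Nat.not_even_iff_odd.2 h)) (fun c hc => ?_) (fun _ => rfl)
    (by rw [← hB]; ring) x
  · simp only [pow_zero, zero_mul, mul_zero, inv_one, mul_one, factorialProdBelow_zero] at key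
    rw [← key]
    refine sum_congr rfl fun p _ => ?_
    have e2 : filter (fun i => 2 * (p.1 i % d) = d) univ = ∅ :=
      filter_eq_empty_iff.2 fun i _ h => by omega
    rw [e2, prod_empty, mul_one, filter_modEq_zero]
  · rw [exists_mem_Icc_modEq (by omega)]
    have := Nat.mod_lt k hd0
    omega
  · rw [hcount c hc]
    split_ifs <;> first | rfl | omega

/-- The second family for odd `d`: with `N = m / d` or `N + 1 = (m + 1) / d`, the class of `0`
contains `N` indices, and the other classes contain `2 N` or `2 (N + 1)` each. -/
theorem mixedFamily_odd {d m : ℕ} (x : ℕ) (hd : Odd d) {A : ℚ}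
    (hA : d ∣ m ∧ A = (-1) ^ ((d - 1).choose 2 * (2 * m / d).choose 2) * ((2 : ℚ) ^ (m / d))⁻¹ *
        ((2 * m / d).factorial : ℚ) * factorialProd ((2 * m - d) / d) d ∨
      d ∣ m + 1 ∧ A = (-1) ^ ((d - 1).choose 2 * (2 * (m + 1) / d).choose 2) *
        ((2 : ℚ) ^ ((m + 1 - d) / d))⁻¹ * (((2 * m + 2 - d) / d).factorial : ℚ)⁻¹ *
        factorialProd ((2 * m + 2 - d) / d) d) :
    ∑ p ∈ mixedSol d m (m * (m + 1) / 2 + x),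
        residueSign d (Icc ((d + 1) / 2) (d - 1)) p.1 *
          (∏ i with p.1 i ≡ 0 [MOD d], (p.1 i : ℚ) ^ 3) * pairProd d p.1 =
      A * (d : ℚ) ^ ((2 * m + 2 - d) * m / d) * triangleNumDiv (4 * m * (m + 1) / d) x d := by
  have hd0 := hd.pos
  rcases hA with ⟨⟨N, rfl⟩, rfl⟩ | ⟨⟨N, hN⟩, rfl⟩
  · rw [mixedFamily_odd_of_dvd x hd (n := 2 * N) (N₀ := N) (even_two_mul N) (fun c hc => ?_) ?_]
    · congr 1
      rw [neg_one_pow_choose_mul]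
      obtain ⟨e, rfl⟩ := hd
      rcases N with _ | N
      · simp [factorialProd, factorialProdBelow]
      · rw [show 2 * ((2 * e + 1) * (N + 1)) = (2 * e + 1) * (2 * (N + 1)) by ring,
          Nat.mul_div_cancel_left _ hd0, Nat.mul_div_cancel_left _ hd0,
          show (2 * e + 1) * (2 * (N + 1)) - (2 * e + 1) = (2 * e + 1) * (2 * N + 1) by
            rw [Nat.sub_eq_iff_eq_add (by nlinarith)]; ring,
          Nat.mul_div_cancel_left _ hd0, factorialProd_eq,
          show (2 * e + 1) * (2 * (N + 1)) + 2 - (2 * e + 1) = 4 * e * N + 2 * e + 2 * N + 3 by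
            rw [Nat.sub_eq_iff_eq_add (by nlinarith)]; ring,
          mul_left_comm (4 * e * N + 2 * e + 2 * N + 3), Nat.mul_div_cancel_left _ hd0,
          show (2 * e + 1 - 1) / 2 = e by omega, factorialProdBelow_succ (2 * (N + 1)),
          show 2 * (N + 1) - 1 = 2 * N + 1 by omega, show 2 * N + 1 + 1 = 2 * (N + 1) by ring]
        generalize factorialProdBelow _ = F
        generalize ((2 * e + 1 : ℕ) : ℚ) = D
        generalize ((2 * (N + 1)).factorial : ℚ) = f
        generalize (-1 : ℚ) = s
        generalize (2 : ℚ) = t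
        ring
    · obtain ⟨e, rfl⟩ := hd
      rw [show (2 * e + 1 - 1) / 2 = e by omega]
      ring
    · rw [count_foldMod_succ hd0 (n := 2 * N) (by ring) hc]
      have := Nat.odd_iff.1 hd
      split_ifs <;> omega
  · obtain ⟨N, rfl⟩ : ∃ N', N = N' + 1 := ⟨N - 1, by
      have : N ≠ 0 := by rintro rfl; omega
      omega⟩
    rw [mixedFamily_odd_of_dvd x hd (n := 2 * (N + 1)) (N₀ := N) (even_two_mul _) (fun c hc => ?_)
      ?_]
    · congr 1
      rw [neg_one_pow_choose_mul]
      obtain ⟨e, rfl⟩ := hd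
      have h1 : 2 * m + 2 = (2 * e + 1) * (2 * (N + 1)) := by linarith
      have h2 : m = 2 * e * N + 2 * e + N := by linarith
      rw [hN, show 2 * ((2 * e + 1) * (N + 1)) = (2 * e + 1) * (2 * (N + 1)) by ring,
        Nat.mul_div_cancel_left _ hd0, h1,
        show (2 * e + 1) * (N + 1) - (2 * e + 1) = (2 * e + 1) * N by
          rw [Nat.sub_eq_iff_eq_add (by nlinarith)]; ring,
        Nat.mul_div_cancel_left _ hd0,
        show (2 * e + 1) * (2 * (N + 1)) - (2 * e + 1) = (2 * e + 1) * (2 * N + 1) by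
          rw [Nat.sub_eq_iff_eq_add (by nlinarith)]; ring,
        Nat.mul_div_cancel_left _ hd0, factorialProd_eq, mul_assoc (2 * e + 1),
        Nat.mul_div_cancel_left _ hd0, h2,
        show (2 * e + 1 - 1) / 2 = e by omega,
        show 2 * (N + 1) - 1 = 2 * N + 1 by omega, show 2 * (N + 1) = 2 * N + 1 + 1 by ring,
        factorialProdBelow_succ (2 * N + 1)]
      have hf : ((2 * N + 1).factorial : ℚ) ≠ 0 := Nat.cast_ne_zero.2 (Nat.factorial_ne_zero _)
      generalize factorialProdBelow _ = F
      generalize ((2 * e + 1 : ℕ) : ℚ) = D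
      generalize ((2 * N + 1).factorial : ℚ) = f at hf
      rw [show (2 * N + 1 + 1) / 2 = N + 1 by omega]
      generalize (-1 : ℚ) = s
      generalize (2 : ℚ) = t
      field_simp
      ring
    · obtain ⟨e, rfl⟩ := hd
      rw [show (2 * e + 1 - 1) / 2 = e by omega, hN]
      have h2 : m = 2 * e * N + 2 * e + N := by linarith
      rw [h2]
      ring
    · -- the target `m + 1`, which is missing, lies in the class of `0`
      have h1 := count_foldMod_succ hd0 (M := m + 1) (n := 2 * (N + 1)) (by rw [hN]; ring) hc
      rw [Nat.count_succ, hN, foldMod, Nat.mul_mod_right, Nat.zero_min] at h1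
      have := Nat.odd_iff.1 hd
      split_ifs at h1 ⊢ <;> omega

/-- The second family for even `d`, for given numbers `N₀` and `N₁` of indices in the classes of `0`
and `d / 2` and `n` in the other classes. -/
theorem mixedFamily_even_of_dvd {d m : ℕ} (x : ℕ) (hd0 : 0 < d) (hd : Even d) {n N₀ N₁ : ℕ}
    (hcount : ∀ c, 2 * c ≤ d → Nat.count (fun i => foldMod d (i + 1) = c) m =
      if c = 0 then N₀ else if 2 * c = d then N₁ else n)
    (hB : d * (2 * n ^ 2 * ((d - 1) / 2) + 4 * N₀ * (N₀ + 1) + 4 * N₁ ^ 2) = 4 * m * (m + 1)) :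
    ∑ p ∈ mixedSol d m (m * (m + 1) / 2 + x),
        residueSign d (Icc ((d + 2) / 2) (d - 1)) p.1 *
          (∏ i with p.1 i ≡ 0 [MOD d], (p.1 i : ℚ) ^ 3) *
          (∏ i with p.1 i ≡ d / 2 [MOD d], (p.1 i : ℚ)) * pairProd d p.1 =
      (((-1) ^ (n / 2) * (d : ℚ) ^ (n * (n - 1)) * factorialProdBelow n ^ 2) ^ ((d - 1) / 2) *
        ((2 ^ N₀)⁻¹ * (d : ℚ) ^ (N₀ * (2 * N₀ + 1)) * factorialProdBelow (2 * N₀ + 1)) *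
        ((2 ^ N₁)⁻¹ * (d : ℚ) ^ (N₁ * (2 * N₁ - 1)) * factorialProdBelow (2 * N₁))) *
        triangleNumDiv (4 * m * (m + 1) / d) x d := by
  have hd2 := Nat.even_iff.1 hd
  have key := sum_mixedSol (d := d) (m := m) (n := n) (N₀ := N₀) (N₁ := N₁) hd0
    (R := Icc ((d + 2) / 2) (d - 1)) (fun k => ?_) (fun _ => hd) hcount
    (fun h => absurd hd (Nat.not_even_iff_odd.2 h)) hB x
  · rw [← key]
    refine sum_congr rfl fun p _ => ?_
    have e2 : filter (fun i => p.1 i ≡ d / 2 [MOD d]) univ =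
        filter (fun i => 2 * (p.1 i % d) = d) univ := filter_congr fun i _ => by
      rw [Nat.ModEq, Nat.mod_eq_of_lt (by omega : d / 2 < d)]
      omega
    rw [e2, filter_modEq_zero]
  · rw [exists_mem_Icc_modEq (by omega)]
    have := Nat.mod_lt k hd0
    omega

/-- The second family for even `d`: with `n = 2 m / d` or `n + 1 = (2 m + 2) / d`, the classes of
`0` and `d / 2` contain `⌊n / 2⌋` and `⌊(n + 1) / 2⌋` indices, and the other classes contain `n` or
`n + 1` each. -/
theorem mixedFamily_even {d m : ℕ} (x : ℕ) (hd0 : 0 < d) (hd : Even d) {B : ℚ}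
    (hB : d ∣ 2 * m ∧ B = (-1) ^ ((d - 1).choose 2 * (2 * m / d).choose 2) *
        ((2 : ℚ) ^ (2 * m / d))⁻¹ * ((2 * m / d).factorial : ℚ) *
        factorialProd ((2 * m - d) / d) d ∨
      d ∣ 2 * m + 2 ∧ B = (-1) ^ ((d - 1).choose 2 * (2 * (m + 1) / d).choose 2) *
        ((2 : ℚ) ^ ((2 * m + 2 - d) / d))⁻¹ * (((2 * m + 2 - d) / d).factorial : ℚ)⁻¹ *
        factorialProd ((2 * m + 2 - d) / d) d) :
    ∑ p ∈ mixedSol d m (m * (m + 1) / 2 + x),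
        residueSign d (Icc ((d + 2) / 2) (d - 1)) p.1 *
          (∏ i with p.1 i ≡ 0 [MOD d], (p.1 i : ℚ) ^ 3) *
          (∏ i with p.1 i ≡ d / 2 [MOD d], (p.1 i : ℚ)) * pairProd d p.1 =
      B * (d : ℚ) ^ ((2 * m + 2 - d) * m / d) * triangleNumDiv (4 * m * (m + 1) / d) x d := by
  obtain ⟨e, rfl⟩ : ∃ e, d = 2 * (e + 1) := by
    obtain ⟨e, rfl⟩ := even_iff_two_dvd.1 hd
    exact ⟨e - 1, by omega⟩
  have he : (2 * (e + 1) - 1) / 2 = e := by omega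
  rcases hB with ⟨⟨n, hn⟩, rfl⟩ | ⟨⟨n, hn⟩, rfl⟩
  · have hm : m = n * (e + 1) := by linarith
    rw [mixedFamily_even_of_dvd x hd0 hd (n := n) (N₀ := n / 2) (N₁ := (n + 1) / 2) (fun c hc =>
      count_foldMod_succ hd0 (by linarith) hc) ?_]
    · congr 1
      rw [neg_one_pow_choose_mul, hn, Nat.mul_div_cancel_left _ hd0, he]
      rcases n with _ | n
      · simp [factorialProd, factorialProdBelow, hm]
      · rw [show 2 * (e + 1) * (n + 1) - 2 * (e + 1) = 2 * (e + 1) * n by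
            rw [Nat.sub_eq_iff_eq_add (by nlinarith)]; ring,
          show 2 * (e + 1) * (n + 1) + 2 - 2 * (e + 1) = 2 * (e * n + n + 1) by
            rw [Nat.sub_eq_iff_eq_add (by nlinarith)]; ring, hm,
          show 2 * (e * n + n + 1) * ((n + 1) * (e + 1)) =
            2 * (e + 1) * ((e * n + n + 1) * (n + 1)) by ring,
          Nat.mul_div_cancel_left _ hd0, Nat.mul_div_cancel_left _ hd0, factorialProd_eq]
        generalize ((2 * (e + 1) : ℕ) : ℚ) = D
        generalize (-1 : ℚ) = s
        generalize (2 : ℚ) = t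
        rcases Nat.even_or_odd' n with ⟨N, rfl | rfl⟩
        · rw [show (2 * N + 1 + 1) / 2 = N + 1 by omega, show (2 * N + 1) / 2 = N by omega,
            show 2 * (N + 1) - 1 = 2 * N + 1 by omega, Nat.add_sub_cancel,
            show 2 * (N + 1) = 2 * N + 1 + 1 by ring, factorialProdBelow_succ (2 * N + 1)]
          generalize factorialProdBelow _ = F
          generalize ((2 * N + 1).factorial : ℚ) = f
          ring
        · rw [show (2 * N + 1 + 1 + 1) / 2 = N + 1 by omega,
            show (2 * N + 1 + 1) / 2 = N + 1 by omega,
            show 2 * (N + 1) - 1 = 2 * N + 1 by omega, Nat.add_sub_cancel,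
            show 2 * (N + 1) = 2 * N + 1 + 1 by ring, factorialProdBelow_succ (2 * N + 1 + 1)]
          generalize factorialProdBelow _ = F
          generalize ((2 * N + 1 + 1).factorial : ℚ) = f
          ring
    · rw [he, hm]
      rcases Nat.even_or_odd' n with ⟨N, rfl | rfl⟩
      · rw [show (2 * N + 1) / 2 = N by omega, show 2 * N / 2 = N by omega]
        ring
      · rw [show (2 * N + 1 + 1) / 2 = N + 1 by omega, show (2 * N + 1) / 2 = N by omega]
        ring
  · obtain ⟨n, rfl⟩ : ∃ n', n = n' + 1 := ⟨n - 1, by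
      have : n ≠ 0 := by rintro rfl; omega
      omega⟩
    have hm1 : m + 1 = (n + 1) * (e + 1) := by linarith
    have hm : m = e * n + n + e := by linarith
    rw [mixedFamily_even_of_dvd x hd0 hd (n := n + 1) (N₀ := n / 2) (N₁ := (n + 1) / 2)
      (fun c hc => ?_) ?_]
    · congr 1
      rw [neg_one_pow_choose_mul, show 2 * (m + 1) = 2 * (e + 1) * (n + 1) by linarith, hn,
        Nat.mul_div_cancel_left _ hd0, he,
        show 2 * (e + 1) * (n + 1) - 2 * (e + 1) = 2 * (e + 1) * n by
          rw [Nat.sub_eq_iff_eq_add (by nlinarith)]; ring, mul_assoc (2 * (e + 1)),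
        Nat.mul_div_cancel_left _ hd0, Nat.mul_div_cancel_left _ hd0, factorialProd_eq, hm]
      have hf : (n.factorial : ℚ) ≠ 0 := Nat.cast_ne_zero.2 (Nat.factorial_ne_zero _)
      generalize ((2 * (e + 1) : ℕ) : ℚ) = D
      generalize (-1 : ℚ) = s
      have h2 : (2 : ℚ) ≠ 0 := two_ne_zero
      generalize (2 : ℚ) = t at h2
      rw [factorialProdBelow_succ n]
      rcases Nat.even_or_odd' n with ⟨N, rfl | rfl⟩
      · rw [show (2 * N + 1) / 2 = N by omega, show 2 * N / 2 = N by omega, Nat.add_sub_cancel,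
          factorialProdBelow_succ (2 * N)]
        generalize factorialProdBelow _ = F
        generalize ((2 * N).factorial : ℚ) = f at hf
        rcases N with _ | N
        · simp
          field_simp
          ring
        · rw [show 2 * (N + 1) - 1 = 2 * N + 1 by omega]
          field_simp
          ring
      · rw [show (2 * N + 1 + 1) / 2 = N + 1 by omega, show (2 * N + 1) / 2 = N by omega,
          show 2 * (N + 1) - 1 = 2 * N + 1 by omega, Nat.add_sub_cancel,
          show 2 * (N + 1) = 2 * N + 1 + 1 by ring, factorialProdBelow_succ (2 * N + 1)]
        generalize factorialProdBelow _ = F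
        generalize ((2 * N + 1).factorial : ℚ) = f at hf
        field_simp
        ring
    · rw [he, hm1, hm]
      rcases Nat.even_or_odd' n with ⟨N, rfl | rfl⟩
      · rw [show (2 * N + 1) / 2 = N by omega, show 2 * N / 2 = N by omega]
        ring
      · rw [show (2 * N + 1 + 1) / 2 = N + 1 by omega, show (2 * N + 1) / 2 = N by omega]
        ring
    · -- the target `m + 1`, which is missing, lies in the class of `0` or of `d / 2`
      have h1 := count_foldMod_succ hd0 (M := m + 1) (n := n + 1) (by linarith) hc
      have h3 : foldMod (2 * (e + 1)) (m + 1) = if n % 2 = 1 then 0 else e + 1 := by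
        rcases Nat.even_or_odd' n with ⟨N, rfl | rfl⟩
        · rw [foldMod, hm1, show (2 * N + 1) * (e + 1) = 2 * (e + 1) * N + (e + 1) by ring,
            Nat.mul_add_mod, Nat.mod_eq_of_lt (by omega)]
          split_ifs <;> omega
        · rw [foldMod, hm1, show (2 * N + 1 + 1) * (e + 1) = 2 * (e + 1) * (N + 1) by ring,
            Nat.mul_mod_right]
          split_ifs <;> omega
      rw [Nat.count_succ, h3] at h1
      split_ifs at h1 ⊢ <;> omega

/-! ### Distinct classes: the analogues of the Getz–Mahlburg identity -/

theorem pairProd_eq_one {D : ℕ} (hD : 0 < D) {m : ℕ} {k : Fin m → ℕ}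
    (h : ∀ i j, i < j → foldMod D (k i) ≠ foldMod D (k j)) : pairProd D k = 1 := by
  rw [pairProd_eq hD]
  exact prod_eq_one fun i _ => prod_eq_one fun j _ => if_neg fun h' => h i j h'.1 h'.2

/-- In the class of `s` the integers congruent to `-s` are those with residue above `D / 2`. -/
theorem modEq_neg_iff {D s k : ℕ} (h0 : 0 < s) (h1 : 2 * s < D) (h : foldMod D k = s) :
    (k : ℤ) ≡ -s [ZMOD D] ↔ D < 2 * (k % D) := by
  have hk := Nat.mod_lt k (by omega : 0 < D)
  rw [foldMod] at h
  have h2 : (-(s : ℤ)) % D = ((D - s : ℕ) : ℤ) := by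
    rw [← Int.add_emod_right, Int.emod_eq_of_lt (by omega) (by omega)]
    omega
  rw [Int.ModEq, h2, ← Int.natCast_mod]
  omega

/-- The case `d = 2 m` of the first family, in which each class contains one index only and the
products over pairs are empty. -/
theorem getzMahlburg {m : ℕ} (x : ℕ) (hm : 0 < m) :
    ∑ p ∈ posSol m (m ^ 2 + x) with (∀ i, Odd (p.1 i) ∧ Odd (p.2 i)) ∧
          ∀ i : Fin m, CongrPM (4 * m) (p.1 i) (2 * (i : ℤ) + 1),
        (-1 : ℚ) ^ #{i : Fin m | (p.1 i : ℤ) ≡ 1 - 2 * ((i : ℤ) + 1) [ZMOD 4 * m]} =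
      triangleNumDiv (2 * m) x (4 * m) := by
  have h0 : 0 < 2 * m := by omega
  have h4 : 0 < 2 * (2 * m) := by omega
  have key := oddFamily_even (d := 2 * m) (m := m) x h0 (even_two_mul m) dvd_rfl
  have hc : ∀ (k : ℕ) (i : Fin m), CongrPM (4 * m) k (2 * (i : ℤ) + 1) ↔
      foldMod (2 * (2 * m)) k = 2 * i + 1 := fun k i => by
    have h1 := congrPM_iff h4 k (2 * i + 1)
    rw [foldMod_of_le (k := 2 * (i : ℕ) + 1) (by omega),
      min_eq_left (by omega : 2 * (i : ℕ) + 1 ≤ 2 * (2 * m) - (2 * i + 1))] at h1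
    rw [← h1]
    push_cast
    rw [show (2 * (2 * m) : ℤ) = 4 * m by ring]
  have hset : oddSol (2 * m) m (m ^ 2 + x) =
      {p ∈ posSol m (m ^ 2 + x) | (∀ i, Odd (p.1 i) ∧ Odd (p.2 i)) ∧
        ∀ i : Fin m, CongrPM (4 * m) (p.1 i) (2 * (i : ℤ) + 1)} := by
    rw [oddSol]
    refine filter_congr fun p _ => and_congr_right fun _ => ?_
    have e4 : (2 * ((2 * m : ℕ) : ℤ)) = 4 * m := by push_cast; ring
    rw [e4]
    refine and_iff_left_of_imp fun h i j hij hc' => ?_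
    rw [congrPM_iff h4, (hc _ _).1 (h i), (hc _ _).1 (h j)] at hc'
    exact absurd hij (by rw [Fin.lt_def]; omega)
  rw [hset, Nat.div_self h0, Nat.sub_self, zero_mul, Nat.zero_div,
    show 4 * m ^ 2 / (2 * m) = 2 * m by
      rw [show 4 * m ^ 2 = 2 * m * (2 * m) by ring, Nat.mul_div_cancel_left _ h0]] at key
  simp only [show Nat.choose 1 2 = 0 from rfl, mul_zero, pow_zero, one_mul] at key
  rw [show factorialProd 0 (2 * m) = 1 by simp [factorialProd], one_mul,
    show 2 * (2 * m) = 4 * m by ring] at key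
  rw [← key]
  refine sum_congr rfl fun p hp => ?_
  rw [show 4 * m = 2 * (2 * m) by ring]
  obtain ⟨_, ho, hcp⟩ := mem_filter.1 hp
  have hf : ∀ i, foldMod (2 * (2 * m)) (p.1 i) = 2 * i + 1 := fun i => (hc _ _).1 (hcp i)
  rw [pairProd_eq_one h4 fun i j hij => by rw [hf, hf]; rw [Fin.lt_def] at hij; omega, mul_one,
    residueSign]
  congr 2
  refine filter_congr fun i _ => ?_
  have h1 := modEq_neg_iff (by omega) (by omega) (hf i)
  have h2 := mod_two_of_odd h0 (ho i).1
  rw [exists_mem_filter_odd_modEq (by omega) (ho i).1]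
  push_cast at h1
  rw [show (1 - 2 * (((i : ℕ) : ℤ) + 1)) = -(2 * (i : ℤ) + 1) by ring,
    show (4 * (m : ℤ)) = 2 * (2 * m) by ring, h1]
  omega

/-- The case `d = 2 m + 2` of the second family, in which each class contains at most one index. -/
theorem getzMahlburg_mixed (m x : ℕ) :
    ∑ p ∈ posSol m (m * (m + 1) / 2 + x) with (∀ i, Odd (p.2 i)) ∧
          ∀ i : Fin m, CongrPM (2 * m + 2) (p.1 i) ((i : ℤ) + 1),
        (-1 : ℚ) ^ #{i : Fin m | (p.1 i : ℤ) ≡ -((i : ℤ) + 1) [ZMOD 2 * m + 2]} =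
      triangleNumDiv (2 * m) x (2 * m + 2) := by
  have h0 : 0 < 2 * m + 2 := by omega
  have key := mixedFamily_even (d := 2 * m + 2) (m := m) x h0 ⟨m + 1, by ring⟩
    (Or.inr ⟨dvd_rfl, rfl⟩)
  have hc : ∀ (k : ℕ) (i : Fin m), CongrPM (2 * m + 2) k ((i : ℤ) + 1) ↔
      foldMod (2 * m + 2) k = i + 1 := fun k i => by
    have h1 := congrPM_iff h0 k (i + 1)
    rw [foldMod_of_le (k := (i : ℕ) + 1) (by omega),
      min_eq_left (by omega : (i : ℕ) + 1 ≤ 2 * m + 2 - (i + 1))] at h1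
    rw [← h1]
    push_cast
    rfl
  have hset : mixedSol (2 * m + 2) m (m * (m + 1) / 2 + x) =
      {p ∈ posSol m (m * (m + 1) / 2 + x) | (∀ i, Odd (p.2 i)) ∧
        ∀ i : Fin m, CongrPM (2 * m + 2) (p.1 i) ((i : ℤ) + 1)} := by
    rw [mixedSol]
    refine filter_congr fun p _ => and_congr_right fun _ => ?_
    have e4 : ((2 * m + 2 : ℕ) : ℤ) = 2 * m + 2 := by push_cast; ring
    rw [e4]
    refine and_iff_left_of_imp fun h i j hij hc' => ?_
    rw [congrPM_iff h0, (hc _ _).1 (h i), (hc _ _).1 (h j)] at hc'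
    exact absurd hij (by rw [Fin.lt_def]; omega)
  rw [hset, show 2 * (m + 1) = 2 * m + 2 by ring, Nat.div_self h0, Nat.sub_self, zero_mul,
    Nat.zero_div, show 4 * m * (m + 1) / (2 * m + 2) = 2 * m by
      rw [show 4 * m * (m + 1) = (2 * m + 2) * (2 * m) by ring, Nat.mul_div_cancel_left _ h0]]
    at key
  simp only [show Nat.choose 1 2 = 0 from rfl, mul_zero, pow_zero, one_mul, Nat.factorial_zero,
    Nat.cast_one, inv_one] at key
  rw [show factorialProd 0 (2 * m + 2) = 1 by simp [factorialProd], one_mul, one_mul] at key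
  rw [← key]
  refine sum_congr rfl fun p hp => ?_
  obtain ⟨_, ho, hcp⟩ := mem_filter.1 hp
  have hf : ∀ i, foldMod (2 * m + 2) (p.1 i) = i + 1 := fun i => (hc _ _).1 (hcp i)
  have e1 : filter (fun i => p.1 i ≡ 0 [MOD 2 * m + 2]) univ = ∅ :=
    filter_eq_empty_iff.2 fun i _ h => by
      have := hf i
      rw [Nat.ModEq, Nat.zero_mod] at h
      rw [foldMod, h] at this
      omega
  have e2 : filter (fun i => p.1 i ≡ (2 * m + 2) / 2 [MOD 2 * m + 2]) univ = ∅ :=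
    filter_eq_empty_iff.2 fun i _ h => by
      have := hf i
      rw [Nat.ModEq, Nat.mod_eq_of_lt (by omega : (2 * m + 2) / 2 < 2 * m + 2)] at h
      rw [foldMod, h] at this
      omega
  rw [pairProd_eq_one h0 fun i j hij => by rw [hf, hf]; rw [Fin.lt_def] at hij; omega, mul_one,
    e1, e2, prod_empty, prod_empty, mul_one, mul_one, residueSign]
  congr 2
  refine filter_congr fun i _ => ?_
  have h1 := modEq_neg_iff (by omega) (by omega) (hf i)
  have h2 := Nat.mod_lt (p.1 i) h0
  rw [exists_mem_Icc_modEq (by omega)]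
  push_cast at h1
  rw [h1]
  omega

/-! ### Sums of 4, 6, 8 and 12 triangles -/

theorem triangleNumDiv_mul {d : ℕ} (hd : 0 < d) (k n : ℕ) :
    triangleNumDiv k (d * n) d = triangleNum k n := by
  rw [triangleNumDiv, if_pos (Dvd.intro n rfl), Nat.mul_div_cancel_left _ hd]

/-- The case `m = 2` of `getzMahlburg_mixed`. -/
theorem triangleNum_four (n : ℕ) : (triangleNum 4 n : ℚ) =
    ∑ p ∈ posSol 2 (6 * n + 3) with (∀ i, Odd (p.2 i)) ∧
        CongrPM 6 (p.1 0) 1 ∧ CongrPM 6 (p.1 1) 2,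
      (-1 : ℚ) ^ ((if (p.1 0 : ℤ) ≡ -1 [ZMOD 6] then 1 else 0) +
        (if (p.1 1 : ℤ) ≡ -2 [ZMOD 6] then 1 else 0)) := by
  have key := getzMahlburg_mixed 2 (6 * n)
  rw [triangleNumDiv_mul (by norm_num)] at key
  norm_num at key
  rw [← key, add_comm 3]
  refine sum_congr (filter_congr fun p _ => ?_) fun p _ => ?_
  · rw [Fin.forall_fin_two]
  · rw [card_filter, Fin.sum_univ_two]
    norm_num

theorem residueSign_two (D : ℕ) (R : Finset ℕ) (k : Fin 2 → ℕ) :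
    residueSign D R k = (if ∃ r ∈ R, k 0 ≡ r [MOD D] then -1 else 1) *
      if ∃ r ∈ R, k 1 ≡ r [MOD D] then -1 else 1 := by
  rw [residueSign, card_filter, Fin.sum_univ_two, pow_add]
  split_ifs <;> simp

theorem pairProd_two (D : ℕ) (k : Fin 2 → ℕ) :
    pairProd D k = (if (k 0 : ℤ) ≡ k 1 [ZMOD D] then ((k 1 : ℚ) - k 0) ^ 2 else 1) *
      if (k 0 : ℤ) ≡ -k 1 [ZMOD D] then ((k 1 : ℚ) + k 0) ^ 2 else 1 := by
  simp [pairProd, prod_filter, Fintype.prod_prod_type, Fin.prod_univ_two]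

/-- The case `d = 4`, `m = 2` of the second family. -/
theorem triangleNum_six (n : ℕ) : (triangleNum 6 n : ℚ) =
    1 / 2 * ∑ p ∈ posSol 2 (4 * n + 3) with (∀ i, Odd (p.2 i)) ∧
        Odd (p.1 0) ∧ p.1 1 ≡ 2 [MOD 4],
      (-1 : ℚ) ^ ((p.1 0 - 1) / 2) * (p.1 1 : ℚ) := by
  have key := mixedFamily_even (d := 4) (m := 2) (4 * n) (by norm_num) (by decide)
    (Or.inl ⟨by norm_num, rfl⟩)
  rw [triangleNumDiv_mul (by norm_num)] at key
  norm_num [factorialProd] at key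
  have hset : mixedSol 4 2 (3 + 4 * n) = {p ∈ posSol 2 (4 * n + 3) | (∀ i, Odd (p.2 i)) ∧
        Odd (p.1 0) ∧ p.1 1 ≡ 2 [MOD 4]} := by
    rw [mixedSol, add_comm 3]
    refine filter_congr fun p _ => and_congr_right fun _ => ?_
    simp only [OrderedMod, CongrPM, Fin.forall_fin_two, Int.ModEq, Nat.ModEq, Nat.odd_iff]
    norm_num
    omega
  have hterm : ∀ p ∈ mixedSol 4 2 (3 + 4 * n), residueSign 4 {3} p.1 *
      (∏ i with p.1 i ≡ 0 [MOD 4], (p.1 i : ℚ) ^ 3) *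
      (∏ i with p.1 i ≡ 2 [MOD 4], (p.1 i : ℚ)) * pairProd 4 p.1 =
      (-1 : ℚ) ^ ((p.1 0 - 1) / 2) * (p.1 1 : ℚ) := fun p hp => by
    rw [hset] at hp
    obtain ⟨_, _, h0, h1⟩ := mem_filter.1 hp
    rw [residueSign_two, pairProd_two, prod_filter, prod_filter, Fin.prod_univ_two,
      Fin.prod_univ_two]
    have h1' : p.1 1 % 4 = 2 := h1
    have h2 : p.1 0 % 4 = 1 ∨ p.1 0 % 4 = 3 := by rw [Nat.odd_iff] at h0; omega
    simp only [mem_singleton, exists_eq_left]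
    rw [if_neg (by rw [Nat.ModEq]; omega : ¬p.1 1 ≡ 3 [MOD 4]),
      if_neg (by rw [Nat.ModEq]; omega : ¬p.1 0 ≡ 0 [MOD 4]),
      if_neg (by rw [Nat.ModEq]; omega : ¬p.1 1 ≡ 0 [MOD 4]),
      if_neg (by rw [Nat.ModEq]; omega : ¬p.1 0 ≡ 2 [MOD 4]), if_pos h1,
      if_neg (by rw [Int.ModEq]; omega : ¬(p.1 0 : ℤ) ≡ p.1 1 [ZMOD (4 : ℕ)]),
      if_neg (by rw [Int.ModEq]; omega : ¬(p.1 0 : ℤ) ≡ -p.1 1 [ZMOD (4 : ℕ)])]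
    rcases h2 with h2 | h2
    · rw [if_neg (by rw [Nat.ModEq]; omega), show (p.1 0 - 1) / 2 = 2 * (p.1 0 / 4) by omega,
        pow_mul]
      norm_num
    · rw [if_pos (by exact h2), show (p.1 0 - 1) / 2 = 2 * (p.1 0 / 4) + 1 by omega, pow_succ,
        pow_mul]
      norm_num
  rw [← hset, ← sum_congr rfl hterm, key]
  ring

/-- The case `d = 2`, `m = 2` of the second family. -/
theorem triangleNum_twelve (n : ℕ) : (triangleNum 12 n : ℚ) =
    1 / 2 ^ 3 * ∑ p ∈ posSol 2 (2 * n + 3) with (∀ i, Odd (p.2 i)) ∧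
        Odd (p.1 0) ∧ Even (p.1 1),
      (p.1 0 : ℚ) * (p.1 1 : ℚ) ^ 3 := by
  have key := mixedFamily_even (d := 2) (m := 2) (2 * n) (by norm_num) (by decide)
    (Or.inl ⟨by norm_num, rfl⟩)
  rw [triangleNumDiv_mul (by norm_num)] at key
  norm_num [factorialProd] at key
  have hset : mixedSol 2 2 (3 + 2 * n) = {p ∈ posSol 2 (2 * n + 3) | (∀ i, Odd (p.2 i)) ∧
        Odd (p.1 0) ∧ Even (p.1 1)} := by
    rw [mixedSol, add_comm 3]
    refine filter_congr fun p _ => and_congr_right fun _ => ?_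
    simp only [OrderedMod, CongrPM, Fin.forall_fin_two, Int.ModEq, Nat.odd_iff, Nat.even_iff]
    norm_num
    omega
  have hterm : ∀ p ∈ mixedSol 2 2 (3 + 2 * n), residueSign 2 ∅ p.1 *
      (∏ i with p.1 i ≡ 0 [MOD 2], (p.1 i : ℚ) ^ 3) *
      (∏ i with p.1 i ≡ 1 [MOD 2], (p.1 i : ℚ)) * pairProd 2 p.1 =
      (p.1 0 : ℚ) * (p.1 1 : ℚ) ^ 3 := fun p hp => by
    rw [hset] at hp
    obtain ⟨_, _, h0, h1⟩ := mem_filter.1 hp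
    rw [residueSign_two, pairProd_two, prod_filter, prod_filter, Fin.prod_univ_two,
      Fin.prod_univ_two]
    rw [Nat.odd_iff] at h0
    rw [Nat.even_iff] at h1
    simp only [notMem_empty, false_and, exists_false, if_false]
    rw [if_neg (by rw [Nat.ModEq]; omega : ¬p.1 0 ≡ 0 [MOD 2]), if_pos (by exact h1),
      if_pos (by exact h0),
      if_neg (by rw [Nat.ModEq]; omega : ¬p.1 1 ≡ 1 [MOD 2]),
      if_neg (by rw [Int.ModEq]; omega : ¬(p.1 0 : ℤ) ≡ p.1 1 [ZMOD (2 : ℕ)]),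
      if_neg (by rw [Int.ModEq]; omega : ¬(p.1 0 : ℤ) ≡ -p.1 1 [ZMOD (2 : ℕ)])]
    ring
  rw [← hset, ← sum_congr rfl hterm, key]
  ring

/-- Exchanging the two pairs. -/
def swapPairs (p : (Fin 2 → ℕ) × (Fin 2 → ℕ)) : (Fin 2 → ℕ) × (Fin 2 → ℕ) :=
  (![p.1 1, p.1 0], ![p.2 1, p.2 0])

theorem swapPairs_swapPairs (p : (Fin 2 → ℕ) × (Fin 2 → ℕ)) : swapPairs (swapPairs p) = p := by
  refine Prod.ext (funext fun i => ?_) (funext fun i => ?_) <;> fin_cases i <;> rfl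

theorem swapPairs_mem {N : ℕ} {p : (Fin 2 → ℕ) × (Fin 2 → ℕ)} (hp : p ∈ posSol 2 N) :
    swapPairs p ∈ posSol 2 N := by
  rw [mem_posSol, Fin.forall_fin_two, Fin.sum_univ_two] at hp ⊢
  exact ⟨⟨hp.1.2, hp.1.1⟩, (add_comm _ _).trans hp.2⟩

/-- A symmetric sum over pairs is twice the sum over the pairs in increasing order. -/
theorem sum_eq_two_mul_sum_lt {N : ℕ} {P : (Fin 2 → ℕ) × (Fin 2 → ℕ) → Prop} [DecidablePred P]
    {f : (Fin 2 → ℕ) × (Fin 2 → ℕ) → ℚ} (hP : ∀ p, P p → P (swapPairs p))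
    (hf : ∀ p, P p → f (swapPairs p) = f p) (hd : ∀ p, P p → p.1 0 = p.1 1 → f p = 0) :
    ∑ p ∈ posSol 2 N with P p, f p = 2 * ∑ p ∈ posSol 2 N with P p ∧ p.1 0 < p.1 1, f p := by
  have h1 : ∑ p ∈ posSol 2 N with P p ∧ p.1 1 < p.1 0, f p =
      ∑ p ∈ posSol 2 N with P p ∧ p.1 0 < p.1 1, f p := by
    refine sum_nbij' swapPairs swapPairs (fun p hp => ?_) (fun p hp => ?_)
      (fun p _ => swapPairs_swapPairs p) (fun p _ => swapPairs_swapPairs p)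
      fun p hp => (hf p (mem_filter.1 hp).2.1).symm
    all_goals
      obtain ⟨h, hP', hlt⟩ := mem_filter.1 hp
      exact mem_filter.2 ⟨swapPairs_mem h, hP _ hP', hlt⟩
  rw [two_mul]
  nth_rw 2 [← h1]
  simp only [sum_filter]
  rw [← sum_add_distrib]
  refine sum_congr rfl fun p _ => ?_
  by_cases h : P p
  · rcases lt_trichotomy (p.1 0) (p.1 1) with h' | h' | h'
    · simp [h, h', h'.not_gt]
    · simp [h, h', hd p h h']
    · simp [h, h', h'.not_gt]
  · simp [h]

/-- The square `(k₁ + k₂) ^ 2` if `k₁ ≡ - k₂` modulo `D`, and `-(k₁ - k₂) ^ 2` otherwise. -/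
def signedSquare (D : ℤ) (p : (Fin 2 → ℕ) × (Fin 2 → ℕ)) : ℚ :=
  if (p.1 0 : ℤ) ≡ -p.1 1 [ZMOD D] then ((p.1 0 : ℚ) + p.1 1) ^ 2 else -((p.1 0 : ℚ) - p.1 1) ^ 2

theorem signedSquare_swapPairs (D : ℤ) (p : (Fin 2 → ℕ) × (Fin 2 → ℕ)) :
    signedSquare D (swapPairs p) = signedSquare D p := by
  have h : (p.1 1 : ℤ) ≡ -p.1 0 [ZMOD D] ↔ (p.1 0 : ℤ) ≡ -p.1 1 [ZMOD D] := by
    rw [Int.modEq_comm, Int.modEq_iff_dvd, Int.modEq_comm, Int.modEq_iff_dvd]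
    ring_nf
  simp only [signedSquare, swapPairs, Matrix.cons_val_zero, Matrix.cons_val_one, h]
  split_ifs <;> ring

theorem signedSquare_eq_zero {D : ℤ} {p : (Fin 2 → ℕ) × (Fin 2 → ℕ)} (h : p.1 0 = p.1 1)
    (hD : ¬(p.1 0 : ℤ) ≡ -p.1 1 [ZMOD D]) : signedSquare D p = 0 := by
  rw [signedSquare, if_neg hD, h]
  ring

/-- The case `d = 2`, `m = 2` of the first family. Both indices lie in the class of `1` modulo `4`,
and the condition `k₁ < k₂` is removed by symmetry. -/
theorem triangleNum_eight_odd (n : ℕ) : (triangleNum 8 n : ℚ) =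
    1 / 2 ^ 5 *
      (∑ p ∈ posSol 2 (4 * n + 4) with (∀ i, Odd (p.1 i) ∧ Odd (p.2 i)) ∧
          (p.1 0 : ℤ) ≡ -p.1 1 [ZMOD 4], ((p.1 0 : ℚ) + p.1 1) ^ 2 -
        ∑ p ∈ posSol 2 (4 * n + 4) with (∀ i, Odd (p.1 i) ∧ Odd (p.2 i)) ∧
          (p.1 0 : ℤ) ≡ p.1 1 [ZMOD 4], ((p.1 0 : ℚ) - p.1 1) ^ 2) := by
  have key := oddFamily_even (d := 2) (m := 2) (4 * n) (by norm_num) (by decide) (by norm_num)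
  rw [triangleNumDiv_mul (by norm_num)] at key
  norm_num [factorialProd] at key
  have hodd : ∀ p : (Fin 2 → ℕ) × (Fin 2 → ℕ), (∀ i, Odd (p.1 i) ∧ Odd (p.2 i)) →
      p.1 0 % 2 = 1 ∧ p.1 1 % 2 = 1 := fun p hp =>
    ⟨Nat.odd_iff.1 (hp 0).1, Nat.odd_iff.1 (hp 1).1⟩
  have h1 : ∑ p ∈ posSol 2 (4 * n + 4) with (∀ i, Odd (p.1 i) ∧ Odd (p.2 i)) ∧
          (p.1 0 : ℤ) ≡ -p.1 1 [ZMOD 4], ((p.1 0 : ℚ) + p.1 1) ^ 2 -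
        ∑ p ∈ posSol 2 (4 * n + 4) with (∀ i, Odd (p.1 i) ∧ Odd (p.2 i)) ∧
          (p.1 0 : ℤ) ≡ p.1 1 [ZMOD 4], ((p.1 0 : ℚ) - p.1 1) ^ 2 =
      ∑ p ∈ posSol 2 (4 * n + 4) with ∀ i, Odd (p.1 i) ∧ Odd (p.2 i), signedSquare 4 p := by
    rw [sum_filter, sum_filter, sum_filter, ← sum_sub_distrib]
    refine sum_congr rfl fun p _ => ?_
    by_cases h : ∀ i, Odd (p.1 i) ∧ Odd (p.2 i)
    · have := hodd p h
      rw [if_pos h, signedSquare]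
      by_cases h' : (p.1 0 : ℤ) ≡ -p.1 1 [ZMOD 4]
      · rw [if_pos ⟨h, h'⟩, if_neg fun h'' => by
          have := h''.2
          rw [Int.ModEq] at this h'
          omega, if_pos h', sub_zero]
      · rw [if_neg fun h'' => h' h''.2, if_pos ⟨h, by rw [Int.ModEq] at h' ⊢; omega⟩, if_neg h',
          zero_sub]
    · rw [if_neg h, if_neg fun h' => h h'.1, if_neg fun h' => h h'.1, sub_zero]
  have h2 := sum_eq_two_mul_sum_lt (N := 4 * n + 4)
    (P := fun p => ∀ i, Odd (p.1 i) ∧ Odd (p.2 i)) (f := signedSquare 4)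
    (fun p hp => Fin.forall_fin_two.2 ⟨hp 1, hp 0⟩) (fun p _ => signedSquare_swapPairs 4 p)
    fun p hp h => signedSquare_eq_zero h (by have := hodd p hp; rw [Int.ModEq]; omega)
  have h3 : oddSol 2 2 (4 + 4 * n) =
      {p ∈ posSol 2 (4 * n + 4) | (∀ i, Odd (p.1 i) ∧ Odd (p.2 i)) ∧ p.1 0 < p.1 1} := by
    rw [oddSol, add_comm 4]
    refine filter_congr fun p _ => and_congr_right fun h => ?_
    have := hodd p h
    simp only [OrderedMod, CongrPM, Fin.forall_fin_two, Int.ModEq]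
    norm_num
    omega
  have h4 : ∀ p ∈ oddSol 2 2 (4 + 4 * n),
      residueSign 4 {r ∈ ({3} : Finset ℕ) | Odd r} p.1 * pairProd 4 p.1 =
        -signedSquare 4 p := fun p hp => by
    rw [h3] at hp
    have := hodd p (mem_filter.1 hp).2.1
    have e : ({r ∈ ({3} : Finset ℕ) | Odd r}) = {3} := by decide
    rw [e, residueSign_two, pairProd_two, signedSquare]
    simp only [mem_singleton, exists_eq_left]
    push_cast
    split_ifs <;> simp only [Nat.ModEq, Int.ModEq] at * <;> first | (exfalso; omega) | ring
  rw [sum_congr rfl h4, sum_neg_distrib, h3] at key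
  rw [h1, h2]
  linarith

/-- The case `d = 3`, `m = 2` of the second family. Both indices lie in the class of `1` modulo `3`,
and the condition `k₁ < k₂` is removed by symmetry. -/
theorem triangleNum_eight_mixed (n : ℕ) : (triangleNum 8 n : ℚ) =
    1 / (2 * 3 ^ 2) *
      (∑ p ∈ posSol 2 (3 * n + 3) with (∀ i, Odd (p.2 i)) ∧
          (p.1 0 : ℤ) ≡ -p.1 1 [ZMOD 3] ∧ ¬ (p.1 0 : ℤ) ≡ 0 [ZMOD 3],
          ((p.1 0 : ℚ) + p.1 1) ^ 2 -
        ∑ p ∈ posSol 2 (3 * n + 3) with (∀ i, Odd (p.2 i)) ∧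
          (p.1 0 : ℤ) ≡ p.1 1 [ZMOD 3] ∧ ¬ (p.1 0 : ℤ) ≡ 0 [ZMOD 3],
          ((p.1 0 : ℚ) - p.1 1) ^ 2) := by
  have key := mixedFamily_odd (d := 3) (m := 2) (3 * n) (by decide) (Or.inr ⟨by norm_num, rfl⟩)
  rw [triangleNumDiv_mul (by norm_num)] at key
  norm_num [factorialProd] at key
  have h1 : ∑ p ∈ posSol 2 (3 * n + 3) with (∀ i, Odd (p.2 i)) ∧
          (p.1 0 : ℤ) ≡ -p.1 1 [ZMOD 3] ∧ ¬ (p.1 0 : ℤ) ≡ 0 [ZMOD 3],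
          ((p.1 0 : ℚ) + p.1 1) ^ 2 -
        ∑ p ∈ posSol 2 (3 * n + 3) with (∀ i, Odd (p.2 i)) ∧
          (p.1 0 : ℤ) ≡ p.1 1 [ZMOD 3] ∧ ¬ (p.1 0 : ℤ) ≡ 0 [ZMOD 3],
          ((p.1 0 : ℚ) - p.1 1) ^ 2 =
      ∑ p ∈ posSol 2 (3 * n + 3) with (∀ i, Odd (p.2 i)) ∧ p.1 0 % 3 ≠ 0 ∧ p.1 1 % 3 ≠ 0,
        signedSquare 3 p := by
    rw [sum_filter, sum_filter, sum_filter, ← sum_sub_distrib]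
    refine sum_congr rfl fun p _ => ?_
    by_cases h : ∀ i, Odd (p.2 i)
    · rw [signedSquare]
      simp only [eq_true h, true_and]
      split_ifs <;> simp only [Int.ModEq] at * <;> first | (exfalso; omega) | ring
    · rw [if_neg fun h' => h h'.1, if_neg fun h' => h h'.1, if_neg fun h' => h h'.1, sub_zero]
  have h2 := sum_eq_two_mul_sum_lt (N := 3 * n + 3)
    (P := fun p => (∀ i, Odd (p.2 i)) ∧ p.1 0 % 3 ≠ 0 ∧ p.1 1 % 3 ≠ 0) (f := signedSquare 3)
    (fun p hp => ⟨Fin.forall_fin_two.2 ⟨hp.1 1, hp.1 0⟩, hp.2.2, hp.2.1⟩)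
    (fun p _ => signedSquare_swapPairs 3 p)
    fun p hp h => signedSquare_eq_zero h (by have := hp.2; rw [Int.ModEq]; omega)
  have h3 : mixedSol 3 2 (3 + 3 * n) = {p ∈ posSol 2 (3 * n + 3) |
      ((∀ i, Odd (p.2 i)) ∧ p.1 0 % 3 ≠ 0 ∧ p.1 1 % 3 ≠ 0) ∧ p.1 0 < p.1 1} := by
    rw [mixedSol, add_comm 3]
    refine filter_congr fun p _ => ?_
    simp only [and_assoc]
    refine and_congr_right fun h => ?_
    simp only [OrderedMod, CongrPM, Fin.forall_fin_two, Int.ModEq]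
    norm_num
    omega
  have h4 : ∀ p ∈ mixedSol 3 2 (3 + 3 * n), residueSign 3 {2} p.1 *
      (∏ i with p.1 i ≡ 0 [MOD 3], (p.1 i : ℚ) ^ 3) * pairProd 3 p.1 =
        -signedSquare 3 p := fun p hp => by
    rw [h3] at hp
    have := (mem_filter.1 hp).2.1.2
    rw [residueSign_two, pairProd_two, prod_filter, Fin.prod_univ_two,
      if_neg (show ¬p.1 0 ≡ 0 [MOD 3] from this.1),
      if_neg (show ¬p.1 1 ≡ 0 [MOD 3] from this.2), signedSquare]
    simp only [mem_singleton, exists_eq_left]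
    push_cast
    split_ifs <;> simp only [Nat.ModEq, Int.ModEq] at * <;> first | (exfalso; omega) | ring
  rw [sum_congr rfl h4, sum_neg_distrib, h3] at key
  rw [h1, h2]
  linarith

/- All quotients of natural numbers below are exact, except that for `m = 0` some of the
differences and quotients are truncated to `0`; they then occur only in an exponent that is
multiplied by `m = 0`, or as the upper end of an empty product. -/
theorem mainTheorem2 :
    -- the first family, `d` odd
    (∀ d m x : ℕ, Odd d → d ∣ m →
      ∑ p ∈ oddSol d m (m ^ 2 + x),
          residueSign (2 * d) {r ∈ Icc (d + 2) (2 * d - 1) | Odd r} p.1 *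
            (∏ i with p.1 i ≡ d [MOD 2 * d], (p.1 i : ℚ)) * pairProd (2 * d) p.1 =
        (-1) ^ ((d - 1) / 2 * (m / d)) *
          ((2 : ℚ) ^ (2 * m - d - 1) * (d : ℚ) ^ (2 * m - d)) ^ (m / d) *
          factorialProd ((2 * m - d) / d) d * triangleNumDiv (4 * m ^ 2 / d) x (2 * d)) ∧
    -- the first family, `d` even
    (∀ d m x : ℕ, 0 < d → Even d → d ∣ 2 * m →
      ∑ p ∈ oddSol d m (m ^ 2 + x),
          residueSign (2 * d) {r ∈ Icc (d + 1) (2 * d - 1) | Odd r} p.1 * pairProd (2 * d) p.1 =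
        (-1) ^ (d / 2 * (2 * m / d).choose 2) * (2 * d : ℚ) ^ ((2 * m - d) * m / d) *
          factorialProd ((2 * m - d) / d) d * triangleNumDiv (4 * m ^ 2 / d) x (2 * d)) ∧
    -- the second family, `d` odd, with the two cases of the constant
    (∀ d m x : ℕ, Odd d → ∀ A : ℚ,
      (d ∣ m ∧ A = (-1) ^ ((d - 1).choose 2 * (2 * m / d).choose 2) * ((2 : ℚ) ^ (m / d))⁻¹ *
          ((2 * m / d).factorial : ℚ) * factorialProd ((2 * m - d) / d) d ∨
        d ∣ m + 1 ∧ A = (-1) ^ ((d - 1).choose 2 * (2 * (m + 1) / d).choose 2) *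
          ((2 : ℚ) ^ ((m + 1 - d) / d))⁻¹ * (((2 * m + 2 - d) / d).factorial : ℚ)⁻¹ *
          factorialProd ((2 * m + 2 - d) / d) d) →
      ∑ p ∈ mixedSol d m (m * (m + 1) / 2 + x),
          residueSign d (Icc ((d + 1) / 2) (d - 1)) p.1 *
            (∏ i with p.1 i ≡ 0 [MOD d], (p.1 i : ℚ) ^ 3) * pairProd d p.1 =
        A * (d : ℚ) ^ ((2 * m + 2 - d) * m / d) *
          triangleNumDiv (4 * m * (m + 1) / d) x d) ∧
    -- the second family, `d` even, with the two cases of the constant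
    (∀ d m x : ℕ, 0 < d → Even d → ∀ B : ℚ,
      (d ∣ 2 * m ∧ B = (-1) ^ ((d - 1).choose 2 * (2 * m / d).choose 2) *
          ((2 : ℚ) ^ (2 * m / d))⁻¹ * ((2 * m / d).factorial : ℚ) *
          factorialProd ((2 * m - d) / d) d ∨
        d ∣ 2 * m + 2 ∧ B = (-1) ^ ((d - 1).choose 2 * (2 * (m + 1) / d).choose 2) *
          ((2 : ℚ) ^ ((2 * m + 2 - d) / d))⁻¹ * (((2 * m + 2 - d) / d).factorial : ℚ)⁻¹ *
          factorialProd ((2 * m + 2 - d) / d) d) →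
      ∑ p ∈ mixedSol d m (m * (m + 1) / 2 + x),
          residueSign d (Icc ((d + 2) / 2) (d - 1)) p.1 *
            (∏ i with p.1 i ≡ 0 [MOD d], (p.1 i : ℚ) ^ 3) *
            (∏ i with p.1 i ≡ d / 2 [MOD d], (p.1 i : ℚ)) * pairProd d p.1 =
        B * (d : ℚ) ^ ((2 * m + 2 - d) * m / d) *
          triangleNumDiv (4 * m * (m + 1) / d) x d) ∧
    -- the Getz–Mahlburg identity
    (∀ m x : ℕ, 0 < m →
      ∑ p ∈ posSol m (m ^ 2 + x) with (∀ i, Odd (p.1 i) ∧ Odd (p.2 i)) ∧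
            ∀ i : Fin m, CongrPM (4 * m) (p.1 i) (2 * (i : ℤ) + 1),
          (-1 : ℚ) ^ #{i : Fin m | (p.1 i : ℤ) ≡ 1 - 2 * ((i : ℤ) + 1) [ZMOD 4 * m]} =
        triangleNumDiv (2 * m) x (4 * m)) ∧
    -- its analogue in the second family
    (∀ m x : ℕ,
      ∑ p ∈ posSol m (m * (m + 1) / 2 + x) with (∀ i, Odd (p.2 i)) ∧
            ∀ i : Fin m, CongrPM (2 * m + 2) (p.1 i) ((i : ℤ) + 1),
          (-1 : ℚ) ^ #{i : Fin m | (p.1 i : ℤ) ≡ -((i : ℤ) + 1) [ZMOD 2 * m + 2]} =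
        triangleNumDiv (2 * m) x (2 * m + 2)) ∧
    -- sums of 4 triangles
    (∀ n : ℕ, (triangleNum 4 n : ℚ) =
      ∑ p ∈ posSol 2 (6 * n + 3) with (∀ i, Odd (p.2 i)) ∧
          CongrPM 6 (p.1 0) 1 ∧ CongrPM 6 (p.1 1) 2,
        (-1 : ℚ) ^ ((if (p.1 0 : ℤ) ≡ -1 [ZMOD 6] then 1 else 0) +
          (if (p.1 1 : ℤ) ≡ -2 [ZMOD 6] then 1 else 0))) ∧
    -- sums of 6 triangles
    (∀ n : ℕ, (triangleNum 6 n : ℚ) =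
      1 / 2 * ∑ p ∈ posSol 2 (4 * n + 3) with (∀ i, Odd (p.2 i)) ∧
          Odd (p.1 0) ∧ p.1 1 ≡ 2 [MOD 4],
        (-1 : ℚ) ^ ((p.1 0 - 1) / 2) * (p.1 1 : ℚ)) ∧
    -- sums of 8 triangles, from the first family
    (∀ n : ℕ, (triangleNum 8 n : ℚ) =
      1 / 2 ^ 5 *
        (∑ p ∈ posSol 2 (4 * n + 4) with (∀ i, Odd (p.1 i) ∧ Odd (p.2 i)) ∧
            (p.1 0 : ℤ) ≡ -p.1 1 [ZMOD 4], ((p.1 0 : ℚ) + p.1 1) ^ 2 -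
          ∑ p ∈ posSol 2 (4 * n + 4) with (∀ i, Odd (p.1 i) ∧ Odd (p.2 i)) ∧
            (p.1 0 : ℤ) ≡ p.1 1 [ZMOD 4], ((p.1 0 : ℚ) - p.1 1) ^ 2)) ∧
    -- sums of 8 triangles, from the second family
    (∀ n : ℕ, (triangleNum 8 n : ℚ) =
      1 / (2 * 3 ^ 2) *
        (∑ p ∈ posSol 2 (3 * n + 3) with (∀ i, Odd (p.2 i)) ∧
            (p.1 0 : ℤ) ≡ -p.1 1 [ZMOD 3] ∧ ¬ (p.1 0 : ℤ) ≡ 0 [ZMOD 3],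
            ((p.1 0 : ℚ) + p.1 1) ^ 2 -
          ∑ p ∈ posSol 2 (3 * n + 3) with (∀ i, Odd (p.2 i)) ∧
            (p.1 0 : ℤ) ≡ p.1 1 [ZMOD 3] ∧ ¬ (p.1 0 : ℤ) ≡ 0 [ZMOD 3],
            ((p.1 0 : ℚ) - p.1 1) ^ 2)) ∧
    -- sums of 12 triangles
    (∀ n : ℕ, (triangleNum 12 n : ℚ) =
      1 / 2 ^ 3 * ∑ p ∈ posSol 2 (2 * n + 3) with (∀ i, Odd (p.2 i)) ∧
          Odd (p.1 0) ∧ Even (p.1 1),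
        (p.1 0 : ℚ) * (p.1 1 : ℚ) ^ 3) := by
  exact ⟨fun d m x hd hm => oddFamily_odd x hd hm, fun d m x h0 hd hm => oddFamily_even x h0 hd hm,
    fun d m x hd A hA => mixedFamily_odd x hd hA,
    fun d m x h0 hd B hB => mixedFamily_even x h0 hd hB,
    fun m x hm => getzMahlburg x hm, getzMahlburg_mixed, triangleNum_four, triangleNum_six,
    triangleNum_eight_odd, triangleNum_eight_mixed, triangleNum_twelve⟩
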